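/- For integers $d\ge 1$ let the $d$-dimensional MacMahon numbers $m_d(n)$ be defined by $$\sum_{n\ge 0} m_d(n)\,q^n=\prod_{n\ge 1}(1-q^n)^{-\binom{n+d-2}{d-1}} .$$ Let $D_d(s)$ be the meromorphic continuation to $\mathbb C$ of the Dirichlet series $\sum_{n\ge1}\binom{n+d-2}{d-1}n^{-s}$, let $A_k$ ($1\le k\le d$) be its residue at $s=k$ (zero if there is no pole), and put $$C_k=C_k^{(d)}=A_k\,\Gamma(k+1)\,\zeta(k+1),\qquad G_d(t)=\sum_{k=1}^{d}\frac{C_k}{k\,t^k}+nt .$$ **Asymptotic expansion.** There are real constants $\beta^{(d)}_r$ ($1\le r\le d$), $\gamma^{(d)}$, $\delta^{(d)}$, for every $d\ge 1$, such that $$\log m_d(n)=\sum_{r=1}^{d}\beta^{(d)}_r\,n^{\frac{d-r+1}{d+1}}+\gamma^{(d)}\log n+\delta^{(d)}+o(1)\qquad(n\to\infty),$$ with leading constant $\beta_1^{(d)}=\frac{d+1}{d}\,[d\,\zeta(d+1)]^{1/(d+1)}$ for every $d\ge1$. **Saddle point formula.** For every $d\ge1$ and $n\ge 1$ the equation $\sum_{k=1}^{d}C_k\,t^{-(k+1)}-n=0$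 has exactly one positive root $t_*=t_*(n)$, and for every $0<\alpha<1$, as $n\to\infty$, $$m_d(n)=\sqrt{\frac{1}{2\pi G_d''(t_*)}}\;t_*^{-D_d(0)}\,\exp\big(G_d(t_*)+D_d'(0)\big)\,\big(1+O(t_*^{\alpha})\big).$$ **Explicit constants for $d=3,4,5$.** * $d=3$: with $C_1=0$, $C_2=\zeta(3)$, $C_3=3\zeta(4)$, one has $\gamma^{(3)}=-\frac{61}{96}$ and $$\beta^{(3)}_1=\tfrac43C_3^{1/4},\quad \beta^{(3)}_2=\frac{C_2}{2C_3^{2/4}},\quad \beta^{(3)}_3=\frac{8C_1C_3-C_2^2}{8C_3^{5/4}}.$$ * $d=4$: with $C_1=0$, $C_2=\frac23\zeta(3)$, $C_3=3\zeta(4)$, $C_4=4\zeta(5)$, one has $\gamma^{(4)}=-\frac{2179}{3600}$ and $$\beta^{(4)}_1=\tfrac54C_4^{1/5},\quad \beta^{(4)}_2=\frac{C_3}{3C_4^{3/5}},\quad \beta^{(4)}_3=\frac{5C_2C_4-C_3^2}{10C_4^{7/5}},\quad \beta^{(4)}_4=\frac{C_3^3-5C_2C_4C_3+25C_1C_4^2}{25C_4^{11/5}}.$$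 * $d=5$: with $C_1=0$, $C_2=\frac12\zeta(3)$, $C_3=\frac{11}4\zeta(4)$, $C_4=6\zeta(5)$, $C_5=5\zeta(6)$, one has $\gamma^{(5)}=-\frac{563}{960}$ and $$\beta^{(5)}_1=\tfrac65C_5^{1/6},\quad \beta^{(5)}_2=\frac{C_4}{4C_5^{2/3}},\quad \beta^{(5)}_3=\frac{4C_3C_5-C_4^2}{12C_5^{3/2}},\quad \beta^{(5)}_4=\frac{2C_4^3-9C_3C_5C_4+27C_2C_5^2}{54C_5^{7/3}},$$ $$\beta^{(5)}_5=\frac{-91C_4^4+504C_3C_5C_4^2-864C_2C_5^2C_4+432C_5^2(12C_1C_5-C_3^2)}{5184\,C_5^{19/6}}.$$ -/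

import Mathlib

open Filter Topology Asymptotics
open scoped PowerSeries.WithPiTopology

/-- The exponent `binom(n+d-2, d-1)` in the MacMahon product (used for `d ≥ 1`, `n ≥ 1`). -/
def macMahonExponent (d n : ℕ) : ℕ := Nat.choose (n + d - 2) (d - 1)

/-- The formal power series `M_d(q) = ∏_{n ≥ 1} (1 - q^n)^{-binom(n+d-2, d-1)}`; the infinite
product is taken in the topology of coefficientwise convergence. -/
noncomputable def macMahonSeries (d : ℕ) : PowerSeries ℝ :=
  ∏' n : ℕ, ((1 - PowerSeries.X ^ (n + 1)) ^ macMahonExponent d (n + 1))⁻¹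

/-- The infinite product defining `macMahonSeries` converges. -/
theorem macMahonSeries_multipliable (d : ℕ) :
    Multipliable fun n : ℕ =>
      (((1 - PowerSeries.X ^ (n + 1)) ^ macMahonExponent d (n + 1))⁻¹ : PowerSeries ℝ) := by
  have key : ∀ n : ℕ, ∃ g : PowerSeries ℝ,
      (((1 - PowerSeries.X ^ (n + 1)) ^ macMahonExponent d (n + 1))⁻¹ : PowerSeries ℝ)
        = 1 + PowerSeries.X ^ (n + 1) * g := by
    intro n
    set a := macMahonExponent d (n + 1)
    set u : PowerSeries ℝ := (1 - PowerSeries.X ^ (n + 1)) ^ a with hu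
    have hc : PowerSeries.constantCoeff u ≠ 0 := by
      simp [hu]
    have hdvd : (PowerSeries.X ^ (n + 1) : PowerSeries ℝ) ∣ 1 - u := by
      have := sub_dvd_pow_sub_pow (1 : PowerSeries ℝ) (1 - PowerSeries.X ^ (n + 1)) a
      simpa [hu] using this
    obtain ⟨v, hv⟩ := hdvd
    refine ⟨u⁻¹ * v, ?_⟩
    have h1 : u⁻¹ * u = 1 := PowerSeries.inv_mul_cancel u hc
    calc u⁻¹ = u⁻¹ * u + u⁻¹ * (1 - u) := by ring
      _ = 1 + PowerSeries.X ^ (n + 1) * (u⁻¹ * v) := by rw [h1, hv]; ring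
  choose g hg using key
  simp_rw [hg]
  apply PowerSeries.WithPiTopology.multipliable_one_add_of_tendsto_order_atTop_nhds_top
  rw [ENat.tendsto_nhds_top_iff_natCast_lt]
  intro m
  filter_upwards [eventually_ge_atTop m] with n hn
  have h1 : ((n + 1 : ℕ) : ℕ∞) ≤ (PowerSeries.X ^ (n + 1) * g n).order := by
    apply PowerSeries.nat_le_order
    intro i hi
    rw [PowerSeries.coeff_X_pow_mul']
    simp [Nat.not_le.mpr hi]
  refine lt_of_lt_of_le ?_ h1
  exact_mod_cast Nat.lt_succ_of_le hn

/-- The `d`-dimensional MacMahon number `m_d(n)`, the coefficient of `q^n` in `M_d(q)`. -/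
noncomputable def macMahonNumber (d n : ℕ) : ℝ := PowerSeries.coeff n (macMahonSeries d)

/-- The polynomial `x(x+1)⋯(x+d-2)/(d-1)!`, whose value at an integer `n ≥ 1` is
`binom(n+d-2, d-1)`. -/
noncomputable def macMahonPoly (d : ℕ) : Polynomial ℝ :=
  Polynomial.C ((Nat.factorial (d - 1) : ℝ)⁻¹) * ascPochhammer ℝ (d - 1)

theorem macMahonPoly_eval (d n : ℕ) (hd : 1 ≤ d) (hn : 1 ≤ n) :
    (macMahonPoly d).eval (n : ℝ) = macMahonExponent d n := by
  obtain ⟨k, rfl⟩ := Nat.exists_eq_add_of_le' hd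
  obtain ⟨m, rfl⟩ := Nat.exists_eq_add_of_le' hn
  have h2 : m + 1 + (k + 1) - 2 = m + k := by omega
  have h3 : (ascPochhammer ℝ k).eval ((m + 1 : ℕ) : ℝ)
      = ((Nat.factorial k * Nat.choose (m + k) k : ℕ) : ℝ) := by
    rw [← ascPochhammer_eval_cast, ascPochhammer_nat_eq_ascFactorial,
      Nat.ascFactorial_eq_factorial_mul_choose]
  have hk : (Nat.factorial k : ℝ) ≠ 0 := by positivity
  simp only [macMahonPoly, macMahonExponent, Polynomial.eval_mul, Polynomial.eval_C,
    Nat.add_sub_cancel, h2, h3]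
  push_cast
  field_simp

theorem macMahonPoly_natDegree_lt (d : ℕ) (hd : 1 ≤ d) : (macMahonPoly d).natDegree < d := by
  have h := Polynomial.natDegree_C_mul_le ((Nat.factorial (d - 1) : ℝ)⁻¹) (ascPochhammer ℝ (d - 1))
  rw [ascPochhammer_natDegree] at h
  unfold macMahonPoly
  omega

/-- The meromorphic continuation to `ℂ` of the Dirichlet series
`D_d(s) = ∑_{n ≥ 1} binom(n+d-2, d-1) n^{-s}`, written as a combination of shifted zeta functions;
`macMahonDirichlet_hasSum` shows that it is the Dirichlet series for `Re s > d`. -/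
noncomputable def macMahonDirichlet (d : ℕ) (s : ℂ) : ℂ :=
  ∑ j ∈ Finset.range d, ((macMahonPoly d).coeff j : ℂ) * riemannZeta (s - j)

theorem macMahonDirichlet_hasSum (d : ℕ) (hd : 1 ≤ d) (s : ℂ) (hs : (d : ℝ) < s.re) :
    HasSum (fun n : ℕ => (macMahonExponent d (n + 1) : ℂ) / ((n + 1 : ℕ) : ℂ) ^ s)
      (macMahonDirichlet d s) := by
  have key : ∀ j ∈ Finset.range d, HasSum
      (fun n : ℕ => ((macMahonPoly d).coeff j : ℂ) *
        (1 / ((n + 1 : ℕ) : ℂ) ^ (s - j)))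
      (((macMahonPoly d).coeff j : ℂ) * riemannZeta (s - j)) := by
    intro j hj
    have hj' : (j : ℝ) + 1 ≤ d := by exact_mod_cast Finset.mem_range.mp hj
    have hre : 1 < (s - j).re := by
      simp only [Complex.sub_re, Complex.natCast_re]; linarith
    apply HasSum.mul_left
    have hsum : Summable fun n : ℕ => 1 / ((n + 1 : ℕ) : ℂ) ^ (s - j) :=
      (summable_nat_add_iff (f := fun n : ℕ => 1 / (n : ℂ) ^ (s - j)) 1).mpr
        (Complex.summable_one_div_nat_cpow.mpr hre)
    have hz := zeta_eq_tsum_one_div_nat_add_one_cpow hre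
    rw [hz]
    simpa using hsum.hasSum
  have h := hasSum_sum key
  unfold macMahonDirichlet
  refine h.congr_fun ?_
  intro n
  have hn : ((n + 1 : ℕ) : ℂ) ≠ 0 := by exact_mod_cast Nat.succ_ne_zero n
  have hev := macMahonPoly_eval d (n + 1) hd (Nat.succ_le_succ (Nat.zero_le n))
  rw [Polynomial.eval_eq_sum_range' (macMahonPoly_natDegree_lt d hd)] at hev
  have hev' : (macMahonExponent d (n + 1) : ℂ)
      = ∑ j ∈ Finset.range d, ((macMahonPoly d).coeff j : ℂ) * ((n + 1 : ℕ) : ℂ) ^ j := by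
    have := congrArg (fun x : ℝ => (x : ℂ)) hev
    push_cast at this ⊢
    exact this.symm
  rw [hev', Finset.sum_div]
  refine Finset.sum_congr rfl fun j _ => ?_
  rw [Complex.cpow_sub _ _ hn, Complex.cpow_natCast]
  field_simp

/-- The residue `A_k` of `D_d` at `s = k` (for `k ≥ 1`), see `macMahonResidue_spec`. -/
noncomputable def macMahonResidue (d k : ℕ) : ℝ := (macMahonPoly d).coeff (k - 1)

theorem macMahonResidue_spec (d k : ℕ) (hd : 1 ≤ d) (hk : 1 ≤ k) :
    Tendsto (fun s : ℂ => (s - k) * macMahonDirichlet d s) (𝓝[≠] (k : ℂ))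
      (𝓝 (macMahonResidue d k : ℂ)) := by
  obtain ⟨i, rfl⟩ := Nat.exists_eq_add_of_le' hk
  have hterm : ∀ j : ℕ, Tendsto
      (fun s : ℂ => (s - (i + 1 : ℕ)) * (((macMahonPoly d).coeff j : ℂ) * riemannZeta (s - j)))
      (𝓝[≠] ((i + 1 : ℕ) : ℂ)) (𝓝 (if j = i then ((macMahonPoly d).coeff j : ℂ) else 0)) := by
    intro j
    by_cases hji : j = i
    · subst hji
      have h1 : Tendsto (fun s : ℂ => s - j) (𝓝[≠] ((j + 1 : ℕ) : ℂ)) (𝓝[≠] 1) := by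
        rw [tendsto_nhdsWithin_iff]
        constructor
        · have : Tendsto (fun s : ℂ => s - j) (𝓝 ((j + 1 : ℕ) : ℂ))
              (𝓝 (((j + 1 : ℕ) : ℂ) - j)) := (continuous_id.sub continuous_const).tendsto _
          have he : (((j + 1 : ℕ) : ℂ) - j) = 1 := by push_cast; ring
          rw [he] at this
          exact this.mono_left nhdsWithin_le_nhds
        · filter_upwards [self_mem_nhdsWithin] with s hs h
          apply hs
          simp only [Set.mem_singleton_iff] at h ⊢
          push_cast
          linear_combination h
      have h2 := (riemannZeta_residue_one.comp h1).const_mul ((macMahonPoly d).coeff j : ℂ)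
      simp only [if_true, mul_one] at h2 ⊢
      refine h2.congr fun s => ?_
      simp only [Function.comp]
      push_cast
      ring
    · have hne : (((i + 1 : ℕ) : ℂ) - j) ≠ 1 := by
        intro h
        apply hji
        have : (i : ℂ) = j := by push_cast at h; linear_combination h
        exact_mod_cast this.symm
      have hc : ContinuousAt
          (fun s : ℂ => (s - (i + 1 : ℕ)) * (((macMahonPoly d).coeff j : ℂ) * riemannZeta (s - j)))
          ((i + 1 : ℕ) : ℂ) := by
        refine ContinuousAt.mul (by fun_prop) (ContinuousAt.mul continuousAt_const ?_)
        exact ContinuousAt.comp (g := riemannZeta) (f := fun s : ℂ => s - j)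
          (differentiableAt_riemannZeta hne).continuousAt (by fun_prop)
      have := hc.tendsto.mono_left (nhdsWithin_le_nhds (s := {((i + 1 : ℕ) : ℂ)}ᶜ))
      simpa [hji] using this
  have hs := tendsto_finsetSum (Finset.range d) fun j _ => hterm j
  have he : (∑ j ∈ Finset.range d, (if j = i then ((macMahonPoly d).coeff j : ℂ) else 0))
      = (macMahonResidue d (i + 1) : ℂ) := by
    rw [Finset.sum_ite_eq' (Finset.range d) i]
    simp only [macMahonResidue, Nat.add_sub_cancel]
    split_ifs with h
    · rfl
    · rw [Polynomial.coeff_eq_zero_of_natDegree_lt]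
      · simp
      · have := macMahonPoly_natDegree_lt d hd
        simp only [Finset.mem_range] at h
        omega
  rw [he] at hs
  refine hs.congr fun s => ?_
  rw [macMahonDirichlet, Finset.mul_sum]

/-- The real value of the Riemann zeta function at an integer. -/
noncomputable def zetaR (k : ℕ) : ℝ := (riemannZeta (k : ℂ)).re

/-- `C_k = A_k Γ(k+1) ζ(k+1)`. -/
noncomputable def macMahonC (d k : ℕ) : ℝ :=
  macMahonResidue d k * Real.Gamma (k + 1) * zetaR (k + 1)

/-- `G_d(t) = ∑_{k=1}^d C_k / (k t^k) + n t`. -/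
noncomputable def macMahonG (d n : ℕ) (t : ℝ) : ℝ :=
  ∑ k ∈ Finset.Icc 1 d, macMahonC d k / (k * t ^ k) + n * t

/-!
The proof is Meinardus' method in real-variable form. It rests on the double series
`log M_d(e^{-z}) = ∑_{n,m} (binom(n+d-2, d-1) / m) e^{-nmz}` (`logM`), whose derivatives on the real
axis are, up to sign, the moments `∑ weight * freq ^ r * e^{-freq t}` (`moment`).

*Behaviour at `t → 0`.* Summing over `n` first gives `∑_m g(mt) / m` with
`g(w) = e^{-w} / (1 - e^{-w})^d` (`kernel`). The Laurent expansion of `g` and a Riemann sum estimate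
for its remainder give an expansion of `log M_d(e^{-t})` in `t^{-d}, …, t^{-1}, log t, 1` up to
`O(t)` (`exists_real_expansion`). Its coefficients are found by comparing poles of Mellin transforms
in `mellin (log M_d) s = Γ(s) ζ(s+1) D_d(s)`, which has to be continued only to `Re s > -1`
(`eventually_mellin_identity`, `exists_abs_moment_sub_le`); no growth estimates on vertical lines are
needed. Convexity and fourth order bounds turn this into asymptotics of the first two derivatives
(`exists_moment_one_asymp`, `exists_moment_two_asymp`).

*Saddle point.* In Cauchy's formula (`macMahonNumber_eq_integral`) the part `|y| ≤ δt` of the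
integral is compared with a Gaussian one (`norm_integral_exp_sub_gaussian_le`); on the rest the
integrand is smaller by a factor `exp(-c t^{-d})` (`exists_logM_re_le`). At the root of
`∑ C_k t^{-(k+1)} = n` this gives the saddle point formula with relative error `O(t)`
(`exists_macMahonNumber_asymp`). The root exists and is unique because all `C_k ≥ 0` and `C_d > 0`.

*Expansion.* With `P(t) = ∑ C_k t^{d-k}` and `S = P^{1/(d+1)}` the saddle point equation reads
`n^{1/(d+1)} = S(t) / t`, and `G_d(t) = Q(t) / t^d` for a polynomial `Q`. Expanding
`Q(t) = ∑_{i ≤ d} b_i t^i S(t)^{d-i} + O(t^{d+1})` (`exists_taylor_mul_pow`) and dividing by `t^d`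
gives `G_d(t) = ∑_{i ≤ d} b_i n^{(d-i)/(d+1)} + O(t)`, so that `β_r = b_{r-1}` without inverting the
map `t ↦ n`. The logarithms contribute `γ = (D_d(0) - (d+2)/2) / (d+1)`. For `i < d` the `b_i`
are unique and depend only on `S` modulo `t^d` (`IsHeightExpansion.coeff_eq`), so for `d = 3, 4, 5` they are
confirmed by a polynomial approximation of `S`.
-/

namespace MacMahon

/-! ### The logarithm of the generating function as a Dirichlet-type sum -/

/-- The index `p = (i, j)` stands for the pair `(n, m) = (i + 1, j + 1)` in
`log ∏ (1 - q^n)^{-a n} = ∑_{n,m} (a n / m) q^{n m}`; this is the coefficient `a n / m`. -/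
noncomputable def weight (d : ℕ) (p : ℕ × ℕ) : ℝ := macMahonExponent d (p.1 + 1) / (p.2 + 1)

/-- The exponent `n m` belonging to the index `p = (n - 1, m - 1)`. -/
def freq (p : ℕ × ℕ) : ℝ := (p.1 + 1) * (p.2 + 1)

/-- `moment d r t = ∑ weight * freq ^ r * e^{-freq t}`, that is `(-1)^r` times the `r`-th derivative
of `log M_d(e^{-t})`. -/
noncomputable def moment (d r : ℕ) (t : ℝ) : ℝ :=
  ∑' p, weight d p * freq p ^ r * Real.exp (-(freq p * t))

/-- `log M_d(e^{-z})` for `Re z > 0`, the branch that is real on the positive axis. -/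
noncomputable def logM (d : ℕ) (z : ℂ) : ℂ :=
  ∑' p, (weight d p : ℂ) * Complex.exp (-(freq p * z))

/-- `∑_{n ≥ 1} binom(n+d-2, d-1) e^{-n w} = e^{-w} / (1 - e^{-w})^d`. -/
noncomputable def kernel (d : ℕ) (w : ℝ) : ℝ := Real.exp (-w) / (1 - Real.exp (-w)) ^ d

lemma weight_nonneg (d : ℕ) (p : ℕ × ℕ) : 0 ≤ weight d p := by
  unfold weight; positivity

lemma one_le_freq (p : ℕ × ℕ) : 1 ≤ freq p := by
  unfold freq
  have h1 : (0 : ℝ) ≤ p.1 := by positivity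
  have h2 : (0 : ℝ) ≤ p.2 := by positivity
  nlinarith [mul_nonneg h1 h2]

lemma freq_pos (p : ℕ × ℕ) : 0 < freq p := one_pos.trans_le (one_le_freq p)

lemma exponent_succ {d : ℕ} (hd : 1 ≤ d) (n : ℕ) :
    macMahonExponent d (n + 1) = (n + (d - 1)).choose (d - 1) := by
  unfold macMahonExponent
  congr 1
  omega

lemma hasSum_exponent_mul_pow {d : ℕ} (hd : 1 ≤ d) {q : ℂ} (hq : ‖q‖ < 1) :
    HasSum (fun n : ℕ => (macMahonExponent d (n + 1) : ℂ) * q ^ (n + 1)) (q / (1 - q) ^ d) := by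
  have h := (hasSum_choose_mul_geometric_of_norm_lt_one (d - 1) hq).mul_left q
  rw [Nat.sub_add_cancel hd] at h
  rw [mul_one_div] at h
  refine h.congr_fun fun n => ?_
  rw [exponent_succ hd]; ring

lemma hasSum_kernel {d : ℕ} (hd : 1 ≤ d) {w : ℝ} (hw : 0 < w) :
    HasSum (fun n : ℕ => (macMahonExponent d (n + 1) : ℝ) * Real.exp (-((n + 1) * w)))
      (kernel d w) := by
  have hlt : Real.exp (-w) < 1 := by rw [Real.exp_lt_one_iff]; linarith
  have h := (hasSum_choose_mul_geometric_of_norm_lt_one (d - 1) (r := Real.exp (-w))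
    (by rwa [Real.norm_of_nonneg (Real.exp_pos _).le])).mul_left (Real.exp (-w))
  rw [Nat.sub_add_cancel hd] at h
  rw [mul_one_div] at h
  refine h.congr_fun fun n => ?_
  have : Real.exp (-((n + 1) * w)) = Real.exp (-w) * Real.exp (-w) ^ n := by
    rw [← Real.exp_nat_mul, ← Real.exp_add]; ring_nf
  rw [exponent_succ hd, this]; ring

lemma summable_exp_neg_succ_mul {t : ℝ} (ht : 0 < t) :
    Summable fun n : ℕ => Real.exp (-((n + 1) * t)) := by
  have h := (hasSum_kernel (d := 1) le_rfl ht).summable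
  simpa [macMahonExponent] using h

lemma summable_weight_mul_exp {d : ℕ} (hd : 1 ≤ d) {t : ℝ} (ht : 0 < t) :
    Summable fun p => weight d p * Real.exp (-(freq p * t)) := by
  have h1 := (hasSum_kernel hd (half_pos ht)).summable
  have h2 := summable_exp_neg_succ_mul (half_pos ht)
  have h := h1.mul_of_nonneg h2 (fun n => by positivity) (fun n => by positivity)
  refine Summable.of_nonneg_of_le (fun p => mul_nonneg (weight_nonneg d p) (by positivity))
    (fun p => ?_) h
  have hx : (0 : ℝ) ≤ p.1 := by positivity
  have hy : (0 : ℝ) ≤ p.2 := by positivity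
  rw [mul_assoc, ← Real.exp_add]
  refine mul_le_mul ?_ (Real.exp_le_exp.mpr ?_) (by positivity) (by positivity)
  · unfold weight
    exact div_le_self (by positivity) (by linarith)
  · have : 0 ≤ (p.1 : ℝ) * p.2 := mul_nonneg hx hy
    unfold freq
    nlinarith [mul_nonneg this ht.le, mul_nonneg hx ht.le, mul_nonneg hy ht.le]

lemma pow_mul_exp_neg_le (r : ℕ) {t : ℝ} (ht : 0 < t) {x : ℝ} (hx : 0 ≤ x) :
    x ^ r * Real.exp (-(x * t)) ≤ r.factorial * (2 / t) ^ r * Real.exp (-(x * (t / 2))) := by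
  have h := Real.pow_div_factorial_le_exp (x * (t / 2)) (by positivity) r
  have hf : (0 : ℝ) < r.factorial := by positivity
  rw [div_le_iff₀ hf] at h
  have h2 : x ^ r = (2 / t) ^ r * (x * (t / 2)) ^ r := by
    rw [← mul_pow]; congr 1; field_simp
  have h3 : Real.exp (-(x * t)) = Real.exp (-(x * (t / 2))) * Real.exp (-(x * (t / 2))) := by
    rw [← Real.exp_add]; ring_nf
  have h4 : Real.exp (x * (t / 2)) * Real.exp (-(x * (t / 2))) = 1 := by
    rw [← Real.exp_add]; simp
  calc x ^ r * Real.exp (-(x * t))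
      ≤ (2 / t) ^ r * (Real.exp (x * (t / 2)) * r.factorial) * Real.exp (-(x * t)) := by
        rw [h2]; gcongr
    _ = r.factorial * (2 / t) ^ r * (Real.exp (x * (t / 2)) * Real.exp (-(x * (t / 2))))
          * Real.exp (-(x * (t / 2))) := by rw [h3]; ring
    _ = _ := by rw [h4]; ring

lemma summable_moment {d : ℕ} (hd : 1 ≤ d) (r : ℕ) {t : ℝ} (ht : 0 < t) :
    Summable fun p => weight d p * freq p ^ r * Real.exp (-(freq p * t)) := by
  refine Summable.of_nonneg_of_le (fun p => ?_) (fun p => ?_)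
    ((summable_weight_mul_exp hd (half_pos ht)).mul_left (r.factorial * (2 / t) ^ r))
  · have := weight_nonneg d p
    have := (freq_pos p).le
    positivity
  · have := mul_le_mul_of_nonneg_left (pow_mul_exp_neg_le r ht (freq_pos p).le) (weight_nonneg d p)
    calc _ = weight d p * (freq p ^ r * Real.exp (-(freq p * t))) := by ring
      _ ≤ _ := this
      _ = _ := by ring

lemma moment_nonneg (d r : ℕ) (t : ℝ) : 0 ≤ moment d r t :=
  tsum_nonneg fun p => by
    have := weight_nonneg d p
    have := (freq_pos p).le
    positivity

lemma moment_le_moment_zero {d : ℕ} (hd : 1 ≤ d) (r : ℕ) {t : ℝ} (ht : 0 < t) :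
    moment d r t ≤ r.factorial * (2 / t) ^ r * moment d 0 (t / 2) := by
  have h := summable_weight_mul_exp hd (half_pos ht)
  unfold moment
  simp only [pow_zero, mul_one]
  rw [← tsum_mul_left]
  refine (summable_moment hd r ht).tsum_le_tsum (fun p => ?_) (h.mul_left _)
  have := mul_le_mul_of_nonneg_left (pow_mul_exp_neg_le r ht (freq_pos p).le) (weight_nonneg d p)
  calc _ = weight d p * (freq p ^ r * Real.exp (-(freq p * t))) := by ring
    _ ≤ _ := this
    _ = _ := by ring

lemma moment_anti {d : ℕ} (hd : 1 ≤ d) (r : ℕ) {s t : ℝ} (hs : 0 < s) (hst : s ≤ t) :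
    moment d r t ≤ moment d r s := by
  refine (summable_moment hd r (hs.trans_le hst)).tsum_le_tsum (fun p => ?_)
    (summable_moment hd r hs)
  have h1 := weight_nonneg d p
  have h2 := (freq_pos p).le
  have : freq p * s ≤ freq p * t := mul_le_mul_of_nonneg_left hst h2
  gcongr

lemma norm_term (d : ℕ) (p : ℕ × ℕ) (z : ℂ) :
    ‖(weight d p : ℂ) * Complex.exp (-(freq p * z))‖
      = weight d p * Real.exp (-(freq p * z.re)) := by
  rw [norm_mul, Complex.norm_exp, Complex.norm_real, Real.norm_of_nonneg (weight_nonneg d p)]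
  simp

lemma summable_logM {d : ℕ} (hd : 1 ≤ d) {z : ℂ} (hz : 0 < z.re) :
    Summable fun p => (weight d p : ℂ) * Complex.exp (-(freq p * z)) := by
  refine Summable.of_norm ?_
  simp_rw [norm_term]
  exact summable_weight_mul_exp hd hz

/-- Summing over `n` first: `log M_d(e^{-t}) = ∑_m g(m t) / m` with `g` the kernel. -/
lemma hasSum_kernel_div {d : ℕ} (hd : 1 ≤ d) {t : ℝ} (ht : 0 < t) :
    HasSum (fun m : ℕ => kernel d ((m + 1) * t) / (m + 1)) (moment d 0 t) := by
  have h := (summable_moment hd 0 ht).hasSum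
  rw [← (Equiv.prodComm ℕ ℕ).hasSum_iff] at h
  refine h.prod_fiberwise fun m => ?_
  have h1 := (hasSum_kernel hd (w := (m + 1) * t) (by positivity)).div_const ((m : ℝ) + 1)
  refine h1.congr_fun fun n => ?_
  simp only [Function.comp, Equiv.prodComm_apply, Prod.swap, weight, freq, pow_zero, mul_one]
  rw [mul_assoc]
  ring

/-! ### Evaluation of the infinite product -/

/-- The power series `f` has nonnegative coefficients and converges absolutely at `q` with value
`v`. The sign condition is part of the notion because it makes the partial products of the MacMahon
product increase coefficientwise, so that the value passes to the limit. -/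
def EvalsTo (f : PowerSeries ℝ) (q v : ℂ) : Prop :=
  (∀ n, 0 ≤ PowerSeries.coeff n f) ∧ (Summable fun n => PowerSeries.coeff n f * ‖q‖ ^ n) ∧
    HasSum (fun n => ((PowerSeries.coeff n f : ℝ) : ℂ) * q ^ n) v

lemma EvalsTo.one (q : ℂ) : EvalsTo 1 q 1 := by
  refine ⟨fun n => ?_, ?_, ?_⟩
  · rw [PowerSeries.coeff_one]; split_ifs <;> norm_num
  · refine summable_of_ne_finset_zero (s := {0}) fun n hn => ?_
    rw [PowerSeries.coeff_one, if_neg (by simpa using hn), zero_mul]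
  · have h := hasSum_single (f := fun n => ((PowerSeries.coeff n (1 : PowerSeries ℝ) : ℝ) : ℂ)
      * q ^ n) 0 (fun n hn => by simp [PowerSeries.coeff_one, hn])
    simpa using h

lemma EvalsTo.mul {f g : PowerSeries ℝ} {q v w : ℂ} (hf : EvalsTo f q v) (hg : EvalsTo g q w) :
    EvalsTo (f * g) q (v * w) := by
  obtain ⟨f0, fs, fv⟩ := hf
  obtain ⟨g0, gs, gv⟩ := hg
  have nf : (fun n => ‖((PowerSeries.coeff n f : ℝ) : ℂ) * q ^ n‖)
      = fun n => PowerSeries.coeff n f * ‖q‖ ^ n := by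
    ext n; rw [norm_mul, norm_pow, Complex.norm_real, Real.norm_of_nonneg (f0 n)]
  have ng : (fun n => ‖((PowerSeries.coeff n g : ℝ) : ℂ) * q ^ n‖)
      = fun n => PowerSeries.coeff n g * ‖q‖ ^ n := by
    ext n; rw [norm_mul, norm_pow, Complex.norm_real, Real.norm_of_nonneg (g0 n)]
  have hc : ∀ n, ∑ kl ∈ Finset.HasAntidiagonal.antidiagonal n,
      (((PowerSeries.coeff kl.1 f : ℝ) : ℂ) * q ^ kl.1) * (((PowerSeries.coeff kl.2 g : ℝ) : ℂ) * q ^ kl.2)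
      = ((PowerSeries.coeff n (f * g) : ℝ) : ℂ) * q ^ n := by
    intro n
    rw [PowerSeries.coeff_mul]
    push_cast
    rw [Finset.sum_mul]
    refine Finset.sum_congr rfl fun kl hkl => ?_
    rw [← Finset.HasAntidiagonal.mem_antidiagonal.mp hkl, pow_add]; ring
  have h0 : ∀ n, 0 ≤ PowerSeries.coeff n (f * g) := fun n => by
    rw [PowerSeries.coeff_mul]
    exact Finset.sum_nonneg fun kl _ => mul_nonneg (f0 _) (g0 _)
  have hs : Summable fun n => ‖((PowerSeries.coeff n (f * g) : ℝ) : ℂ) * q ^ n‖ := by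
    have := summable_norm_sum_mul_antidiagonal_of_summable_norm
      (f := fun n => ((PowerSeries.coeff n f : ℝ) : ℂ) * q ^ n)
      (g := fun n => ((PowerSeries.coeff n g : ℝ) : ℂ) * q ^ n) (by rw [nf]; exact fs) (by rw [ng]; exact gs)
    simpa only [hc] using this
  refine ⟨h0, ?_, ?_⟩
  · refine hs.congr fun n => ?_
    rw [norm_mul, norm_pow, Complex.norm_real, Real.norm_of_nonneg (h0 n)]
  · have := tsum_mul_tsum_eq_tsum_sum_antidiagonal_of_summable_norm
      (f := fun n => ((PowerSeries.coeff n f : ℝ) : ℂ) * q ^ n)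
      (g := fun n => ((PowerSeries.coeff n g : ℝ) : ℂ) * q ^ n) (by rw [nf]; exact fs) (by rw [ng]; exact gs)
    rw [fv.tsum_eq, gv.tsum_eq] at this
    simp only [hc] at this
    rw [this]
    exact hs.of_norm.hasSum

lemma EvalsTo.pow {f : PowerSeries ℝ} {q v : ℂ} (hf : EvalsTo f q v) (k : ℕ) :
    EvalsTo (f ^ k) q (v ^ k) := by
  induction k with
  | zero => simpa using EvalsTo.one q
  | succ k ih => rw [pow_succ, pow_succ]; exact ih.mul hf

lemma EvalsTo.prod_range {f : ℕ → PowerSeries ℝ} {q : ℂ} {v : ℕ → ℂ}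
    (hf : ∀ i, EvalsTo (f i) q (v i)) (k : ℕ) :
    EvalsTo (∏ i ∈ Finset.range k, f i) q (∏ i ∈ Finset.range k, v i) := by
  induction k with
  | zero => simpa using EvalsTo.one q
  | succ k ih => rw [Finset.prod_range_succ, Finset.prod_range_succ]; exact ih.mul (hf k)

lemma inv_one_sub_X_pow (k : ℕ) (hk : 0 < k) :
    (1 - PowerSeries.X ^ k : PowerSeries ℝ)⁻¹
      = PowerSeries.mk fun n => if k ∣ n then 1 else 0 := by
  have hc : PowerSeries.constantCoeff (1 - PowerSeries.X ^ k : PowerSeries ℝ) ≠ 0 := by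
    simp [hk.ne']
  rw [PowerSeries.inv_eq_iff_mul_eq_one hc]
  ext n
  rw [mul_sub, mul_one, map_sub, PowerSeries.coeff_mk, PowerSeries.coeff_mul_X_pow',
    PowerSeries.coeff_one]
  by_cases h : k ≤ n
  · have : n ≠ 0 := by omega
    have hd : k ∣ n - k ↔ k ∣ n := by
      rw [Nat.dvd_sub_self_right]; constructor
      · rintro (h' | h')
        · exact h'
        · have : n = k := le_antisymm h' h
          rw [this]
      · exact Or.inl
    simp [h, this, hd]
  · by_cases h0 : n = 0
    · subst h0; simp [hk.ne']
    · have : ¬ k ∣ n := fun hdv => h (Nat.le_of_dvd (Nat.pos_of_ne_zero h0) hdv)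
      simp [h, h0, this]

lemma evalsTo_inv_one_sub_X_pow {k : ℕ} (hk : 0 < k) {q : ℂ} (hq : ‖q‖ < 1) :
    EvalsTo (1 - PowerSeries.X ^ k : PowerSeries ℝ)⁻¹ q (1 - q ^ k)⁻¹ := by
  rw [inv_one_sub_X_pow k hk]
  have hinj : Function.Injective fun j : ℕ => k * j := fun a b h => Nat.eq_of_mul_eq_mul_left hk h
  have hrange : ∀ n, n ∉ Set.range (fun j : ℕ => k * j) → ¬ k ∣ n := by
    rintro n hn ⟨j, rfl⟩
    exact hn ⟨j, rfl⟩
  refine ⟨fun n => ?_, ?_, ?_⟩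
  · rw [PowerSeries.coeff_mk]; split_ifs <;> norm_num
  · rw [← hinj.summable_iff]
    · have : ‖q‖ ^ k < 1 := pow_lt_one₀ (norm_nonneg _) hq hk.ne'
      refine (summable_geometric_of_lt_one (by positivity) this).congr fun j => ?_
      simp [pow_mul]
    · intro n hn
      simp [hrange n hn]
  · rw [← hinj.hasSum_iff]
    · have : ‖q ^ k‖ < 1 := by rw [norm_pow]; exact pow_lt_one₀ (norm_nonneg _) hq hk.ne'
      refine (hasSum_geometric_of_norm_lt_one this).congr_fun fun j => ?_
      simp [pow_mul]
    · intro n hn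
      simp [hrange n hn]

/-- The `n`-th factor of the MacMahon product. -/
noncomputable def factor (d n : ℕ) : PowerSeries ℝ :=
  ((1 - PowerSeries.X ^ (n + 1)) ^ macMahonExponent d (n + 1))⁻¹

lemma factor_eq (d n : ℕ) :
    factor d n = (1 - PowerSeries.X ^ (n + 1) : PowerSeries ℝ)⁻¹ ^ macMahonExponent d (n + 1) := by
  have hc : PowerSeries.constantCoeff (1 - PowerSeries.X ^ (n + 1) : PowerSeries ℝ) ≠ 0 := by simp
  unfold factor
  rw [PowerSeries.inv_eq_iff_mul_eq_one (by simp), ← mul_pow, PowerSeries.inv_mul_cancel _ hc,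
    one_pow]

lemma evalsTo_factor (d n : ℕ) {q : ℂ} (hq : ‖q‖ < 1) :
    EvalsTo (factor d n) q ((1 - q ^ (n + 1))⁻¹ ^ macMahonExponent d (n + 1)) := by
  rw [factor_eq]
  exact (evalsTo_inv_one_sub_X_pow n.succ_pos hq).pow _

lemma coeff_partialProd_nonneg (d K n : ℕ) :
    0 ≤ PowerSeries.coeff n (∏ i ∈ Finset.range K, factor d i) :=
  (EvalsTo.prod_range (q := 0) (fun i => evalsTo_factor d i (by simp)) K).1 n

lemma coeff_partialProd_mono (d n : ℕ) :
    Monotone fun K => PowerSeries.coeff n (∏ i ∈ Finset.range K, factor d i) := by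
  refine monotone_nat_of_le_succ fun K => ?_
  have hF := (evalsTo_factor d K (q := 0) (by simp)).1
  have h1 : PowerSeries.coeff 0 (factor d K) = 1 := by
    rw [factor_eq]; simp
  rw [Finset.prod_range_succ, PowerSeries.coeff_mul]
  have := Finset.single_le_sum (s := Finset.HasAntidiagonal.antidiagonal n)
    (f := fun kl => PowerSeries.coeff kl.1 (∏ i ∈ Finset.range K, factor d i)
      * PowerSeries.coeff kl.2 (factor d K))
    (fun kl _ => mul_nonneg (coeff_partialProd_nonneg d K kl.1) (hF kl.2))
    ((Finset.HasAntidiagonal.mem_antidiagonal (a := (n, 0))).mpr (add_zero n))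
  simpa [h1] using this

lemma tendsto_coeff_partialProd (d n : ℕ) :
    Tendsto (fun K => PowerSeries.coeff n (∏ i ∈ Finset.range K, factor d i)) atTop
      (𝓝 (macMahonNumber d n)) := by
  have h := (macMahonSeries_multipliable d).hasProd.tendsto_prod_nat
  exact ((PowerSeries.WithPiTopology.continuous_coeff ℝ n).tendsto _).comp h

lemma coeff_partialProd_le (d K n : ℕ) :
    PowerSeries.coeff n (∏ i ∈ Finset.range K, factor d i) ≤ macMahonNumber d n :=
  (coeff_partialProd_mono d n).ge_of_tendsto (tendsto_coeff_partialProd d n) K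

lemma macMahonNumber_nonneg (d n : ℕ) : 0 ≤ macMahonNumber d n :=
  (coeff_partialProd_nonneg d 0 n).trans (coeff_partialProd_le d 0 n)

lemma tendsto_prod_exp_logM {d : ℕ} (hd : 1 ≤ d) {z : ℂ} (hz : 0 < z.re) :
    Tendsto (fun K => ∏ i ∈ Finset.range K,
      (1 - Complex.exp (-z) ^ (i + 1))⁻¹ ^ macMahonExponent d (i + 1)) atTop
      (𝓝 (Complex.exp (logM d z))) := by
  have hq : ‖Complex.exp (-z)‖ < 1 := by
    rw [Complex.norm_exp, Real.exp_lt_one_iff]; simpa using hz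
  have hqn : ∀ i : ℕ, ‖Complex.exp (-z) ^ (i + 1)‖ < 1 := fun i => by
    rw [norm_pow]; exact pow_lt_one₀ (norm_nonneg _) hq i.succ_ne_zero
  have h : HasSum (fun i : ℕ => (macMahonExponent d (i + 1) : ℂ) *
      -Complex.log (1 - Complex.exp (-z) ^ (i + 1))) (logM d z) := by
    refine (summable_logM hd hz).hasSum.prod_fiberwise fun i => ?_
    have h1 := (Complex.hasSum_taylorSeries_neg_log (hqn i))
    rw [← hasSum_nat_add_iff' 1] at h1
    simp only [Finset.range_one, Finset.sum_singleton, pow_zero, Nat.cast_zero, div_zero,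
      sub_zero] at h1
    refine (h1.mul_left (macMahonExponent d (i + 1) : ℂ)).congr_fun fun m => ?_
    simp only [weight, freq]
    rw [← Complex.exp_nat_mul, ← Complex.exp_nat_mul]
    push_cast
    rw [show -(((i : ℂ) + 1) * (m + 1) * z) = ((m : ℂ) + 1) * ((i + 1) * -z) by ring]
    ring
  refine ((Complex.continuous_exp.tendsto _).comp h.tendsto_sum_nat).congr fun K => ?_
  simp only [Function.comp]
  rw [Complex.exp_sum]
  refine Finset.prod_congr rfl fun i _ => ?_
  have hne : 1 - Complex.exp (-z) ^ (i + 1) ≠ 0 := by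
    intro h0
    have := hqn i
    rw [← sub_eq_zero.mp h0] at this
    simp at this
  rw [Complex.exp_nat_mul, Complex.exp_neg, Complex.exp_log hne]

/-- The generating function of the MacMahon numbers converges in the right half plane. -/
lemma summable_macMahonNumber {d : ℕ} (hd : 1 ≤ d) {t : ℝ} (ht : 0 < t) :
    Summable fun n : ℕ => macMahonNumber d n * Real.exp (-t) ^ n := by
  have hT := tendsto_prod_exp_logM hd (z := (t : ℂ)) (by simpa using ht)
  obtain ⟨B, hB⟩ := hT.norm.bddAbove_range
  have hn : ‖Complex.exp (-(t : ℂ))‖ = Real.exp (-t) := by rw [Complex.norm_exp]; simp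
  have hq : ‖Complex.exp (-(t : ℂ))‖ < 1 := by rw [hn, Real.exp_lt_one_iff]; linarith
  refine summable_of_sum_le (c := B) (fun n => mul_nonneg (macMahonNumber_nonneg d n)
    (by positivity)) fun u => ?_
  have hlim : Tendsto (fun K => ∑ n ∈ u, PowerSeries.coeff n (∏ i ∈ Finset.range K, factor d i)
      * Real.exp (-t) ^ n) atTop (𝓝 (∑ n ∈ u, macMahonNumber d n * Real.exp (-t) ^ n)) :=
    tendsto_finsetSum u fun n _ => (tendsto_coeff_partialProd d n).mul_const _
  refine le_of_tendsto hlim (Eventually.of_forall fun K => ?_)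
  have hE := EvalsTo.prod_range (fun i => evalsTo_factor d i hq) K
  have hre : HasSum (fun n => PowerSeries.coeff n (∏ i ∈ Finset.range K, factor d i)
      * Real.exp (-t) ^ n) (∏ i ∈ Finset.range K, (1 - Complex.exp (-(t : ℂ)) ^ (i + 1))⁻¹
        ^ macMahonExponent d (i + 1)).re := by
    refine (Complex.hasSum_re hE.2.2).congr_fun fun n => ?_
    rw [← Complex.ofReal_neg, ← Complex.ofReal_exp, ← Complex.ofReal_pow, ← Complex.ofReal_mul,
      Complex.ofReal_re]
  refine (sum_le_hasSum u (fun n _ => mul_nonneg (hE.1 n) (by positivity)) hre).trans ?_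
  exact (Complex.re_le_norm _).trans (hB ⟨K, rfl⟩)

/-- `∑ m_d(n) e^{-nz} = exp (log M_d(e^{-z}))`. -/
lemma hasSum_macMahonNumber {d : ℕ} (hd : 1 ≤ d) {z : ℂ} (hz : 0 < z.re) :
    HasSum (fun n : ℕ => (macMahonNumber d n : ℂ) * Complex.exp (-z) ^ n)
      (Complex.exp (logM d z)) := by
  have hn : ‖Complex.exp (-z)‖ = Real.exp (-z.re) := by rw [Complex.norm_exp]; simp
  have hq : ‖Complex.exp (-z)‖ < 1 := by rw [hn, Real.exp_lt_one_iff]; linarith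
  have hsum := summable_macMahonNumber hd hz
  have hs : Summable fun n : ℕ => (macMahonNumber d n : ℂ) * Complex.exp (-z) ^ n := by
    refine Summable.of_norm (hsum.congr fun n => ?_)
    rw [norm_mul, norm_pow, hn, Complex.norm_real, Real.norm_of_nonneg (macMahonNumber_nonneg d n)]
  have h1 := tendsto_tsum_of_dominated_convergence (𝓕 := atTop) hsum
    (f := fun K n => ((PowerSeries.coeff n (∏ i ∈ Finset.range K, factor d i) : ℝ) : ℂ)
      * Complex.exp (-z) ^ n)
    (g := fun n : ℕ => (macMahonNumber d n : ℂ) * Complex.exp (-z) ^ n)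
    (fun n => ((Complex.continuous_ofReal.tendsto _).comp
      (tendsto_coeff_partialProd d n)).mul_const _)
    (Eventually.of_forall fun K n => by
      rw [norm_mul, norm_pow, hn, Complex.norm_real,
        Real.norm_of_nonneg (coeff_partialProd_nonneg d K n)]
      exact mul_le_mul_of_nonneg_right (coeff_partialProd_le d K n) (by positivity))
  have h2 : Tendsto (fun K => ∑' n, ((PowerSeries.coeff n (∏ i ∈ Finset.range K, factor d i) : ℝ) : ℂ)
      * Complex.exp (-z) ^ n) atTop (𝓝 (Complex.exp (logM d z))) := by
    refine (tendsto_prod_exp_logM hd hz).congr fun K => ?_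
    exact (EvalsTo.prod_range (fun i => evalsTo_factor d i hq) K).2.2.tsum_eq.symm
  rw [← tendsto_nhds_unique h1 h2]
  exact hs.hasSum

open MeasureTheory

/-! ### Cauchy's formula for the coefficients -/

lemma integral_exp_int_mul (j : ℤ) :
    ∫ y in (-Real.pi)..Real.pi, Complex.exp (j * Complex.I * y)
      = if j = 0 then ((2 * Real.pi : ℝ) : ℂ) else 0 := by
  split_ifs with h
  · subst h
    simp only [Int.cast_zero, zero_mul, Complex.exp_zero, intervalIntegral.integral_const,
      sub_neg_eq_add, Complex.real_smul, mul_one]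
    push_cast; ring
  · have hc : (j : ℂ) * Complex.I ≠ 0 := by simp [h]
    rw [integral_exp_mul_complex hc]
    have : Complex.exp (j * Complex.I * (Real.pi : ℝ))
        = Complex.exp (j * Complex.I * ((-Real.pi : ℝ) : ℂ)) := by
      rw [Complex.exp_eq_exp_iff_exists_int]
      exact ⟨j, by push_cast; ring⟩
    rw [this, sub_self, zero_div]

/-- Cauchy's formula on the circle `|q| = e^{-t}`, in the variable `q = e^{-(t + iy)}`. -/
lemma macMahonNumber_eq_integral {d : ℕ} (hd : 1 ≤ d) (n : ℕ) {t : ℝ} (ht : 0 < t) :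
    (macMahonNumber d n : ℂ) = (2 * Real.pi : ℝ)⁻¹ * ∫ y in (-Real.pi)..Real.pi,
      Complex.exp (logM d (t + y * Complex.I) + n * (t + y * Complex.I)) := by
  have hz : ∀ y : ℝ, 0 < ((t : ℂ) + y * Complex.I).re := fun y => by simpa using ht
  have hterm : ∀ (k : ℕ) (y : ℝ), (macMahonNumber d k : ℂ) *
      Complex.exp (-((t : ℂ) + y * Complex.I)) ^ k * Complex.exp (n * (t + y * Complex.I))
      = (macMahonNumber d k * Real.exp (-t) ^ k * Real.exp (n * t) : ℝ) *
        Complex.exp (((n - k : ℤ) : ℂ) * Complex.I * y) := by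
    intro k y
    have e1 : ((n - k : ℤ) : ℂ) = (n : ℂ) - k := by push_cast; ring
    push_cast
    rw [← Complex.exp_nat_mul, ← Complex.exp_nat_mul, mul_assoc, mul_assoc, mul_assoc,
      ← Complex.exp_add, ← Complex.exp_add, ← Complex.exp_add]
    congr 2
    ring
  have hnorm : ∀ (k : ℕ) (y : ℝ), ‖(macMahonNumber d k : ℂ) *
      Complex.exp (-((t : ℂ) + y * Complex.I)) ^ k * Complex.exp (n * (t + y * Complex.I))‖
      = macMahonNumber d k * Real.exp (-t) ^ k * Real.exp (n * t) := by
    intro k y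
    have h0 := macMahonNumber_nonneg d k
    rw [hterm, norm_mul, Complex.norm_real, Real.norm_of_nonneg (by positivity), Complex.norm_exp]
    simp
  have hsum := (summable_macMahonNumber hd ht).mul_right (Real.exp (n * t))
  have h := intervalIntegral.hasSum_integral_of_dominated_convergence (μ := volume)
    (a := -Real.pi) (b := Real.pi)
    (F := fun (k : ℕ) (y : ℝ) => (macMahonNumber d k : ℂ) *
      Complex.exp (-((t : ℂ) + y * Complex.I)) ^ k * Complex.exp (n * (t + y * Complex.I)))
    (f := fun y : ℝ => Complex.exp (logM d (t + y * Complex.I) + n * (t + y * Complex.I)))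
    (fun k _ => macMahonNumber d k * Real.exp (-t) ^ k * Real.exp (n * t))
    (fun k => Continuous.aestronglyMeasurable (by fun_prop))
    (fun k => Eventually.of_forall fun y _ => (hnorm k y).le)
    (Eventually.of_forall fun y _ => hsum) intervalIntegrable_const
    (Eventually.of_forall fun y _ => by
      rw [Complex.exp_add]
      exact (hasSum_macMahonNumber hd (hz y)).mul_right _)
  have hval : ∀ k : ℕ, ∫ y in (-Real.pi)..Real.pi, (macMahonNumber d k : ℂ) *
      Complex.exp (-((t : ℂ) + y * Complex.I)) ^ k * Complex.exp (n * (t + y * Complex.I))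
      = if k = n then (macMahonNumber d n * (2 * Real.pi : ℝ) : ℂ) else 0 := by
    intro k
    simp_rw [hterm]
    rw [intervalIntegral.integral_const_mul, integral_exp_int_mul]
    by_cases hk : k = n
    · subst hk
      have : Real.exp (-t) ^ k * Real.exp (k * t) = 1 := by
        rw [← Real.exp_nat_mul, ← Real.exp_add]; simp
      rw [mul_assoc (macMahonNumber d k), this]
      simp
    · have : ¬ ((n : ℤ) - k = 0) := by omega
      simp [hk, this]
  simp_rw [hval] at h
  have h2 := (hasSum_ite_eq n (macMahonNumber d n * (2 * Real.pi : ℝ) : ℂ)).unique h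
  rw [← h2]
  have hpi : ((2 * Real.pi : ℝ) : ℂ) ≠ 0 := by
    exact_mod_cast (by positivity : (2 * Real.pi : ℝ) ≠ 0)
  rw [Complex.ofReal_inv]
  field_simp

/-! ### Behaviour of `log M_d(e^{-t})` as `t → 0` on the real axis -/

lemma analyticAt_dslope {f : ℝ → ℝ} (hf : AnalyticAt ℝ f 0) : AnalyticAt ℝ (dslope f 0) 0 := by
  obtain ⟨p, hp⟩ := hf
  exact ⟨_, hp.has_fpower_series_dslope_fslope⟩

lemma exists_taylor {f : ℝ → ℝ} (hf : AnalyticAt ℝ f 0) (N : ℕ) :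
    ∃ (e : ℕ → ℝ) (g : ℝ → ℝ), AnalyticAt ℝ g 0 ∧
      ∀ w, f w = ∑ i ∈ Finset.range N, e i * w ^ i + w ^ N * g w := by
  induction N with
  | zero => exact ⟨fun _ => 0, f, hf, fun w => by simp⟩
  | succ N ih =>
    obtain ⟨e, g, hg, h⟩ := ih
    refine ⟨fun i => if i = N then g 0 else e i, dslope g 0, analyticAt_dslope hg, fun w => ?_⟩
    have h1 := sub_smul_dslope g 0 w
    rw [sub_zero, smul_eq_mul] at h1
    have h2 : ∑ i ∈ Finset.range N, (if i = N then g 0 else e i) * w ^ i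
        = ∑ i ∈ Finset.range N, e i * w ^ i :=
      Finset.sum_congr rfl fun i hi => by rw [if_neg (Finset.mem_range.mp hi).ne]
    rw [h w, Finset.sum_range_succ, h2]
    simp only [if_true]
    linear_combination (-(w ^ N)) * h1

/-- The Laurent expansion of the kernel at `0`, with the constant term carried by `e^{-w}`, so that
the remainder `w * k w` still decays at infinity. -/
lemma exists_kernel_expansion (d : ℕ) :
    ∃ (c : ℕ → ℝ) (e : ℝ) (k : ℝ → ℝ), AnalyticAt ℝ k 0 ∧ ∀ w, 0 < w →
      kernel d w = ∑ j ∈ Finset.Icc 1 d, c j / w ^ j + e * Real.exp (-w) + w * k w := by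
  set φ : ℝ → ℝ := fun w => 1 - Real.exp (-w) with hφ
  have hφa : AnalyticAt ℝ φ 0 := by fun_prop
  set b := dslope φ 0 with hb
  have hba : AnalyticAt ℝ b 0 := analyticAt_dslope hφa
  have hb0 : b 0 = 1 := by
    rw [hb, dslope_same]
    have : HasDerivAt φ (-(Real.exp (-0) * -1)) 0 :=
      ((hasDerivAt_neg (0 : ℝ)).exp).const_sub 1
    rw [this.deriv]; simp
  have hφb : ∀ w, φ w = w * b w := fun w => by
    have := sub_smul_dslope φ 0 w
    simp only [sub_zero, smul_eq_mul] at this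
    rw [hb, this]; simp [hφ]
  have hE : AnalyticAt ℝ (fun w => Real.exp (-w) / b w ^ d) 0 :=
    AnalyticAt.div (by fun_prop) (hba.pow d) (by simp [hb0])
  obtain ⟨a, g, hg, h⟩ := exists_taylor hE (d + 1)
  refine ⟨fun j => a (d - j), a d, fun w => a d * b w + g w, (analyticAt_const.mul hba).add hg,
    fun w hw => ?_⟩
  have hbw : b w ≠ 0 := by
    intro h0
    have h1 := hφb w
    rw [h0, mul_zero] at h1
    have : Real.exp (-w) < 1 := by rw [Real.exp_lt_one_iff]; linarith
    simp only [hφ] at h1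
    linarith
  have hk : kernel d w = (∑ i ∈ Finset.range (d + 1), a i * w ^ i + w ^ (d + 1) * g w) / w ^ d := by
    have h1 : (1 - Real.exp (-w)) = w * b w := hφb w
    rw [← h w, kernel, h1, mul_pow]
    field_simp
  have hs : ∑ j ∈ Finset.Icc 1 d, a (d - j) / w ^ j = (∑ i ∈ Finset.range d, a i * w ^ i) / w ^ d := by
    rw [Finset.sum_div]
    refine Finset.sum_bij' (fun j _ => d - j) (fun i _ => d - i) ?_ ?_ ?_ ?_ ?_
    · intro j hj; simp only [Finset.mem_Icc, Finset.mem_range] at *; omega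
    · intro j hj; simp only [Finset.mem_Icc, Finset.mem_range] at *; omega
    · intro j hj; simp only [Finset.mem_Icc] at *; omega
    · intro j hj; simp only [Finset.mem_range] at *; omega
    · intro j hj
      simp only [Finset.mem_Icc] at hj
      have : w ^ d = w ^ (d - j) * w ^ j := by rw [← pow_add]; congr 1; omega
      rw [this]
      field_simp
  have hexp : Real.exp (-w) = 1 - w * b w := by
    have := hφb w
    simp only [hφ] at this
    linarith
  rw [hk, hs, Finset.sum_range_succ, hexp]
  field_simp
  ring

/-- A Riemann sum differs from the integral by at most the mesh times the total variation; here the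
variation of `k` is measured by an antitone majorant `U`. -/
lemma abs_riemann_sum_sub_integral_le {k U : ℝ → ℝ} (hU : AntitoneOn U (Set.Ici 0))
    (hU0 : ∀ x, 0 ≤ x → 0 ≤ U x) (hk : ∀ x y, 0 < x → x ≤ y → |k y - k x| ≤ U x - U y)
    (hint : IntegrableOn k (Set.Ioi 0)) {t : ℝ} (ht : 0 < t)
    (hs : Summable fun m : ℕ => k ((m + 1) * t)) :
    |t * ∑' m : ℕ, k ((m + 1) * t) - ∫ x in Set.Ioi 0, k x| ≤ t * U 0 := by
  have hii : ∀ a b : ℝ, 0 ≤ a → a ≤ b → IntervalIntegrable k volume a b := fun a b ha hab => by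
    rw [intervalIntegrable_iff_integrableOn_Ioc_of_le hab]
    exact hint.mono_set fun x hx => lt_of_le_of_lt ha hx.1
  have hstep : ∀ m : ℕ, |t * k ((m + 1) * t) - ∫ x in (m * t)..((m + 1) * t), k x|
      ≤ t * (U (m * t) - U ((m + 1) * t)) := by
    intro m
    have hm : (0 : ℝ) ≤ m * t := by positivity
    have hle : (m : ℝ) * t ≤ (m + 1) * t := by nlinarith
    have e1 : t * k ((m + 1) * t) = ∫ _ in (m * t)..((m + 1) * t), k ((m + 1) * t) := by
      rw [intervalIntegral.integral_const, smul_eq_mul]; ring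
    rw [e1, ← intervalIntegral.integral_sub intervalIntegrable_const (hii _ _ hm hle)]
    have := intervalIntegral.norm_integral_le_of_norm_le_const (a := m * t) (b := (m + 1) * t)
      (f := fun x => k ((m + 1) * t) - k x) (C := U (m * t) - U ((m + 1) * t)) fun x hx => by
        rw [Set.uIoc_of_le hle] at hx
        have hx0 : 0 < x := lt_of_le_of_lt hm hx.1
        refine (hk x _ hx0 hx.2).trans ?_
        have := hU (Set.mem_Ici.mpr hm) (Set.mem_Ici.mpr hx0.le) hx.1.le
        linarith
    rw [Real.norm_eq_abs] at this
    refine this.trans_eq ?_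
    rw [show ((m : ℝ) + 1) * t - m * t = t by ring, abs_of_pos ht]; ring
  have hpart : ∀ M : ℕ, |t * ∑ m ∈ Finset.range M, k ((m + 1) * t) - ∫ x in (0 : ℝ)..(M * t), k x|
      ≤ t * (U 0 - U (M * t)) := by
    intro M
    induction M with
    | zero => simp
    | succ M ih =>
      have hm : (0 : ℝ) ≤ M * t := by positivity
      have hle : (M : ℝ) * t ≤ (M + 1) * t := by nlinarith
      push_cast
      rw [Finset.sum_range_succ, ← intervalIntegral.integral_add_adjacent_intervals
        (hii 0 (M * t) le_rfl hm) (hii _ _ hm hle)]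
      have h3 := abs_add_le (t * ∑ m ∈ Finset.range M, k ((m + 1) * t) - ∫ x in (0 : ℝ)..(M * t), k x)
        (t * k ((M + 1) * t) - ∫ x in (M * t)..((M + 1) * t), k x)
      have h4 := hstep M
      calc _ = |(t * ∑ m ∈ Finset.range M, k ((m + 1) * t) - ∫ x in (0 : ℝ)..(M * t), k x) +
            (t * k ((M + 1) * t) - ∫ x in (M * t)..((M + 1) * t), k x)| := by congr 1; ring
        _ ≤ _ := h3
        _ ≤ _ := add_le_add ih h4
        _ = _ := by ring
  have hlim1 := (hs.hasSum.tendsto_sum_nat).const_mul t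
  have hlim2 : Tendsto (fun M : ℕ => ∫ x in (0 : ℝ)..(M * t), k x) atTop
      (𝓝 (∫ x in Set.Ioi 0, k x)) :=
    intervalIntegral_tendsto_integral_Ioi 0 hint
      (tendsto_natCast_atTop_atTop.atTop_mul_const ht)
  refine le_of_tendsto (hlim1.sub hlim2).abs (Eventually.of_forall fun M => (hpart M).trans ?_)
  have := hU0 (M * t) (by positivity)
  nlinarith

lemma kernel_nonneg (d : ℕ) {w : ℝ} (hw : 0 < w) : 0 ≤ kernel d w := by
  have : Real.exp (-w) < 1 := by rw [Real.exp_lt_one_iff]; linarith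
  have : 0 < 1 - Real.exp (-w) := by linarith
  unfold kernel; positivity

lemma kernel_anti (d : ℕ) {x y : ℝ} (hx : 0 < x) (hxy : x ≤ y) : kernel d y ≤ kernel d x := by
  have h1 : Real.exp (-x) < 1 := by rw [Real.exp_lt_one_iff]; linarith
  have h2 : 0 < 1 - Real.exp (-x) := by linarith
  have h3 : Real.exp (-y) ≤ Real.exp (-x) := Real.exp_le_exp.mpr (by linarith)
  unfold kernel
  gcongr

lemma kernel_le (d : ℕ) {x y : ℝ} (hx : 0 < x) (hxy : x ≤ y) :
    kernel d y ≤ ((1 - Real.exp (-x)) ^ d)⁻¹ * Real.exp (-y) := by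
  have h1 : Real.exp (-x) < 1 := by rw [Real.exp_lt_one_iff]; linarith
  have h2 : 0 < 1 - Real.exp (-x) := by linarith
  have h3 : Real.exp (-y) ≤ Real.exp (-x) := Real.exp_le_exp.mpr (by linarith)
  unfold kernel
  rw [div_eq_inv_mul]
  gcongr

/-- `-log (1 - e^{-t})` as a series. -/
noncomputable def logSeries (t : ℝ) : ℝ := ∑' m : ℕ, Real.exp (-((m + 1) * t)) / (m + 1)

lemma summable_logSeries {t : ℝ} (ht : 0 < t) :
    Summable fun m : ℕ => Real.exp (-((m + 1) * t)) / (m + 1) :=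
  Summable.of_nonneg_of_le (fun m => by positivity)
    (fun m => div_le_self (by positivity) (by linarith [(Nat.cast_nonneg m : (0 : ℝ) ≤ m)]))
    (summable_exp_neg_succ_mul ht)

lemma logSeries_eq {t : ℝ} (ht : 0 < t) : logSeries t = -Real.log (1 - Real.exp (-t)) := by
  have h1 : |Real.exp (-t)| < 1 := by
    rw [abs_of_pos (Real.exp_pos _), Real.exp_lt_one_iff]; linarith
  rw [← (Real.hasSum_pow_div_log_of_abs_lt_one h1).tsum_eq]
  refine tsum_congr fun m => ?_
  rw [← Real.exp_nat_mul]
  push_cast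
  ring_nf

/-- An antitone majorant of the variation of the remainder `k` in the expansion of the kernel: near
`0` the function `k` is Lipschitz, and away from `0` it is a combination of antitone functions. -/
lemma exists_variation_bound {d : ℕ} {c : ℕ → ℝ} {e : ℝ} {k : ℝ → ℝ} (hka : AnalyticAt ℝ k 0)
    (hk : ∀ w, 0 < w →
      kernel d w = ∑ j ∈ Finset.Icc 1 d, c j / w ^ j + e * Real.exp (-w) + w * k w) :
    ∃ U : ℝ → ℝ, AntitoneOn U (Set.Ici 0) ∧ (∀ x, 0 ≤ x → 0 ≤ U x) ∧
      ∀ x y, 0 < x → x ≤ y → |k y - k x| ≤ U x - U y := by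
  obtain ⟨K, s, hs, hlip⟩ := hka.hasStrictFDerivAt.exists_lipschitzOnWith
  obtain ⟨ε₀, hε₀, hball⟩ := Metric.mem_nhds_iff.mp hs
  set ε := ε₀ / 2 with hεdef
  have hε : 0 < ε := by positivity
  have hnear : ∀ x y, 0 < x → x ≤ y → y ≤ ε → |k y - k x| ≤ K * (y - x) := by
    intro x y hx hxy hy
    have hmem : ∀ u, 0 < u → u ≤ ε → u ∈ s := fun u h0 h1 => hball (by
      rw [Metric.mem_ball, Real.dist_eq, sub_zero, abs_of_pos h0]; linarith)
    have := hlip.dist_le_mul y (hmem y (hx.trans_le hxy) hy) x (hmem x hx (hxy.trans hy))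
    rwa [Real.dist_eq, Real.dist_eq, abs_of_nonneg (sub_nonneg.mpr hxy)] at this
  set W : ℝ → ℝ := fun w => kernel d w * w⁻¹ +
    (∑ j ∈ Finset.Icc 1 d, |c j| * (w ^ (j + 1))⁻¹ + |e| * (Real.exp (-w) * w⁻¹)) with hW
  have hkform : ∀ w, 0 < w → k w = kernel d w * w⁻¹ -
      (∑ j ∈ Finset.Icc 1 d, c j * (w ^ (j + 1))⁻¹ + e * (Real.exp (-w) * w⁻¹)) := by
    intro w hw
    have h1 : ∑ j ∈ Finset.Icc 1 d, c j * (w ^ (j + 1))⁻¹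
        = (∑ j ∈ Finset.Icc 1 d, c j / w ^ j) * w⁻¹ := by
      rw [Finset.sum_mul]
      refine Finset.sum_congr rfl fun j _ => ?_
      rw [pow_succ, mul_inv]; ring
    rw [h1, hk w hw]
    field_simp
    ring
  have hfar : ∀ x y, 0 < x → x ≤ y → |k y - k x| ≤ W x - W y := by
    intro x y hx hxy
    have hy := hx.trans_le hxy
    have hinv : y⁻¹ ≤ x⁻¹ := inv_anti₀ hx hxy
    have h1 : kernel d y * y⁻¹ ≤ kernel d x * x⁻¹ :=
      mul_le_mul (kernel_anti d hx hxy) hinv (by positivity) (kernel_nonneg d hx)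
    have h2 : ∀ j : ℕ, (y ^ (j + 1))⁻¹ ≤ (x ^ (j + 1))⁻¹ := fun j =>
      inv_anti₀ (by positivity) (pow_le_pow_left₀ hx.le hxy _)
    have h3 : Real.exp (-y) * y⁻¹ ≤ Real.exp (-x) * x⁻¹ :=
      mul_le_mul (Real.exp_le_exp.mpr (by linarith)) hinv (by positivity) (by positivity)
    have e1 : k y - k x = -(kernel d x * x⁻¹ - kernel d y * y⁻¹) +
        (∑ j ∈ Finset.Icc 1 d, c j * ((x ^ (j + 1))⁻¹ - (y ^ (j + 1))⁻¹)
          + e * (Real.exp (-x) * x⁻¹ - Real.exp (-y) * y⁻¹)) := by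
      rw [hkform x hx, hkform y hy]
      simp only [mul_sub, Finset.sum_sub_distrib]
      ring
    have e2 : W x - W y = (kernel d x * x⁻¹ - kernel d y * y⁻¹) +
        (∑ j ∈ Finset.Icc 1 d, |c j| * ((x ^ (j + 1))⁻¹ - (y ^ (j + 1))⁻¹)
          + |e| * (Real.exp (-x) * x⁻¹ - Real.exp (-y) * y⁻¹)) := by
      simp only [hW, mul_sub, Finset.sum_sub_distrib]
      ring
    rw [e1, e2]
    refine (abs_add_le _ _).trans (add_le_add ?_ ((abs_add_le _ _).trans (add_le_add ?_ ?_)))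
    · rw [abs_neg, abs_of_nonneg (by linarith)]
    · refine (Finset.abs_sum_le_sum_abs _ _).trans (Finset.sum_le_sum fun j _ => ?_)
      rw [abs_mul, abs_of_nonneg (sub_nonneg.mpr (h2 j))]
    · rw [abs_mul, abs_of_nonneg (sub_nonneg.mpr h3)]
  have hWnn : ∀ w, 0 < w → 0 ≤ W w := by
    intro w hw
    have := kernel_nonneg d hw
    simp only [hW]
    positivity
  have hWanti : ∀ x y, 0 < x → x ≤ y → W y ≤ W x := fun x y hx hxy => by
    have := (abs_nonneg _).trans (hfar x y hx hxy)
    linarith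
  have hmaxpos : ∀ x, 0 < max x ε := fun x => lt_max_of_lt_right hε
  refine ⟨fun x => K * max (ε - x) 0 + W (max x ε), ?_, ?_, ?_⟩
  · intro x _ y _ hxy
    refine add_le_add (mul_le_mul_of_nonneg_left ?_ K.2) (hWanti _ _ (hmaxpos x) ?_)
    · exact max_le_max (by linarith) le_rfl
    · exact max_le_max hxy le_rfl
  · intro x _
    exact add_nonneg (mul_nonneg K.2 (le_max_right _ _)) (hWnn _ (hmaxpos x))
  · intro x y hx hxy
    rcases le_total y ε with hy | hy
    · have hx' := hxy.trans hy
      simp only [max_eq_right hy, max_eq_right hx', max_eq_left (sub_nonneg.mpr hy),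
        max_eq_left (sub_nonneg.mpr hx')]
      have := hnear x y hx hxy hy
      linarith
    · rcases le_total x ε with hx' | hx'
      · simp only [max_eq_left hy, max_eq_right hx', max_eq_left (sub_nonneg.mpr hx'),
          max_eq_right (sub_nonpos.mpr hy)]
        have h1 := hnear x ε hx hx' le_rfl
        have h2 := hfar ε y hε hy
        have h3 := abs_sub_le (k y) (k ε) (k x)
        linarith
      · simp only [max_eq_left hy, max_eq_left hx', max_eq_right (sub_nonpos.mpr hy),
          max_eq_right (sub_nonpos.mpr hx')]
        have := hfar x y hx hxy
        linarith

/-- The remainder is bounded near `0` and of order `w^{-2}` at infinity, because the kernel is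
exponentially small there. -/
lemma integrableOn_remainder {d : ℕ} {c : ℕ → ℝ} {e : ℝ} {k : ℝ → ℝ} (hka : AnalyticAt ℝ k 0)
    (hk : ∀ w, 0 < w →
      kernel d w = ∑ j ∈ Finset.Icc 1 d, c j / w ^ j + e * Real.exp (-w) + w * k w) :
    IntegrableOn k (Set.Ioi 0) := by
  obtain ⟨U, hU, hU0, hkU⟩ := exists_variation_bound hka hk
  have hkform : ∀ w, 0 < w →
      k w = (kernel d w - (∑ j ∈ Finset.Icc 1 d, c j / w ^ j + e * Real.exp (-w))) / w := by
    intro w hw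
    rw [hk w hw]
    field_simp
    ring
  have hcont : ContinuousOn k (Set.Ioi 0) := by
    refine ContinuousOn.congr ?_ (fun w hw => hkform w hw)
    have hne : ∀ w ∈ Set.Ioi (0 : ℝ), w ≠ 0 := fun w hw => (Set.mem_Ioi.mp hw).ne'
    have hne2 : ∀ w ∈ Set.Ioi (0 : ℝ), (1 - Real.exp (-w)) ^ d ≠ 0 := fun w hw => by
      have : Real.exp (-w) < 1 := by rw [Real.exp_lt_one_iff]; simpa using hw
      exact pow_ne_zero _ (by linarith)
    unfold kernel
    refine ContinuousOn.div (ContinuousOn.sub (ContinuousOn.div (by fun_prop) (by fun_prop) hne2)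
      (ContinuousOn.add (continuousOn_finsetSum _ fun j _ => ContinuousOn.div (by fun_prop)
        (by fun_prop) fun w hw => pow_ne_zero _ (hne w hw)) (by fun_prop))) (by fun_prop) hne
  have hmeas : ∀ s ⊆ Set.Ioi (0 : ℝ), MeasurableSet s →
      AEStronglyMeasurable k (volume.restrict s) := fun s hs hms =>
    (hcont.mono hs).aestronglyMeasurable hms
  rw [← Set.Ioc_union_Ioi_eq_Ioi (zero_le_one (α := ℝ)), integrableOn_union]
  constructor
  · refine IntegrableOn.of_bound (C := |k 1| + U 0) (by simp)
      (hmeas _ (fun x hx => hx.1) measurableSet_Ioc) ?_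
    refine (ae_restrict_iff' measurableSet_Ioc).mpr (Eventually.of_forall fun x hx => ?_)
    have h1 := hkU x 1 hx.1 hx.2
    have h2 := hU (Set.mem_Ici.mpr le_rfl) (Set.mem_Ici.mpr hx.1.le) hx.1.le
    have h3 := hU0 1 zero_le_one
    have h4 := abs_sub_abs_le_abs_sub (k x) (k 1)
    rw [abs_sub_comm] at h4
    rw [Real.norm_eq_abs]
    linarith
  · set A := ((1 - Real.exp (-1)) ^ d)⁻¹ + |e| with hA
    set B := ∑ j ∈ Finset.Icc 1 d, |c j| with hB
    have hi : IntegrableOn (fun w : ℝ => A * Real.exp (-w) + B * w ^ (-2 : ℝ)) (Set.Ioi 1) :=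
      ((integrableOn_exp_neg_Ioi 1).const_mul A).add
        ((integrableOn_Ioi_rpow_of_lt (by norm_num) one_pos).const_mul B)
    refine hi.mono' (hmeas _ (Set.Ioi_subset_Ioi zero_le_one) measurableSet_Ioi) ?_
    refine (ae_restrict_iff' measurableSet_Ioi).mpr (Eventually.of_forall fun w hw => ?_)
    have hw1 : (1 : ℝ) < w := hw
    have hw0 : 0 < w := by linarith
    have h1 := kernel_le d one_pos hw1.le
    have h0 := kernel_nonneg d hw0
    have h2 : |∑ j ∈ Finset.Icc 1 d, c j / w ^ j| ≤ B / w := by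
      rw [hB, Finset.sum_div]
      refine (Finset.abs_sum_le_sum_abs _ _).trans (Finset.sum_le_sum fun j hj => ?_)
      rw [abs_div, abs_of_pos (pow_pos hw0 j)]
      have : w ≤ w ^ j := le_self_pow₀ hw1.le (by have := (Finset.mem_Icc.mp hj).1; omega)
      gcongr
    have h3 : |kernel d w - (∑ j ∈ Finset.Icc 1 d, c j / w ^ j + e * Real.exp (-w))|
        ≤ A * Real.exp (-w) + B / w := by
      have a1 := abs_sub (kernel d w) (∑ j ∈ Finset.Icc 1 d, c j / w ^ j + e * Real.exp (-w))
      have a2 := abs_add_le (∑ j ∈ Finset.Icc 1 d, c j / w ^ j) (e * Real.exp (-w))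
      rw [abs_mul, abs_of_pos (Real.exp_pos _)] at a2
      rw [abs_of_nonneg h0] at a1
      rw [hA, add_mul]
      linarith
    have hA0 : 0 ≤ A * Real.exp (-w) := by
      have : 0 < 1 - Real.exp (-1) := by
        have : Real.exp (-1) < 1 := by rw [Real.exp_lt_one_iff]; norm_num
        linarith
      positivity
    rw [hkform w hw0, Real.norm_eq_abs, abs_div, abs_of_pos hw0]
    calc _ ≤ (A * Real.exp (-w) + B / w) / w := by gcongr
      _ = A * Real.exp (-w) / w + B * w ^ (-2 : ℝ) := by
          rw [Real.rpow_neg hw0.le, Real.rpow_two]; field_simp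
      _ ≤ _ := by gcongr; exact div_le_self hA0 hw1.le

/-- The expansion of `log M_d(e^{-t})` up to `O(t)`, with unspecified coefficients: the kernel is
replaced by its Laurent expansion in `∑ g(m t) / m`, and the remainder contributes the Riemann sum
`t ∑ k(m t)`, which is `∫ k + O(t)`. -/
lemma exists_real_expansion {d : ℕ} (hd : 1 ≤ d) :
    ∃ (c : ℕ → ℝ) (e c₀ B : ℝ), ∀ t, 0 < t →
      |moment d 0 t - (∑ j ∈ Finset.Icc 1 d, c j / t ^ j + e * logSeries t + c₀)| ≤ B * t := by
  obtain ⟨c, e, k, hka, hk⟩ := exists_kernel_expansion d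
  obtain ⟨U, hU, hU0, hkU⟩ := exists_variation_bound hka hk
  have hint := integrableOn_remainder hka hk
  refine ⟨fun j => c j * ∑' m : ℕ, 1 / ((m : ℝ) + 1) ^ (j + 1), e, ∫ x in Set.Ioi 0, k x, U 0,
    fun t ht => ?_⟩
  have h1 := hasSum_kernel_div hd ht
  have h2 : HasSum (fun m : ℕ => ∑ j ∈ Finset.Icc 1 d, c j / t ^ j * (1 / ((m : ℝ) + 1) ^ (j + 1)))
      (∑ j ∈ Finset.Icc 1 d, c j / t ^ j * ∑' m : ℕ, 1 / ((m : ℝ) + 1) ^ (j + 1)) := by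
    refine hasSum_sum fun j hj => HasSum.mul_left _ (Summable.hasSum ?_)
    have := (summable_nat_add_iff (f := fun n : ℕ => 1 / (n : ℝ) ^ (j + 1)) 1).mpr
      (Real.summable_one_div_nat_pow.mpr (by have := (Finset.mem_Icc.mp hj).1; omega))
    simpa using this
  have h3 := (summable_logSeries ht).hasSum.mul_left e
  have h4 := (h1.sub h2).sub h3
  have h5 : ∀ m : ℕ, kernel d ((m + 1) * t) / (m + 1) -
      (∑ j ∈ Finset.Icc 1 d, c j / t ^ j * (1 / ((m : ℝ) + 1) ^ (j + 1))) -
      e * (Real.exp (-((m + 1) * t)) / (m + 1)) = t * k ((m + 1) * t) := by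
    intro m
    have hm : (0 : ℝ) < m + 1 := by positivity
    have hs : ∑ j ∈ Finset.Icc 1 d, c j / t ^ j * (1 / ((m : ℝ) + 1) ^ (j + 1))
        = (∑ j ∈ Finset.Icc 1 d, c j / (((m : ℝ) + 1) * t) ^ j) / (m + 1) := by
      rw [Finset.sum_div]
      refine Finset.sum_congr rfl fun j _ => ?_
      rw [mul_pow, pow_succ]
      field_simp
    rw [hs, hk _ (by positivity)]
    field_simp
    ring
  simp only [h5] at h4
  have hsum : Summable fun m : ℕ => k ((m + 1) * t) := by
    refine (h4.summable.mul_left t⁻¹).congr fun m => ?_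
    field_simp
  have h6 := abs_riemann_sum_sub_integral_le hU hU0 hkU hint ht hsum
  rw [← tsum_mul_left, h4.tsum_eq] at h6
  have h7 : ∑ j ∈ Finset.Icc 1 d, (c j * ∑' m : ℕ, 1 / ((m : ℝ) + 1) ^ (j + 1)) / t ^ j
      = ∑ j ∈ Finset.Icc 1 d, c j / t ^ j * ∑' m : ℕ, 1 / ((m : ℝ) + 1) ^ (j + 1) :=
    Finset.sum_congr rfl fun j _ => by ring
  rw [h7, mul_comm (U 0)]
  refine le_trans (le_of_eq ?_) h6
  unfold logSeries
  congr 1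
  ring

/-! ### Identification of the coefficients through the Mellin transform -/

lemma kernel_one_le_inv {t : ℝ} (ht : 0 < t) : kernel 1 t ≤ 1 / t := by
  have h1 : Real.exp (-t) < 1 := by rw [Real.exp_lt_one_iff]; linarith
  have h2 := Real.add_one_le_exp t
  have h3 : Real.exp (-t) * Real.exp t = 1 := by rw [← Real.exp_add]; simp
  unfold kernel
  rw [pow_one, div_le_div_iff₀ (by linarith) ht]
  nlinarith [mul_le_mul_of_nonneg_left h2 (Real.exp_pos (-t)).le]

lemma logSeries_nonneg (t : ℝ) : 0 ≤ logSeries t := tsum_nonneg fun m => by positivity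

lemma logSeries_le_kernel {t : ℝ} (ht : 0 < t) : logSeries t ≤ kernel 1 t := by
  have h := hasSum_kernel le_rfl ht
  simp only [macMahonExponent, Nat.sub_self, Nat.choose_zero_right, Nat.cast_one, one_mul] at h
  rw [← h.tsum_eq]
  exact (summable_logSeries ht).tsum_le_tsum
    (fun m => div_le_self (by positivity) (by linarith [(Nat.cast_nonneg m : (0 : ℝ) ≤ m)]))
    h.summable

lemma logSeries_antitoneOn : AntitoneOn logSeries (Set.Ioi 0) := by
  intro x hx y hy hxy
  refine (summable_logSeries hy).tsum_le_tsum (fun m => ?_) (summable_logSeries hx)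
  have : ((m : ℝ) + 1) * x ≤ (m + 1) * y := mul_le_mul_of_nonneg_left hxy (by positivity)
  gcongr

lemma moment_le_exp {d : ℕ} (hd : 1 ≤ d) {t : ℝ} (ht : 1 ≤ t) :
    moment d 0 t ≤ Real.exp 1 * moment d 0 1 * Real.exp (-t) := by
  unfold moment
  rw [← tsum_mul_left, ← tsum_mul_right]
  have h1 := summable_moment hd 0 (one_pos : (0 : ℝ) < 1)
  refine (summable_moment hd 0 (by linarith)).tsum_le_tsum (fun p => ?_)
    ((h1.mul_left _).mul_right _)
  have hp := one_le_freq p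
  have : Real.exp (-(freq p * t)) ≤ Real.exp 1 * Real.exp (-(freq p * 1)) * Real.exp (-t) := by
    rw [← Real.exp_add, ← Real.exp_add]
    refine Real.exp_le_exp.mpr ?_
    nlinarith
  have hw := weight_nonneg d p
  calc _ ≤ weight d p * freq p ^ 0 *
      (Real.exp 1 * Real.exp (-(freq p * 1)) * Real.exp (-t)) := by gcongr
    _ = _ := by ring

/-- Meinardus' identity, obtained by integrating the defining series term by term. -/
lemma mellin_moment {d : ℕ} (hd : 1 ≤ d) {s : ℂ} (hs : (d : ℝ) < s.re) :
    mellin (fun t => (moment d 0 t : ℂ)) s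
      = Complex.Gamma s * riemannZeta (s + 1) * macMahonDirichlet d s := by
  have hd1 : (1 : ℝ) ≤ d := by exact_mod_cast hd
  have hs0 : 0 < s.re := by linarith
  have hD := macMahonDirichlet_hasSum d hd s hs
  have hZ : HasSum (fun m : ℕ => 1 / ((m + 1 : ℕ) : ℂ) ^ (s + 1)) (riemannZeta (s + 1)) := by
    have hre : 1 < (s + 1).re := by simp only [Complex.add_re, Complex.one_re]; linarith
    rw [zeta_eq_tsum_one_div_nat_add_one_cpow hre]
    have := (summable_nat_add_iff (f := fun n : ℕ => 1 / (n : ℂ) ^ (s + 1)) 1).mpr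
      (Complex.summable_one_div_nat_cpow.mpr hre)
    simpa using this.hasSum
  have hsumm := summable_mul_of_summable_norm hD.summable.norm hZ.summable.norm
  have hprod := hD.mul hZ hsumm
  have hterm : ∀ p : ℕ × ℕ, (macMahonExponent d (p.1 + 1) : ℂ) / ((p.1 + 1 : ℕ) : ℂ) ^ s *
      (1 / ((p.2 + 1 : ℕ) : ℂ) ^ (s + 1)) = (weight d p : ℂ) / (freq p : ℂ) ^ s := by
    intro p
    have h1 : (0 : ℝ) ≤ ((p.1 + 1 : ℕ) : ℝ) := by positivity
    have h2 : (0 : ℝ) ≤ ((p.2 + 1 : ℕ) : ℝ) := by positivity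
    have hf : (freq p : ℂ) = (((p.1 + 1 : ℕ) : ℝ) : ℂ) * (((p.2 + 1 : ℕ) : ℝ) : ℂ) := by
      unfold freq; push_cast; ring
    have hne : ((p.2 + 1 : ℕ) : ℂ) ≠ 0 := Nat.cast_ne_zero.mpr p.2.succ_ne_zero
    rw [hf, Complex.mul_cpow_ofReal_nonneg h1 h2, Complex.cpow_add _ _ hne, Complex.cpow_one]
    unfold weight
    push_cast
    simp only [div_eq_mul_inv, mul_inv]
    ring
  simp only [hterm] at hprod
  have hmain := hasSum_mellin (ι := ℕ × ℕ) (a := fun p => (weight d p : ℂ)) (p := freq)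
    (F := fun t => (moment d 0 t : ℂ)) (s := s) (fun p => Or.inr (freq_pos p)) hs0
    (fun t ht => by
      have := (summable_moment hd 0 (Set.mem_Ioi.mp ht)).hasSum
      have h2 := Complex.hasSum_ofReal.mpr this
      refine h2.congr_fun fun p => ?_
      push_cast; simp)
    (by
      have := hprod.summable.norm
      refine this.congr fun p => ?_
      rw [norm_div, Complex.norm_cpow_eq_rpow_re_of_pos (freq_pos p)])
  rw [← hmain.tsum_eq]
  have := (hprod.mul_left (Complex.Gamma s)).tsum_eq
  rw [show Complex.Gamma s * riemannZeta (s + 1) * macMahonDirichlet d s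
    = Complex.Gamma s * (macMahonDirichlet d s * riemannZeta (s + 1)) by ring, ← this]
  exact tsum_congr fun p => by ring

lemma mellin_logSeries {s : ℂ} (hs : 0 < s.re) :
    mellin (fun t => (logSeries t : ℂ)) s = Complex.Gamma s * riemannZeta (s + 1) := by
  have hre : 1 < (s + 1).re := by simp only [Complex.add_re, Complex.one_re]; linarith
  have hZ : HasSum (fun m : ℕ => 1 / ((m + 1 : ℕ) : ℂ) ^ (s + 1)) (riemannZeta (s + 1)) := by
    rw [zeta_eq_tsum_one_div_nat_add_one_cpow hre]
    have := (summable_nat_add_iff (f := fun n : ℕ => 1 / (n : ℂ) ^ (s + 1)) 1).mpr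
      (Complex.summable_one_div_nat_cpow.mpr hre)
    simpa using this.hasSum
  have hterm : ∀ m : ℕ, 1 / ((m + 1 : ℕ) : ℂ) ^ (s + 1)
      = (1 / ((m : ℂ) + 1)) / (((m : ℝ) + 1 : ℝ) : ℂ) ^ s := by
    intro m
    have hne : ((m + 1 : ℕ) : ℂ) ≠ 0 := Nat.cast_ne_zero.mpr m.succ_ne_zero
    rw [Complex.cpow_add _ _ hne, Complex.cpow_one]
    push_cast
    field_simp
  simp only [hterm] at hZ
  have hmain := hasSum_mellin (ι := ℕ) (a := fun m => 1 / ((m : ℂ) + 1)) (p := fun m => (m : ℝ) + 1)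
    (F := fun t => (logSeries t : ℂ)) (s := s) (fun m => Or.inr (by positivity)) hs
    (fun t ht => by
      have := (summable_logSeries (Set.mem_Ioi.mp ht)).hasSum
      have h2 := Complex.hasSum_ofReal.mpr this
      refine h2.congr_fun fun p => ?_
      push_cast
      rw [neg_mul]; ring)
    (by
      refine hZ.summable.norm.congr fun m => ?_
      rw [norm_div, Complex.norm_cpow_eq_rpow_re_of_pos (by positivity)])
  rw [← hmain.tsum_eq, ← (hZ.mul_left (Complex.Gamma s)).tsum_eq]
  exact tsum_congr fun p => by ring

lemma hasMellin_finset_sum {ι : Type*} (S : Finset ι) {f : ι → ℝ → ℂ} {s : ℂ} {m : ι → ℂ}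
    (h : ∀ i ∈ S, HasMellin (f i) s (m i)) :
    HasMellin (fun t => ∑ i ∈ S, f i t) s (∑ i ∈ S, m i) := by
  classical
  induction S using Finset.induction_on with
  | empty =>
    simp only [Finset.sum_empty]
    exact ⟨by simp [MellinConvergent], by simp [mellin]⟩
  | insert a S ha ih =>
    have h1 := ih fun i hi => h i (Finset.mem_insert_of_mem hi)
    have h2 := h a (Finset.mem_insert_self _ _)
    simp only [Finset.sum_insert ha]
    have h3 := hasMellin_add h2.1 h1.1
    rwa [h2.2, h1.2] at h3

lemma locallyIntegrableOn_of_antitoneOn {f : ℝ → ℝ} (hf : AntitoneOn f (Set.Ioi 0)) :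
    LocallyIntegrableOn f (Set.Ioi 0) := by
  rw [locallyIntegrableOn_iff isOpen_Ioi.isLocallyClosed]
  intro K hK hKc
  exact (hf.mono hK).integrableOn_isCompact hKc

lemma locallyIntegrableOn_ofReal {f : ℝ → ℝ} (hf : LocallyIntegrableOn f (Set.Ioi 0)) :
    LocallyIntegrableOn (fun t => (f t : ℂ)) (Set.Ioi 0) := by
  rw [locallyIntegrableOn_iff isOpen_Ioi.isLocallyClosed] at hf ⊢
  intro K hK hKc
  exact (hf K hK hKc).ofReal

/-- The polar and constant terms of the expansion at `0`, cut off at `1` so that the Mellin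
transform converges on a half plane. -/
noncomputable def polarPart (d : ℕ) (c : ℕ → ℝ) (c₀ : ℝ) (t : ℝ) : ℝ :=
  (Set.Ioc (0 : ℝ) 1).indicator (fun t => ∑ j ∈ Finset.Icc 1 d, c j / t ^ j + c₀) t

lemma hasMellin_polarPart (d : ℕ) (c : ℕ → ℝ) (c₀ : ℝ) {s : ℂ} (hs0 : 0 < s.re)
    (hs : (d : ℝ) < s.re) :
    HasMellin (fun t => (polarPart d c c₀ t : ℂ)) s
      (∑ j ∈ Finset.Icc 1 d, (c j : ℂ) / (s - j) + c₀ / s) := by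
  have h1 : ∀ j ∈ Finset.Icc 1 d, HasMellin (fun t : ℝ => (c j : ℂ) •
      (Set.Ioc (0 : ℝ) 1).indicator (fun t : ℝ => (t : ℂ) ^ (-(j : ℂ))) t) s
      ((c j : ℂ) / (s - j)) := by
    intro j hj
    have hj' : (j : ℝ) ≤ d := by exact_mod_cast (Finset.mem_Icc.mp hj).2
    have := hasMellin_cpow_Ioc (-(j : ℂ)) (s := s) (by simp; linarith)
    have h2 := hasMellin_const_smul this.1 (c j : ℂ)
    rw [this.2, smul_eq_mul, mul_one_div, ← sub_eq_add_neg] at h2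
    exact h2
  have h2 := hasMellin_finset_sum _ h1
  have h3 := hasMellin_const_smul (hasMellin_one_Ioc hs0).1 (c₀ : ℂ)
  rw [(hasMellin_one_Ioc hs0).2, smul_eq_mul, mul_one_div] at h3
  have h4 := hasMellin_add h2.1 h3.1
  rw [h2.2, h3.2] at h4
  have he : (fun t => (polarPart d c c₀ t : ℂ)) = fun t => (∑ j ∈ Finset.Icc 1 d, (c j : ℂ) •
      (Set.Ioc (0 : ℝ) 1).indicator (fun t : ℝ => (t : ℂ) ^ (-(j : ℂ))) t) +
      (c₀ : ℂ) • (Set.Ioc (0 : ℝ) 1).indicator (fun _ => (1 : ℂ)) t := by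
    ext t
    by_cases ht : t ∈ Set.Ioc (0 : ℝ) 1
    · simp only [polarPart, Set.indicator_of_mem ht, smul_eq_mul, mul_one]
      push_cast
      congr 1
      refine Finset.sum_congr rfl fun j _ => ?_
      rw [Complex.cpow_neg, Complex.cpow_natCast]; rfl
    · simp [polarPart, Set.indicator_of_notMem ht]
  rw [he]
  exact h4

lemma meromorphicAt_riemannZeta (s : ℂ) : MeromorphicAt riemannZeta s := by
  by_cases hs : s = 1
  · subst hs
    refine ⟨2, ?_⟩
    refine Complex.analyticAt_of_differentiable_on_punctured_nhds_of_continuousAt ?_ ?_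
    · filter_upwards [self_mem_nhdsWithin] with z hz
      have := differentiableAt_riemannZeta (s := z) hz
      exact (by fun_prop : DifferentiableAt ℂ (fun z : ℂ => (z - 1) ^ 2) z).smul this
    · rw [continuousAt_iff_punctured_nhds]
      have h1 : Tendsto (fun z : ℂ => z - 1) (𝓝[≠] 1) (𝓝 0) := by
        have : Tendsto (fun z : ℂ => z - 1) (𝓝 1) (𝓝 (1 - 1)) := by
          exact (continuous_id.sub continuous_const).tendsto _
        rw [sub_self] at this
        exact this.mono_left nhdsWithin_le_nhds
      have := h1.mul riemannZeta_residue_one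
      simp only [sub_self, ne_eq, OfNat.ofNat_ne_zero, not_false_eq_true, zero_pow, zero_smul]
      rw [zero_mul] at this
      refine this.congr fun z => ?_
      rw [smul_eq_mul]; ring
  · refine AnalyticAt.meromorphicAt ?_
    rw [Complex.analyticAt_iff_eventually_differentiableAt]
    filter_upwards [isOpen_ne.mem_nhds hs] with z hz
    exact differentiableAt_riemannZeta hz

lemma analyticAt_riemannZeta {s : ℂ} (hs : s ≠ 1) : AnalyticAt ℂ riemannZeta s := by
  rw [Complex.analyticAt_iff_eventually_differentiableAt]
  filter_upwards [isOpen_ne.mem_nhds hs] with z hz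
  exact differentiableAt_riemannZeta hz

lemma meromorphicAt_macMahonDirichlet (d : ℕ) (s : ℂ) : MeromorphicAt (macMahonDirichlet d) s := by
  unfold macMahonDirichlet
  refine MeromorphicAt.fun_sum fun j _ => (MeromorphicAt.const _ _).fun_mul ?_
  exact (meromorphicAt_riemannZeta (s - j)).comp_analyticAt (f := riemannZeta)
    (g := fun z => z - (j : ℂ)) (by fun_prop)

lemma analyticAt_macMahonDirichlet_zero (d : ℕ) : AnalyticAt ℂ (macMahonDirichlet d) 0 := by
  unfold macMahonDirichlet
  refine Finset.analyticAt_fun_sum _ fun j _ => analyticAt_const.fun_mul ?_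
  refine AnalyticAt.fun_comp (g := riemannZeta) (f := fun z => z - (j : ℂ)) ?_ (by fun_prop)
  refine analyticAt_riemannZeta fun h => ?_
  have := congrArg Complex.re h
  simp at this
  have h2 : (0 : ℝ) ≤ j := by positivity
  linarith

/-- The Mellin transform of the expansion: an identity of meromorphic functions on `Re s > -1`,
where `A` is the Mellin transform of the error term. For `Re s > d` it follows from
`mellin_moment`, and it extends by the identity theorem. -/
lemma eventually_mellin_identity {d : ℕ} (hd : 1 ≤ d) {c : ℕ → ℝ} {e c₀ B : ℝ}
    (h : ∀ t, 0 < t →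
      |moment d 0 t - (∑ j ∈ Finset.Icc 1 d, c j / t ^ j + e * logSeries t + c₀)| ≤ B * t) :
    ∃ A : ℂ → ℂ, (∀ s : ℂ, -1 < s.re → AnalyticAt ℂ A s) ∧ ∀ s : ℂ, -1 < s.re →
      ∀ᶠ z in 𝓝[≠] s, Complex.Gamma z * riemannZeta (z + 1) * (macMahonDirichlet d z - e)
        = ∑ j ∈ Finset.Icc 1 d, (c j : ℂ) / (z - j) + c₀ / z + A z := by
  have hd1 : (1 : ℝ) ≤ d := by exact_mod_cast hd
  set R : ℝ → ℝ := fun t => moment d 0 t - e * logSeries t - polarPart d c c₀ t with hR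
  have hlm : LocallyIntegrableOn (fun t => (moment d 0 t : ℂ)) (Set.Ioi 0) :=
    locallyIntegrableOn_ofReal (locallyIntegrableOn_of_antitoneOn
      fun x hx y _ hxy => moment_anti hd 0 hx hxy)
  have hll : LocallyIntegrableOn (fun t => (logSeries t : ℂ)) (Set.Ioi 0) :=
    locallyIntegrableOn_ofReal (locallyIntegrableOn_of_antitoneOn logSeries_antitoneOn)
  have hlp : LocallyIntegrableOn (fun t => (polarPart d c c₀ t : ℂ)) (Set.Ioi 0) := by
    refine locallyIntegrableOn_ofReal ?_
    rw [locallyIntegrableOn_iff isOpen_Ioi.isLocallyClosed]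
    intro K hK hKc
    refine Integrable.indicator ?_ measurableSet_Ioc
    refine ContinuousOn.integrableOn_compact hKc ?_
    refine ContinuousOn.add (continuousOn_finsetSum _ fun j _ => ContinuousOn.div (by fun_prop)
      (by fun_prop) fun w hw => pow_ne_zero _ (hK hw).ne') (by fun_prop)
  have hlR : LocallyIntegrableOn (fun t => (R t : ℂ)) (Set.Ioi 0) := by
    have : (fun t => (R t : ℂ)) = fun t => (moment d 0 t : ℂ) - (e : ℂ) • (logSeries t : ℂ)
        - (polarPart d c c₀ t : ℂ) := by
      ext t; simp [hR]
    rw [this]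
    exact (hlm.sub (hll.smul (e : ℂ))).sub hlp
  -- exponential decay of the three pieces at infinity
  have hmtop : (fun t => (moment d 0 t : ℂ)) =O[atTop] fun t => Real.exp (-1 * t) := by
    refine IsBigO.of_bound (Real.exp 1 * moment d 0 1) ?_
    filter_upwards [eventually_ge_atTop 1] with t ht
    rw [Complex.norm_real, Real.norm_of_nonneg (moment_nonneg _ _ _),
      Real.norm_of_nonneg (Real.exp_pos _).le, neg_one_mul]
    exact moment_le_exp hd ht
  have hltop : (fun t => (logSeries t : ℂ)) =O[atTop] fun t => Real.exp (-1 * t) := by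
    refine IsBigO.of_bound (((1 - Real.exp (-1)) ^ 1)⁻¹) ?_
    filter_upwards [eventually_ge_atTop 1] with t ht
    rw [Complex.norm_real, Real.norm_of_nonneg (logSeries_nonneg _),
      Real.norm_of_nonneg (Real.exp_pos _).le, neg_one_mul]
    exact (logSeries_le_kernel (by linarith)).trans (kernel_le 1 one_pos ht)
  have hptop : (fun t => (polarPart d c c₀ t : ℂ)) =O[atTop] fun t => Real.exp (-1 * t) := by
    refine IsBigO.of_bound 0 ?_
    filter_upwards [eventually_gt_atTop 1] with t ht
    rw [polarPart, Set.indicator_of_notMem (fun h => absurd h.2 (not_le.mpr ht))]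
    simp
  have hRtop : (fun t => (R t : ℂ)) =O[atTop] fun t => Real.exp (-1 * t) := by
    have : (fun t => (R t : ℂ)) = fun t => (moment d 0 t : ℂ) - (e : ℂ) * (logSeries t : ℂ)
        - (polarPart d c c₀ t : ℂ) := by
      ext t; simp [hR]
    rw [this]
    exact (hmtop.sub (hltop.const_mul_left _)).sub hptop
  -- behaviour at zero
  have hev : ∀ᶠ t : ℝ in 𝓝[>] 0, t ∈ Set.Ioc (0 : ℝ) 1 := Ioc_mem_nhdsGT one_pos
  have hRbot : (fun t => (R t : ℂ)) =O[𝓝[>] 0] fun t : ℝ => t ^ (-(-1) : ℝ) := by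
    refine IsBigO.of_bound B ?_
    filter_upwards [hev] with t ht
    have h1 := h t ht.1
    rw [neg_neg, Real.rpow_one, Complex.norm_real, Real.norm_of_nonneg ht.1.le, Real.norm_eq_abs]
    refine le_trans (le_of_eq ?_) h1
    simp only [hR, polarPart, Set.indicator_of_mem ht]
    congr 1; ring
  have hlbot : (fun t => (logSeries t : ℂ)) =O[𝓝[>] 0] fun t : ℝ => t ^ (-(1 : ℝ)) := by
    refine IsBigO.of_bound 1 ?_
    filter_upwards [hev] with t ht
    have ht0 : 0 < t := ht.1
    rw [Real.rpow_neg_one, Complex.norm_real, Real.norm_of_nonneg (logSeries_nonneg _),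
      Real.norm_of_nonneg (by positivity), one_mul, ← one_div]
    exact (logSeries_le_kernel ht0).trans (kernel_one_le_inv ht0)
  have hAan : ∀ s : ℂ, -1 < s.re → AnalyticAt ℂ (mellin fun t => (R t : ℂ)) s := by
    intro s hs
    rw [Complex.analyticAt_iff_eventually_differentiableAt]
    have : {z : ℂ | -1 < z.re} ∈ 𝓝 s := (isOpen_lt continuous_const Complex.continuous_re).mem_nhds hs
    filter_upwards [this] with z hz
    exact mellin_differentiableAt_of_isBigO_rpow_exp one_pos hlR hRtop hRbot hz
  refine ⟨_, hAan, ?_⟩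
  set U : Set ℂ := {z : ℂ | -1 < z.re} with hUdef
  have hUconv : Convex ℝ U := convex_halfSpace_re_gt (-1)
  set F : ℂ → ℂ := fun z => Complex.Gamma z * riemannZeta (z + 1) * (macMahonDirichlet d z - e)
    - (∑ j ∈ Finset.Icc 1 d, (c j : ℂ) / (z - j) + c₀ / z + mellin (fun t => (R t : ℂ)) z) with hF
  have hFmer : MeromorphicOn F U := by
    intro z hz
    refine MeromorphicAt.fun_sub ?_ ?_
    · refine MeromorphicAt.fun_mul (MeromorphicAt.fun_mul (Meromorphic.Gamma z) ?_) ?_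
      · exact (meromorphicAt_riemannZeta (z + 1)).comp_analyticAt (f := riemannZeta)
          (g := fun z => z + 1) (by fun_prop)
      · exact (meromorphicAt_macMahonDirichlet d z).fun_sub (MeromorphicAt.const _ _)
    · refine MeromorphicAt.fun_add (MeromorphicAt.fun_add
        (MeromorphicAt.fun_sum fun j _ => ?_) ?_) (hAan z hz).meromorphicAt
      · exact MeromorphicAt.fun_div (MeromorphicAt.const _ _)
          ((MeromorphicAt.id z).fun_sub (MeromorphicAt.const _ _))
      · exact MeromorphicAt.fun_div (MeromorphicAt.const _ _) (MeromorphicAt.id z)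
  have hzero : ∀ s : ℂ, (d : ℝ) < s.re → F s = 0 := by
    intro s hs
    have hs0 : 0 < s.re := by linarith
    have hp := hasMellin_polarPart d c c₀ hs0 hs
    have hlc : MellinConvergent (fun t => (logSeries t : ℂ)) s :=
      mellinConvergent_of_isBigO_rpow_exp one_pos hll hltop hlbot (by linarith)
    have hRc : MellinConvergent (fun t => (R t : ℂ)) s :=
      mellinConvergent_of_isBigO_rpow_exp one_pos hlR hRtop hRbot (by linarith)
    have h1 := hasMellin_const_smul hlc (e : ℂ)
    have h2 := hasMellin_add (hasMellin_add hRc h1.1).1 hp.1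
    rw [(hasMellin_add hRc h1.1).2, h1.2, hp.2, mellin_logSeries hs0] at h2
    have h3 : (fun t => (R t : ℂ) + (e : ℂ) • (logSeries t : ℂ) + (polarPart d c c₀ t : ℂ))
        = fun t => (moment d 0 t : ℂ) := by
      ext t; simp only [hR, smul_eq_mul]; push_cast; ring
    rw [h3] at h2
    have h4 := h2.2
    rw [mellin_moment hd hs, smul_eq_mul] at h4
    simp only [hF]
    linear_combination h4
  have htop : meromorphicOrderAt F ((d : ℂ) + 1) = ⊤ := by
    rw [meromorphicOrderAt_eq_top_iff]
    have : {z : ℂ | (d : ℝ) < z.re} ∈ 𝓝 ((d : ℂ) + 1) :=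
      (isOpen_lt continuous_const Complex.continuous_re).mem_nhds (by simp)
    exact nhdsWithin_le_nhds (by filter_upwards [this] with z hz using hzero z hz)
  have hmem : ((d : ℂ) + 1) ∈ U := by simp [hUdef]; linarith
  intro s hs
  have : meromorphicOrderAt F s = ⊤ := by
    by_contra hne
    exact hFmer.meromorphicOrderAt_ne_top_of_isPreconnected hUconv.isPreconnected hs hmem hne htop
  rw [meromorphicOrderAt_eq_top_iff] at this
  filter_upwards [this] with z hz
  exact sub_eq_zero.mp hz

lemma tendsto_sub_mul_self {f : ℂ → ℂ} {s a : ℂ} (hf : ContinuousAt f s) (ha : a = s) :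
    Tendsto (fun z => (z - a) * f z) (𝓝[≠] s) (𝓝 0) := by
  subst ha
  have h : ContinuousAt (fun z => (z - a) * f z) a := (by fun_prop : ContinuousAt (fun z => z - a) a).mul hf
  have := h.tendsto
  simp only [sub_self, zero_mul] at this
  exact this.mono_left nhdsWithin_le_nhds

/-- The residue at `k` of a sum of simple fractions. -/
lemma tendsto_sub_mul_sum (d : ℕ) (c : ℕ → ℂ) {k : ℕ} (hk : k ∈ Finset.Icc 1 d) :
    Tendsto (fun z : ℂ => (z - k) * ∑ j ∈ Finset.Icc 1 d, c j / (z - j)) (𝓝[≠] (k : ℂ))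
      (𝓝 (c k)) := by
  have hterm : ∀ j ∈ Finset.Icc 1 d, Tendsto (fun z : ℂ => (z - k) * (c j / (z - j)))
      (𝓝[≠] (k : ℂ)) (𝓝 (if j = k then c j else 0)) := by
    intro j _
    by_cases hjk : j = k
    · subst hjk
      rw [if_pos rfl]
      refine tendsto_const_nhds.congr' ?_
      filter_upwards [self_mem_nhdsWithin] with z hz
      have : z - j ≠ 0 := sub_ne_zero.mpr hz
      field_simp
    · rw [if_neg hjk]
      refine tendsto_sub_mul_self ?_ rfl
      refine ContinuousAt.div continuousAt_const (by fun_prop) (sub_ne_zero.mpr ?_)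
      exact_mod_cast Ne.symm hjk
  have := tendsto_finsetSum _ hterm
  rw [Finset.sum_ite_eq' _ k, if_pos hk] at this
  refine this.congr fun z => ?_
  rw [Finset.mul_sum]

lemma tendsto_mul_riemannZeta_add_one :
    Tendsto (fun z : ℂ => z * riemannZeta (z + 1)) (𝓝[≠] 0) (𝓝 1) := by
  have h1 : Tendsto (fun z : ℂ => z + 1) (𝓝[≠] 0) (𝓝[≠] 1) := by
    rw [tendsto_nhdsWithin_iff]
    constructor
    · have : Tendsto (fun z : ℂ => z + 1) (𝓝 0) (𝓝 (0 + 1)) :=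
        (continuous_id.add continuous_const).tendsto _
      rw [zero_add] at this
      exact this.mono_left nhdsWithin_le_nhds
    · filter_upwards [self_mem_nhdsWithin] with z hz
      simpa using hz
  refine (riemannZeta_residue_one.comp h1).congr fun z => ?_
  simp

lemma riemannZeta_natCast_eq {k : ℕ} (hk : 1 < k) :
    riemannZeta k = ((∑' n : ℕ, 1 / (n : ℝ) ^ k : ℝ) : ℂ) := by
  rw [zeta_nat_eq_tsum_of_gt_one hk]
  push_cast
  rfl

lemma zetaR_eq {k : ℕ} (hk : 1 < k) : (zetaR k : ℂ) = riemannZeta k := by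
  rw [zetaR, riemannZeta_natCast_eq hk, Complex.ofReal_re]

lemma zetaR_pos {k : ℕ} (hk : 1 < k) : 0 < zetaR k := by
  rw [zetaR, riemannZeta_natCast_eq hk, Complex.ofReal_re]
  exact (Real.summable_one_div_nat_pow.mpr hk).tsum_pos (fun n => by positivity) 1 (by norm_num)

lemma macMahonResidue_nonneg (d k : ℕ) : 0 ≤ macMahonResidue d k := by
  unfold macMahonResidue macMahonPoly
  rw [Polynomial.coeff_C_mul]
  refine mul_nonneg (by positivity) ?_
  rw [← ascPochhammer_map (algebraMap ℕ ℝ), Polynomial.coeff_map]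
  simp

lemma macMahonC_nonneg (d : ℕ) {k : ℕ} (hk : 1 ≤ k) : 0 ≤ macMahonC d k := by
  unfold macMahonC
  have h1 := macMahonResidue_nonneg d k
  have h2 : 0 < Real.Gamma (k + 1) := Real.Gamma_pos_of_pos (by positivity)
  have h3 := zetaR_pos (k := k + 1) (by omega)
  positivity

lemma macMahonC_self {d : ℕ} (hd : 1 ≤ d) : macMahonC d d = d * zetaR (d + 1) := by
  obtain ⟨m, rfl⟩ := Nat.exists_eq_add_of_le' hd
  have h1 : macMahonResidue (m + 1) (m + 1) = (m.factorial : ℝ)⁻¹ := by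
    unfold macMahonResidue macMahonPoly
    rw [Polynomial.coeff_C_mul]
    simp only [Nat.add_sub_cancel]
    have : (ascPochhammer ℝ m).coeff m = 1 := by
      have := monic_ascPochhammer ℝ m
      rw [Polynomial.Monic, Polynomial.leadingCoeff, ascPochhammer_natDegree] at this
      exact this
    rw [this, mul_one]
  have h2 : Real.Gamma (((m + 1 : ℕ) : ℝ) + 1) = (m + 1) * m.factorial := by
    rw [Real.Gamma_nat_eq_factorial, Nat.factorial_succ]; push_cast; ring
  have hm : (m.factorial : ℝ) ≠ 0 := by positivity
  unfold macMahonC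
  rw [h1, h2]
  push_cast
  field_simp

lemma macMahonC_self_pos {d : ℕ} (hd : 1 ≤ d) : 0 < macMahonC d d := by
  rw [macMahonC_self hd]
  have := zetaR_pos (k := d + 1) (by omega)
  have : (0 : ℝ) < d := by exact_mod_cast hd
  positivity

/-- `log M_d(e^{-t})` up to `O(t)`, with the term `-D_d(0) log t` replaced by
`-D_d(0) log (1 - e^{-t})`. The coefficients are read off from `eventually_mellin_identity`: those
of `t^{-k}` from the residues at `k`, the last two from the double pole of `Γ(s) ζ(s+1)` at `0`. -/
lemma exists_abs_moment_sub_le {d : ℕ} (hd : 1 ≤ d) : ∃ B : ℝ, ∀ t, 0 < t →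
    |moment d 0 t - (∑ j ∈ Finset.Icc 1 d, macMahonC d j / (j * t ^ j) +
      (macMahonDirichlet d 0).re * logSeries t + (deriv (macMahonDirichlet d) 0).re)| ≤ B * t := by
  obtain ⟨c, e, c₀, B, h⟩ := exists_real_expansion hd
  obtain ⟨A, hA, hid⟩ := eventually_mellin_identity hd h
  -- residues at the positive integers
  have hc : ∀ k ∈ Finset.Icc 1 d, c k = macMahonC d k / k := by
    intro k hk
    have hk1 := (Finset.mem_Icc.mp hk).1
    have hkpos : (0 : ℝ) < k := by exact_mod_cast hk1
    have hre : -1 < ((k : ℂ)).re := by simp; linarith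
    have hk0 : (k : ℂ) ≠ 0 := by exact_mod_cast (by omega : k ≠ 0)
    have hG : ContinuousAt (fun z : ℂ => Complex.Gamma z * riemannZeta (z + 1)) k := by
      refine ContinuousAt.mul (Complex.differentiableAt_Gamma _ fun m hm => ?_).continuousAt
        (ContinuousAt.comp (g := riemannZeta) (f := fun z : ℂ => z + 1) ?_ (by fun_prop))
      · have := congrArg Complex.re hm
        simp at this
        have h2 : (0 : ℝ) ≤ m := by positivity
        linarith
      · exact (differentiableAt_riemannZeta (by simpa using hk0)).continuousAt
    have l1 := (hG.tendsto.mono_left (nhdsWithin_le_nhds (s := {(k : ℂ)}ᶜ))).mul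
      (macMahonResidue_spec d k hd hk1)
    have l2 := tendsto_sub_mul_self (hG.mul (continuousAt_const (y := (e : ℂ)))) rfl
    have l3 := l1.sub l2
    have r1 := tendsto_sub_mul_sum d (fun j => (c j : ℂ)) hk
    have r2 := tendsto_sub_mul_self (f := fun z => (c₀ : ℂ) / z + A z) (s := (k : ℂ))
      ((ContinuousAt.div continuousAt_const continuousAt_id hk0).add
        (hA k hre).continuousAt) rfl
    have r3 := r1.add r2
    rw [sub_zero] at l3
    rw [add_zero] at r3
    have := tendsto_nhds_unique (l3.congr' ?_) r3
    · have hGk : Complex.Gamma (k : ℂ) = (Real.Gamma k : ℂ) := by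
        rw [← Complex.Gamma_ofReal, Complex.ofReal_natCast]
      rw [hGk, show (k : ℂ) + 1 = ((k + 1 : ℕ) : ℂ) by push_cast; ring,
        ← zetaR_eq (k := k + 1) (by omega)] at this
      have h5 : c k = Real.Gamma k * zetaR (k + 1) * macMahonResidue d k := by
        exact_mod_cast this.symm
      rw [h5, macMahonC, Real.Gamma_add_one hkpos.ne']
      field_simp
    · filter_upwards [hid k hre] with z hz
      simp only [Pi.mul_apply]
      linear_combination (z - k) * hz
  -- the double pole at zero
  have hD := analyticAt_macMahonDirichlet_zero d
  have hre0 : -1 < (0 : ℂ).re := by simp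
  have hsumc : ContinuousAt (fun z : ℂ => ∑ j ∈ Finset.Icc 1 d, (c j : ℂ) / (z - j)) 0 := by
    refine tendsto_finsetSum _ fun j hj => ContinuousAt.div continuousAt_const (by fun_prop) ?_
    have := (Finset.mem_Icc.mp hj).1
    simp only [zero_sub, ne_eq, neg_eq_zero]
    exact_mod_cast (by omega : j ≠ 0)
  have hrest := hsumc.add (hA 0 hre0).continuousAt
  have hz0 : Tendsto (fun z : ℂ => z) (𝓝[≠] 0) (𝓝 0) := tendsto_id.mono_left nhdsWithin_le_nhds
  have hprod := Complex.tendsto_self_mul_Gamma_nhds_zero.mul tendsto_mul_riemannZeta_add_one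
  have he : macMahonDirichlet d 0 = e := by
    have l1 := hprod.mul
      ((hD.continuousAt.sub (continuousAt_const (y := (e : ℂ)))).tendsto.mono_left
        (nhdsWithin_le_nhds (s := {(0 : ℂ)}ᶜ)))
    have r1 := (hz0.mul_const (c₀ : ℂ)).add (hz0.mul (tendsto_sub_mul_self hrest rfl))
    have := tendsto_nhds_unique (l1.congr' ?_) r1
    · simpa [sub_eq_zero] using this
    · filter_upwards [hid 0 hre0, self_mem_nhdsWithin] with z hz hz'
      have hzne : z ≠ 0 := hz'
      have e1 : (c₀ : ℂ) / z * z = c₀ := by field_simp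
      simp only [sub_zero, Pi.add_apply, Pi.sub_apply]
      linear_combination z ^ 2 * hz + z * e1
  have hc0 : deriv (macMahonDirichlet d) 0 = c₀ := by
    have hder := hasDerivAt_iff_tendsto_slope.mp hD.differentiableAt.hasDerivAt
    have l1 := hprod.mul hder
    have r1 := (tendsto_const_nhds (x := (c₀ : ℂ))).add (tendsto_sub_mul_self hrest rfl)
    have := tendsto_nhds_unique (l1.congr' ?_) r1
    · simpa using this
    · filter_upwards [hid 0 hre0, self_mem_nhdsWithin] with z hz hz'
      have hzne : z ≠ 0 := hz'
      have e1 : (c₀ : ℂ) / z * z = c₀ := by field_simp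
      have e2 : slope (macMahonDirichlet d) 0 z * z = macMahonDirichlet d z - e := by
        rw [slope_def_field, he, sub_zero]; field_simp
      simp only [sub_zero, Pi.add_apply]
      linear_combination z * hz + e1 + z * Complex.Gamma z * riemannZeta (z + 1) * e2
  refine ⟨B, fun t ht => ?_⟩
  have h1 := h t ht
  have h2 : ∑ j ∈ Finset.Icc 1 d, macMahonC d j / (j * t ^ j) = ∑ j ∈ Finset.Icc 1 d, c j / t ^ j :=
    Finset.sum_congr rfl fun j hj => by rw [hc j hj, div_div]
  rw [h2, he, hc0, Complex.ofReal_re, Complex.ofReal_re]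
  exact h1

/-! ### Asymptotics of the first two derivatives of `log M_d(e^{-t})` -/

/-- The main part of `log M_d(e^{-t})` as `t → 0`. -/
noncomputable def logMain (d : ℕ) (t : ℝ) : ℝ :=
  ∑ j ∈ Finset.Icc 1 d, macMahonC d j / (j * t ^ j) - (macMahonDirichlet d 0).re * Real.log t +
    (deriv (macMahonDirichlet d) 0).re

lemma abs_logSeries_add_log_le {t : ℝ} (ht : 0 < t) : |logSeries t + Real.log t| ≤ t := by
  have h1 : Real.exp (-t) < 1 := by rw [Real.exp_lt_one_iff]; linarith
  have h2 := Real.add_one_le_exp t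
  have h3 : Real.exp (-t) * Real.exp t = 1 := by rw [← Real.exp_add]; simp
  have h4 := Real.add_one_le_exp (-t)
  have h5 : t * Real.exp (-t) ≤ 1 - Real.exp (-t) := by
    nlinarith [mul_le_mul_of_nonneg_left h2 (Real.exp_pos (-t)).le]
  have h6 := Real.log_le_log (by positivity) h5
  rw [Real.log_mul ht.ne' (Real.exp_pos _).ne', Real.log_exp] at h6
  have h7 := Real.log_le_log (by linarith) (show 1 - Real.exp (-t) ≤ t by linarith)
  rw [logSeries_eq ht, abs_le]
  constructor <;> linarith

lemma exists_abs_moment_sub_logMain_le {d : ℕ} (hd : 1 ≤ d) :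
    ∃ B : ℝ, 0 ≤ B ∧ ∀ t, 0 < t → |moment d 0 t - logMain d t| ≤ B * t := by
  obtain ⟨B, hB⟩ := exists_abs_moment_sub_le hd
  refine ⟨|B| + |(macMahonDirichlet d 0).re|, by positivity, fun t ht => ?_⟩
  have h1 := hB t ht
  have h2 := mul_le_mul_of_nonneg_left (abs_logSeries_add_log_le ht)
    (abs_nonneg (macMahonDirichlet d 0).re)
  rw [← abs_mul] at h2
  have h3 := abs_add_le (moment d 0 t - (∑ j ∈ Finset.Icc 1 d, macMahonC d j / (j * t ^ j) +
      (macMahonDirichlet d 0).re * logSeries t + (deriv (macMahonDirichlet d) 0).re))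
      ((macMahonDirichlet d 0).re * (logSeries t + Real.log t))
  have h4 : B * t ≤ |B| * t := mul_le_mul_of_nonneg_right (le_abs_self B) ht.le
  rw [add_mul]
  refine le_trans (le_of_eq ?_) (h3.trans (by linarith))
  unfold logMain
  congr 1
  ring

lemma inv_pow_le_inv_pow {t : ℝ} (ht : 0 < t) (ht1 : t ≤ 1) {j d : ℕ} (hjd : j ≤ d) :
    (t ^ j)⁻¹ ≤ (t ^ d)⁻¹ :=
  inv_anti₀ (by positivity) (pow_le_pow_of_le_one ht.le ht1 hjd)

lemma one_le_inv_pow {t : ℝ} (ht : 0 < t) (ht1 : t ≤ 1) (d : ℕ) : 1 ≤ (t ^ d)⁻¹ := by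
  simpa using inv_pow_le_inv_pow ht ht1 (Nat.zero_le d)

lemma abs_sum_div_pow_le {d : ℕ} (c : ℕ → ℝ) {t : ℝ} (ht : 0 < t) (ht1 : t ≤ 1) :
    |∑ j ∈ Finset.Icc 1 d, c j / t ^ j| ≤ (∑ j ∈ Finset.Icc 1 d, |c j|) * (t ^ d)⁻¹ := by
  rw [Finset.sum_mul]
  refine (Finset.abs_sum_le_sum_abs _ _).trans (Finset.sum_le_sum fun j hj => ?_)
  rw [abs_div, abs_of_pos (pow_pos ht j), div_eq_mul_inv]
  exact mul_le_mul_of_nonneg_left (inv_pow_le_inv_pow ht ht1 (Finset.mem_Icc.mp hj).2)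
    (abs_nonneg _)

lemma exists_moment_zero_le {d : ℕ} (hd : 1 ≤ d) :
    ∃ C : ℝ, 0 ≤ C ∧ ∀ t, 0 < t → t ≤ 1 → moment d 0 t ≤ C * (t ^ d)⁻¹ := by
  obtain ⟨B, hB⟩ := exists_abs_moment_sub_le hd
  refine ⟨∑ j ∈ Finset.Icc 1 d, |macMahonC d j / j| + |(macMahonDirichlet d 0).re| +
    |(deriv (macMahonDirichlet d) 0).re| + |B|, by positivity, fun t ht ht1 => ?_⟩
  have h1 := (abs_le.mp (hB t ht)).2
  have h2 : ∑ j ∈ Finset.Icc 1 d, macMahonC d j / (j * t ^ j)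
      = ∑ j ∈ Finset.Icc 1 d, (macMahonC d j / j) / t ^ j :=
    Finset.sum_congr rfl fun j _ => by rw [div_div]
  have h3 := (abs_le.mp (abs_sum_div_pow_le (d := d) (fun j => macMahonC d j / j) ht ht1)).2
  have h4 : logSeries t ≤ (t ^ d)⁻¹ := by
    refine ((logSeries_le_kernel ht).trans (kernel_one_le_inv ht)).trans ?_
    rw [one_div]
    simpa using inv_pow_le_inv_pow ht ht1 hd
  have hone := one_le_inv_pow ht ht1 d
  have h5 : (macMahonDirichlet d 0).re * logSeries t ≤ |(macMahonDirichlet d 0).re| * (t ^ d)⁻¹ :=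
    mul_le_mul (le_abs_self _) h4 (logSeries_nonneg t) (abs_nonneg _)
  have h6 : (deriv (macMahonDirichlet d) 0).re ≤
      |(deriv (macMahonDirichlet d) 0).re| * (t ^ d)⁻¹ :=
    (le_abs_self _).trans (le_mul_of_one_le_right (abs_nonneg _) hone)
  have h7 : B * t ≤ |B| * (t ^ d)⁻¹ :=
    mul_le_mul (le_abs_self _) (ht1.trans hone) ht.le (abs_nonneg _)
  rw [h2] at h1
  simp only [add_mul]
  linarith

lemma exists_moment_le {d : ℕ} (hd : 1 ≤ d) (r : ℕ) :
    ∃ C : ℝ, 0 ≤ C ∧ ∀ t, 0 < t → t ≤ 1 → t ^ r * moment d r t ≤ C * (t ^ d)⁻¹ := by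
  obtain ⟨C, hC, h⟩ := exists_moment_zero_le hd
  refine ⟨r.factorial * 2 ^ r * (C * 2 ^ d), by positivity, fun t ht ht1 => ?_⟩
  have h1 := moment_le_moment_zero hd r ht
  have h2 := h (t / 2) (by positivity) (by linarith)
  have htr : t ^ r ≠ 0 := by positivity
  calc t ^ r * moment d r t
      ≤ t ^ r * (r.factorial * (2 / t) ^ r * (C * ((t / 2) ^ d)⁻¹)) := by gcongr; exact h1.trans (by gcongr)
    _ = _ := by
      rw [div_pow, div_pow, inv_div]
      field_simp

lemma exists_inv_pow_taylor (j : ℕ) : ∃ C : ℝ, 0 ≤ C ∧ ∀ v : ℝ, |v| ≤ 1 / 2 →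
    |((1 + v) ^ j)⁻¹ - (1 - j * v + j * (j + 1) / 2 * v ^ 2 - j * (j + 1) * (j + 2) / 6 * v ^ 3)|
      ≤ C * v ^ 4 := by
  induction j with
  | zero => exact ⟨0, le_rfl, fun v _ => by simp⟩
  | succ j ih =>
    obtain ⟨C, hC, h⟩ := ih
    refine ⟨2 * (C + (j + 1) * (j + 2) * (j + 3) / 6), by positivity, fun v hv => ?_⟩
    have hv' := abs_le.mp hv
    have hpos : 0 < 1 + v := by linarith
    have hinv : (1 + v)⁻¹ ≤ 2 := by
      rw [inv_le_comm₀ hpos two_pos]; linarith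
    have h1 := h v hv
    have e1 : ((1 + v) ^ (j + 1))⁻¹ - (1 - ((j + 1 : ℕ) : ℝ) * v +
        ((j + 1 : ℕ) : ℝ) * (((j + 1 : ℕ) : ℝ) + 1) / 2 * v ^ 2 -
        ((j + 1 : ℕ) : ℝ) * (((j + 1 : ℕ) : ℝ) + 1) * (((j + 1 : ℕ) : ℝ) + 2) / 6 * v ^ 3)
        = (1 + v)⁻¹ * ((((1 + v) ^ j)⁻¹ - (1 - j * v + j * (j + 1) / 2 * v ^ 2 -
          j * (j + 1) * (j + 2) / 6 * v ^ 3)) + (j + 1) * (j + 2) * (j + 3) / 6 * v ^ 4) := by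
      push_cast
      field_simp
      ring
    rw [e1, abs_mul, abs_of_pos (inv_pos.mpr hpos), mul_assoc 2]
    refine mul_le_mul hinv ((abs_add_le _ _).trans ?_) (abs_nonneg _) zero_le_two
    rw [add_mul C]
    exact add_le_add h1 (le_of_eq (abs_of_nonneg (by positivity)))

lemma log_one_add_taylor {v : ℝ} (hv : |v| ≤ 1 / 2) :
    |Real.log (1 + v) - (v - v ^ 2 / 2 + v ^ 3 / 3)| ≤ 2 * v ^ 4 := by
  have h := Real.abs_log_sub_add_sum_range_le (x := -v) (by rw [abs_neg]; linarith) 3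
  simp only [Finset.sum_range_succ, Finset.sum_range_zero] at h
  rw [abs_neg, sub_neg_eq_add] at h
  have h2 : |v| ^ 4 / (1 - |v|) ≤ 2 * v ^ 4 := by
    rw [show |v| ^ 4 = v ^ 4 by rw [← abs_pow]; exact abs_of_nonneg (by positivity),
      div_le_iff₀ (by linarith)]
    have : 0 ≤ v ^ 4 := by positivity
    nlinarith
  refine le_trans (le_of_eq ?_) (h.trans h2)
  congr 1
  push_cast
  ring

/-- Third order Taylor expansion of the main part, in the relative increment `v`, uniform in `t`. -/
lemma logMain_taylor (d : ℕ) : ∃ C : ℝ, 0 ≤ C ∧ ∀ t, 0 < t → t ≤ 1 → ∀ v : ℝ, |v| ≤ 1 / 2 →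
    |logMain d (t * (1 + v)) - (logMain d t
      - (∑ j ∈ Finset.Icc 1 d, macMahonC d j / t ^ j + (macMahonDirichlet d 0).re) * v
      + (∑ j ∈ Finset.Icc 1 d, (j + 1) * macMahonC d j / t ^ j + (macMahonDirichlet d 0).re) / 2
          * v ^ 2
      - (∑ j ∈ Finset.Icc 1 d, (j + 1) * (j + 2) * macMahonC d j / t ^ j
          + 2 * (macMahonDirichlet d 0).re) / 6 * v ^ 3)| ≤ C * (t ^ d)⁻¹ * v ^ 4 := by
  choose K hK hKb using exists_inv_pow_taylor
  refine ⟨∑ j ∈ Finset.Icc 1 d, |macMahonC d j / j * K j| + |(macMahonDirichlet d 0).re| * 2,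
    by positivity, fun t ht ht1 v hv => ?_⟩
  have hv' := abs_le.mp hv
  have hpos : 0 < 1 + v := by linarith
  set a := (macMahonDirichlet d 0).re with ha
  have hv4 : 0 ≤ v ^ 4 := by positivity
  have e1 : logMain d (t * (1 + v)) - (logMain d t
      - (∑ j ∈ Finset.Icc 1 d, macMahonC d j / t ^ j + a) * v
      + (∑ j ∈ Finset.Icc 1 d, (j + 1) * macMahonC d j / t ^ j + a) / 2 * v ^ 2
      - (∑ j ∈ Finset.Icc 1 d, (j + 1) * (j + 2) * macMahonC d j / t ^ j + 2 * a) / 6 * v ^ 3)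
      = ∑ j ∈ Finset.Icc 1 d, (macMahonC d j / j * (((1 + v) ^ j)⁻¹ - (1 - j * v +
          j * (j + 1) / 2 * v ^ 2 - j * (j + 1) * (j + 2) / 6 * v ^ 3))) / t ^ j
        - a * (Real.log (1 + v) - (v - v ^ 2 / 2 + v ^ 3 / 3)) := by
    have e2 : ∀ j ∈ Finset.Icc 1 d, (macMahonC d j / j * (((1 + v) ^ j)⁻¹ - (1 - j * v +
          j * (j + 1) / 2 * v ^ 2 - j * (j + 1) * (j + 2) / 6 * v ^ 3))) / t ^ j
        = macMahonC d j / (j * (t * (1 + v)) ^ j) - macMahonC d j / (j * t ^ j)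
          + macMahonC d j / t ^ j * v - (j + 1) * macMahonC d j / t ^ j * (v ^ 2 / 2)
          + (j + 1) * (j + 2) * macMahonC d j / t ^ j * (v ^ 3 / 6) := by
      intro j hj
      have hj0 : (j : ℝ) ≠ 0 := by
        have := (Finset.mem_Icc.mp hj).1
        exact_mod_cast (by omega : j ≠ 0)
      rw [mul_pow]
      field_simp
      ring
    rw [Finset.sum_congr rfl e2]
    simp only [Finset.sum_add_distrib, Finset.sum_sub_distrib, ← Finset.sum_mul]
    unfold logMain
    rw [Real.log_mul ht.ne' hpos.ne']
    ring
  rw [e1]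
  have h1 := log_one_add_taylor hv
  have h2 : |a * (Real.log (1 + v) - (v - v ^ 2 / 2 + v ^ 3 / 3))|
      ≤ |a| * 2 * (t ^ d)⁻¹ * v ^ 4 := by
    rw [abs_mul, mul_assoc, mul_assoc]
    refine mul_le_mul_of_nonneg_left (h1.trans ?_) (abs_nonneg _)
    have := one_le_inv_pow ht ht1 d
    nlinarith
  have h3 := abs_sum_div_pow_le (d := d) (fun j => macMahonC d j / j * (((1 + v) ^ j)⁻¹ -
    (1 - j * v + j * (j + 1) / 2 * v ^ 2 - j * (j + 1) * (j + 2) / 6 * v ^ 3))) ht ht1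
  have h4 : ∑ j ∈ Finset.Icc 1 d, |macMahonC d j / j * (((1 + v) ^ j)⁻¹ -
      (1 - j * v + j * (j + 1) / 2 * v ^ 2 - j * (j + 1) * (j + 2) / 6 * v ^ 3))|
      ≤ (∑ j ∈ Finset.Icc 1 d, |macMahonC d j / j * K j|) * v ^ 4 := by
    rw [Finset.sum_mul]
    refine Finset.sum_le_sum fun j _ => ?_
    rw [abs_mul, abs_mul, abs_of_nonneg (hK j), mul_assoc |macMahonC d j / j|]
    exact mul_le_mul_of_nonneg_left (hKb j v hv) (abs_nonneg _)
  have h5 := mul_le_mul_of_nonneg_right h4 (by positivity : 0 ≤ (t ^ d)⁻¹)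
  have h6 := abs_sub (∑ j ∈ Finset.Icc 1 d, (macMahonC d j / j * (((1 + v) ^ j)⁻¹ - (1 - j * v +
          j * (j + 1) / 2 * v ^ 2 - j * (j + 1) * (j + 2) / 6 * v ^ 3))) / t ^ j)
        (a * (Real.log (1 + v) - (v - v ^ 2 / 2 + v ^ 3 / 3)))
  calc _ ≤ _ := h6
    _ ≤ (∑ j ∈ Finset.Icc 1 d, |macMahonC d j / j * K j|) * v ^ 4 * (t ^ d)⁻¹
        + |a| * 2 * (t ^ d)⁻¹ * v ^ 4 := add_le_add (h3.trans h5) h2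
    _ = _ := by ring

lemma moment_zero_convex {d : ℕ} (hd : 1 ≤ d) {t v : ℝ} (ht : 0 < t) (hv : |v| ≤ 1 / 2) :
    moment d 0 t - v * (t * moment d 1 t) ≤ moment d 0 (t * (1 + v)) := by
  have hv' := abs_le.mp hv
  have h0 := (summable_moment hd 0 ht).hasSum
  have h1 := (summable_moment hd 1 ht).hasSum.mul_left (v * t)
  have h2 := (summable_moment hd 0 (t := t * (1 + v)) (by nlinarith)).hasSum
  have := hasSum_le (fun p => ?_) (h0.sub h1) h2
  · unfold moment
    linarith
  · have hw := weight_nonneg d p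
    have e1 : Real.exp (-(freq p * (t * (1 + v))))
        = Real.exp (-(freq p * t)) * Real.exp (-(freq p * t * v)) := by
      rw [← Real.exp_add]; ring_nf
    have e2 := Real.add_one_le_exp (-(freq p * t * v))
    rw [e1]
    have := mul_le_mul_of_nonneg_left e2 (mul_nonneg hw (Real.exp_pos (-(freq p * t))).le)
    nlinarith

lemma abs_exp_add_exp_neg_sub_le (x : ℝ) :
    |Real.exp x + Real.exp (-x) - 2 - x ^ 2| ≤ 2 * x ^ 4 * Real.exp |x| := by
  have key : ∀ y : ℝ, |Real.exp y - (1 + y + y ^ 2 / 2 + y ^ 3 / 6)| ≤ y ^ 4 * Real.exp |y| := by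
    intro y
    have h := Complex.norm_exp_sub_sum_le_norm_mul_exp (y : ℂ) 4
    have e : Complex.exp y - ∑ m ∈ Finset.range 4, (y : ℂ) ^ m / (m.factorial : ℂ)
        = ((Real.exp y - (1 + y + y ^ 2 / 2 + y ^ 3 / 6) : ℝ) : ℂ) := by
      simp only [Finset.sum_range_succ, Finset.sum_range_zero, Nat.factorial]
      push_cast; ring
    rw [e, Complex.norm_real, Complex.norm_real, Real.norm_eq_abs, Real.norm_eq_abs] at h
    rwa [show |y| ^ 4 = y ^ 4 by rw [← abs_pow]; exact abs_of_nonneg (by positivity)] at h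
  have h1 := key x
  have h2 := key (-x)
  rw [abs_neg] at h2
  have h3 := abs_add_le (Real.exp x - (1 + x + x ^ 2 / 2 + x ^ 3 / 6))
    (Real.exp (-x) - (1 + -x + (-x) ^ 2 / 2 + (-x) ^ 3 / 6))
  have e : Real.exp x + Real.exp (-x) - 2 - x ^ 2 = Real.exp x - (1 + x + x ^ 2 / 2 + x ^ 3 / 6) +
    (Real.exp (-x) - (1 + -x + (-x) ^ 2 / 2 + (-x) ^ 3 / 6)) := by ring
  rw [e]
  have : (-x) ^ 4 = x ^ 4 := by ring
  rw [this] at h2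
  linarith

lemma abs_moment_second_difference_le {d : ℕ} (hd : 1 ≤ d) {t v : ℝ} (ht : 0 < t) (hv0 : 0 ≤ v)
    (hv : v ≤ 1 / 2) :
    |moment d 0 (t * (1 + v)) + moment d 0 (t * (1 - v)) - 2 * moment d 0 t
      - v ^ 2 * (t ^ 2 * moment d 2 t)| ≤ 2 * v ^ 4 * t ^ 4 * moment d 4 (t / 2) := by
  have h0 := (summable_moment hd 0 ht).hasSum.mul_left 2
  have h1 := (summable_moment hd 0 (t := t * (1 + v)) (by nlinarith)).hasSum
  have h2 := (summable_moment hd 0 (t := t * (1 - v)) (by nlinarith)).hasSum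
  have h3 := (summable_moment hd 2 ht).hasSum.mul_left (v ^ 2 * t ^ 2)
  have h4 := (summable_moment hd 4 (half_pos ht)).hasSum.mul_left (2 * v ^ 4 * t ^ 4)
  have h5 := ((h1.add h2).sub h0).sub h3
  have hb : ∀ p, ‖weight d p * freq p ^ 0 * Real.exp (-(freq p * (t * (1 + v))))
      + weight d p * freq p ^ 0 * Real.exp (-(freq p * (t * (1 - v))))
      - 2 * (weight d p * freq p ^ 0 * Real.exp (-(freq p * t)))
      - v ^ 2 * t ^ 2 * (weight d p * freq p ^ 2 * Real.exp (-(freq p * t)))‖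
      ≤ 2 * v ^ 4 * t ^ 4 * (weight d p * freq p ^ 4 * Real.exp (-(freq p * (t / 2)))) := by
    intro p
    have hw := weight_nonneg d p
    have hf := (freq_pos p).le
    set x := freq p * t * v with hx
    have hx0 : 0 ≤ x := by positivity
    have e1 : Real.exp (-(freq p * (t * (1 + v)))) = Real.exp (-(freq p * t)) * Real.exp (-x) := by
      rw [← Real.exp_add, hx]; ring_nf
    have e2 : Real.exp (-(freq p * (t * (1 - v)))) = Real.exp (-(freq p * t)) * Real.exp x := by
      rw [← Real.exp_add, hx]; ring_nf
    have e3 : weight d p * freq p ^ 0 * Real.exp (-(freq p * (t * (1 + v))))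
      + weight d p * freq p ^ 0 * Real.exp (-(freq p * (t * (1 - v))))
      - 2 * (weight d p * freq p ^ 0 * Real.exp (-(freq p * t)))
      - v ^ 2 * t ^ 2 * (weight d p * freq p ^ 2 * Real.exp (-(freq p * t)))
      = weight d p * Real.exp (-(freq p * t)) * (Real.exp x + Real.exp (-x) - 2 - x ^ 2) := by
      rw [e1, e2, hx]; ring
    rw [e3, Real.norm_eq_abs, abs_mul, abs_of_nonneg (by positivity)]
    have h6 := abs_exp_add_exp_neg_sub_le x
    rw [abs_of_nonneg hx0] at h6
    have h7 : Real.exp (-(freq p * t)) * Real.exp x ≤ Real.exp (-(freq p * (t / 2))) := by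
      rw [← Real.exp_add]
      refine Real.exp_le_exp.mpr ?_
      have : freq p * t * v ≤ freq p * t * (1 / 2) :=
        mul_le_mul_of_nonneg_left hv (by positivity)
      rw [hx]; linarith
    calc _ ≤ weight d p * Real.exp (-(freq p * t)) * (2 * x ^ 4 * Real.exp x) := by gcongr
      _ = weight d p * (2 * x ^ 4) * (Real.exp (-(freq p * t)) * Real.exp x) := by ring
      _ ≤ weight d p * (2 * x ^ 4) * Real.exp (-(freq p * (t / 2))) := by gcongr
      _ = _ := by rw [hx]; ring
  have h6 := h5.norm_le_of_bounded h4 hb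
  unfold moment
  rw [Real.norm_eq_abs] at h6
  refine le_trans (le_of_eq ?_) h6
  congr 1
  ring

/-- The error bound is `|t * moment d 1 t - ∑ C_j / t^j| = O(t^{(1-d)/2})`, which is what the saddle
point method needs. An asymptotic formula cannot be differentiated in general, but `moment d 0` is
convex, so its derivative lies between difference quotients. -/
lemma exists_moment_one_asymp {d : ℕ} (hd : 1 ≤ d) : ∃ C : ℝ, 0 ≤ C ∧ ∀ t, 0 < t → t ≤ 1 →
    (t * moment d 1 t - ∑ j ∈ Finset.Icc 1 d, macMahonC d j / t ^ j) ^ 2 * t ^ d ≤ C * t := by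
  obtain ⟨B, hB0, hB⟩ := exists_abs_moment_sub_logMain_le hd
  obtain ⟨C, hC0, hC⟩ := logMain_taylor d
  set a := (macMahonDirichlet d 0).re with ha
  set K := (∑ j ∈ Finset.Icc 1 d, |(j + 1) * macMahonC d j| + |a|) / 2 +
    (∑ j ∈ Finset.Icc 1 d, |(j + 1) * (j + 2) * macMahonC d j| + 2 * |a|) / 6 + C with hK
  have hK0 : 0 ≤ K := by positivity
  refine ⟨2 * (2 * (K + 3 * B)) ^ 2 + 2 * a ^ 2, by positivity, fun t ht ht1 => ?_⟩
  set S := ∑ j ∈ Finset.Icc 1 d, macMahonC d j / t ^ j with hS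
  set X := t * moment d 1 t - S - a with hX
  have hone := one_le_inv_pow ht ht1 d
  set T := (t ^ d)⁻¹ with hT
  have hmain : ∀ v : ℝ, |v| ≤ 1 / 2 → -(v * X) ≤ K * T * v ^ 2 + 3 * B * t := by
    intro v hv
    have hv' := abs_le.mp hv
    have h1 := moment_zero_convex hd ht hv
    have h2 := (abs_le.mp (hB t ht)).1
    have h3 := (abs_le.mp (hB (t * (1 + v)) (by nlinarith))).2
    have h4 := (abs_le.mp (hC t ht ht1 v hv)).2
    have h5 : B * (t * (1 + v)) ≤ 2 * (B * t) := by nlinarith [mul_nonneg hB0 ht.le]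
    have hS2 := abs_sum_div_pow_le (d := d) (fun j => (j + 1) * macMahonC d j) ht ht1
    have hS3 := abs_sum_div_pow_le (d := d) (fun j => (j + 1) * (j + 2) * macMahonC d j) ht ht1
    set s2 := ∑ j ∈ Finset.Icc 1 d, (j + 1) * macMahonC d j / t ^ j
    set s3 := ∑ j ∈ Finset.Icc 1 d, (j + 1) * (j + 2) * macMahonC d j / t ^ j
    set k2 := ∑ j ∈ Finset.Icc 1 d, |(j + 1) * macMahonC d j|
    set k3 := ∑ j ∈ Finset.Icc 1 d, |(j + 1) * (j + 2) * macMahonC d j|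
    have haT : |a| ≤ |a| * T := le_mul_of_one_le_right (abs_nonneg _) hone
    have b2 : (s2 + a) / 2 * v ^ 2 ≤ (k2 + |a|) / 2 * T * v ^ 2 := by
      have : s2 + a ≤ (k2 + |a|) * T := by
        have := le_abs_self s2; have := le_abs_self a; rw [add_mul]; linarith
      nlinarith [sq_nonneg v]
    have b3 : -((s3 + 2 * a) / 6 * v ^ 3) ≤ (k3 + 2 * |a|) / 6 * T * v ^ 2 := by
      have h6 : |s3 + 2 * a| ≤ (k3 + 2 * |a|) * T := by
        have h7 := abs_add_le s3 (2 * a)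
        rw [abs_mul, abs_two] at h7
        rw [add_mul]; linarith
      have h8 : |v ^ 3| ≤ v ^ 2 := by
        rw [abs_pow, pow_succ, sq_abs]
        exact mul_le_of_le_one_right (sq_nonneg v) (by linarith)
      have h9 := mul_le_mul h6 h8 (abs_nonneg _) ((abs_nonneg _).trans h6)
      rw [← abs_mul] at h9
      have := neg_abs_le ((s3 + 2 * a) * v ^ 3)
      linarith
    have b4 : C * T * v ^ 4 ≤ C * T * v ^ 2 := by
      refine mul_le_mul_of_nonneg_left ?_ (mul_nonneg hC0 (by positivity))
      have : v ^ 2 ≤ 1 := by nlinarith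
      nlinarith [sq_nonneg v]
    have e1 : K * T * v ^ 2 = (k2 + |a|) / 2 * T * v ^ 2 + (k3 + 2 * |a|) / 6 * T * v ^ 2
      + C * T * v ^ 2 := by rw [hK]; ring
    have e2 : -(v * X) = -(v * (t * moment d 1 t)) + (S + a) * v := by rw [hX]; ring
    rw [e1, e2]
    linarith
  -- the increment `v ≈ t^((d+1)/2)` balances the error terms `t^(-d) v^2` and `t`
  set q := Real.sqrt (t ^ (d + 1)) with hq
  have hq0 : 0 < q := Real.sqrt_pos.mpr (by positivity)
  have hqq : q ^ 2 = t ^ (d + 1) := Real.sq_sqrt (by positivity)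
  have hq1 : q ≤ 1 := by
    rw [hq, Real.sqrt_le_one]; exact pow_le_one₀ ht.le ht1
  have hTq : T * q ^ 2 = t := by
    rw [hqq, hT, pow_succ]; field_simp
  have hX1 := hmain (q / 2) (by rw [abs_of_pos (by positivity)]; linarith)
  have hX2 := hmain (-(q / 2)) (by rw [abs_neg, abs_of_pos (by positivity)]; linarith)
  have e3 : K * T * (q / 2) ^ 2 = K * t / 4 := by rw [← hTq]; ring
  rw [e3] at hX1
  rw [show (-(q / 2)) ^ 2 = (q / 2) ^ 2 by ring, e3] at hX2
  have hKt : 0 ≤ K * t := mul_nonneg hK0 ht.le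
  have hXq : |X * q| ≤ 2 * (K + 3 * B) * t := by
    have hBt : 0 ≤ B * t := mul_nonneg hB0 ht.le
    rw [abs_le]
    constructor <;> linarith
  have hXq2 : (X * q) ^ 2 ≤ (2 * (K + 3 * B) * t) ^ 2 := sq_le_sq' (abs_le.mp hXq).1 (abs_le.mp hXq).2
  have hXT : X ^ 2 * t ^ d ≤ (2 * (K + 3 * B)) ^ 2 * t := by
    rw [mul_pow, hqq, pow_succ t d] at hXq2
    have : X ^ 2 * t ^ d * t ≤ (2 * (K + 3 * B)) ^ 2 * t * t := by linarith only [hXq2]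
    exact le_of_mul_le_mul_right this ht
  have htd : t ^ d ≤ t := by simpa using pow_le_pow_of_le_one ht.le ht1 hd
  have e4 : t * moment d 1 t - S = X + a := by rw [hX]; ring
  rw [e4]
  have h10 : (X + a) ^ 2 ≤ 2 * X ^ 2 + 2 * a ^ 2 := by
    linarith only [sq_nonneg (X - a)]
  have h11 := mul_le_mul_of_nonneg_right h10 (by positivity : 0 ≤ t ^ d)
  have h12 := mul_le_mul_of_nonneg_left htd (by positivity : 0 ≤ 2 * a ^ 2)
  calc (X + a) ^ 2 * t ^ d ≤ (2 * X ^ 2 + 2 * a ^ 2) * t ^ d := h11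
    _ = 2 * (X ^ 2 * t ^ d) + 2 * a ^ 2 * t ^ d := by ring
    _ ≤ 2 * ((2 * (K + 3 * B)) ^ 2 * t) + 2 * a ^ 2 * t := by linarith only [hXT, h12]
    _ = _ := by ring

/-- The second moment up to a relative error `O(t)`, from symmetric second differences, whose own
error is controlled by the fourth moment. -/
lemma exists_moment_two_asymp {d : ℕ} (hd : 1 ≤ d) : ∃ C : ℝ, 0 ≤ C ∧ ∀ t, 0 < t → t ≤ 1 →
    |t ^ 2 * moment d 2 t - ∑ j ∈ Finset.Icc 1 d, (j + 1) * macMahonC d j / t ^ j| * t ^ d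
      ≤ C * t := by
  obtain ⟨B, hB0, hB⟩ := exists_abs_moment_sub_logMain_le hd
  obtain ⟨C, hC0, hC⟩ := logMain_taylor d
  obtain ⟨M, hM0, hM⟩ := exists_moment_le hd 4
  set a := (macMahonDirichlet d 0).re with ha
  set K := 2 * C + 32 * M * 2 ^ d with hK
  have hK0 : 0 ≤ K := by positivity
  refine ⟨4 * (K + 5 * B) + |a|, by positivity, fun t ht ht1 => ?_⟩
  set S := ∑ j ∈ Finset.Icc 1 d, (j + 1) * macMahonC d j / t ^ j with hS
  set X := t ^ 2 * moment d 2 t - S - a with hX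
  set T := (t ^ d)⁻¹ with hT
  have hmain : ∀ v : ℝ, 0 ≤ v → v ≤ 1 / 2 → v ^ 2 * |X| ≤ K * T * v ^ 4 + 5 * B * t := by
    intro v hv0 hv
    have h1 := abs_le.mp (abs_moment_second_difference_le hd ht hv0 hv)
    have h2 := abs_le.mp (hB t ht)
    have h3 := abs_le.mp (hB (t * (1 + v)) (by nlinarith))
    have h4 := abs_le.mp (hB (t * (1 - v)) (by nlinarith))
    have h5 := abs_le.mp (hC t ht ht1 v (by rw [abs_of_nonneg hv0]; exact hv))
    have h6 := abs_le.mp (hC t ht ht1 (-v) (by rw [abs_neg, abs_of_nonneg hv0]; exact hv))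
    have h7 : 2 * v ^ 4 * t ^ 4 * moment d 4 (t / 2) ≤ 32 * M * 2 ^ d * T * v ^ 4 := by
      have h8 := hM (t / 2) (by positivity) (by linarith)
      have e : M * ((t / 2) ^ d)⁻¹ = M * 2 ^ d * T := by
        rw [div_pow, inv_div, hT]; field_simp
      rw [e] at h8
      have := mul_le_mul_of_nonneg_left h8 (by positivity : 0 ≤ 32 * v ^ 4)
      calc _ = 32 * v ^ 4 * ((t / 2) ^ 4 * moment d 4 (t / 2)) := by ring
        _ ≤ _ := this
        _ = _ := by ring
    rw [show v ^ 2 * |X| = |v ^ 2 * X| by rw [abs_mul, abs_of_nonneg (sq_nonneg v)]]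
    have e1 : K * T * v ^ 4 = 2 * (C * T * v ^ 4) + 32 * M * 2 ^ d * T * v ^ 4 := by
      rw [hK]; ring
    have e2 : v ^ 2 * X = v ^ 2 * (t ^ 2 * moment d 2 t) - (S + a) * v ^ 2 := by rw [hX]; ring
    rw [show (-v) ^ 4 = v ^ 4 by ring, show (-v) ^ 2 = v ^ 2 by ring,
      show (-v) ^ 3 = -v ^ 3 by ring, ← sub_eq_add_neg] at h6
    rw [e1, e2, abs_le]
    constructor
    · nlinarith [mul_nonneg hB0 ht.le]
    · nlinarith [mul_nonneg hB0 ht.le]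
  -- the increment `v ≈ t^((d+1)/4)` balances the error terms `t^(-d) v^4` and `t`
  set q := Real.sqrt (t ^ (d + 1)) with hq
  have hq0 : 0 < q := Real.sqrt_pos.mpr (by positivity)
  have hqq : q ^ 2 = t ^ (d + 1) := Real.sq_sqrt (by positivity)
  have hqt : q ≤ t := by
    rw [hq, Real.sqrt_le_left ht.le]
    exact pow_le_pow_of_le_one ht.le ht1 (by omega)
  have hTq : T * q ^ 2 = t := by
    rw [hqq, hT, pow_succ]; field_simp
  have hs0 : 0 ≤ Real.sqrt q := Real.sqrt_nonneg _
  have hss : Real.sqrt q ^ 2 = q := Real.sq_sqrt hq0.le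
  have hs1 : Real.sqrt q ≤ 1 := by rw [Real.sqrt_le_one]; linarith
  have h1 := hmain (Real.sqrt q / 2) (by positivity) (by linarith)
  have e3 : K * T * (Real.sqrt q / 2) ^ 4 = K * t / 16 := by
    rw [← hTq, div_pow, show Real.sqrt q ^ 4 = (Real.sqrt q ^ 2) ^ 2 by ring, hss]; ring
  rw [e3, div_pow, hss] at h1
  have hXq : |X| * q ≤ 4 * (K + 5 * B) * t := by nlinarith [mul_nonneg hK0 ht.le]
  have hXT : |X| * t ^ d ≤ 4 * (K + 5 * B) * t := by
    have h2 : |X| * q * q ≤ 4 * (K + 5 * B) * t * t :=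
      mul_le_mul hXq hqt hq0.le (by positivity)
    have h3 : |X| * q * q = |X| * t ^ d * t := by
      rw [mul_assoc, ← sq, hqq, pow_succ]; ring
    rw [h3] at h2
    exact le_of_mul_le_mul_right h2 ht
  have htd : t ^ d ≤ t := by simpa using pow_le_pow_of_le_one ht.le ht1 hd
  have e4 : t ^ 2 * moment d 2 t - S = X + a := by rw [hX]; ring
  rw [e4]
  have h10 := mul_le_mul_of_nonneg_right (abs_add_le X a) (by positivity : 0 ≤ t ^ d)
  have h12 := mul_le_mul_of_nonneg_left htd (abs_nonneg a)
  rw [add_mul] at h10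
  rw [add_mul]
  linarith

/-! ### The saddle point method -/

lemma norm_exp_I_mul_sub_linear_le (x : ℝ) :
    ‖Complex.exp (Complex.I * x) - 1 - Complex.I * x‖ ≤ 3 * x ^ 2 := by
  have hn : ‖Complex.I * (x : ℂ)‖ = |x| := by simp
  have h1 : ‖Complex.exp (Complex.I * x)‖ = 1 := by rw [mul_comm]; exact Complex.norm_exp_ofReal_mul_I x
  rw [← sq_abs x]
  rcases le_total |x| 1 with h | h
  · have := Complex.norm_exp_sub_one_sub_id_le (x := Complex.I * x) (by rwa [hn])
    rw [hn] at this
    nlinarith [sq_nonneg |x|]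
  · have h2 := norm_sub_le (Complex.exp (Complex.I * x) - 1) (Complex.I * x)
    have h3 := norm_sub_le (Complex.exp (Complex.I * x)) 1
    rw [hn] at h2
    rw [h1, norm_one] at h3
    nlinarith

lemma norm_exp_I_mul_sub_cubic_le (x : ℝ) :
    ‖Complex.exp (Complex.I * x) - (1 + Complex.I * x - x ^ 2 / 2 - Complex.I * x ^ 3 / 6)‖
      ≤ 4 * x ^ 4 := by
  have hn : ‖Complex.I * (x : ℂ)‖ = |x| := by simp
  have h1 : ‖Complex.exp (Complex.I * x)‖ = 1 := by rw [mul_comm]; exact Complex.norm_exp_ofReal_mul_I x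
  have e4 : x ^ 4 = |x| ^ 4 := by rw [← abs_pow]; exact (abs_of_nonneg (by positivity)).symm
  rw [e4]
  rcases le_total |x| 1 with h | h
  · have := Complex.exp_bound (x := Complex.I * x) (by rwa [hn]) (n := 4) (by norm_num)
    rw [hn] at this
    have e : ∑ m ∈ Finset.range 4, (Complex.I * (x : ℂ)) ^ m / (m.factorial : ℂ)
        = 1 + Complex.I * x - x ^ 2 / 2 - Complex.I * x ^ 3 / 6 := by
      simp only [Finset.sum_range_succ, Finset.sum_range_zero, Nat.factorial, mul_pow,
        Complex.I_sq, Complex.I_pow_three]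
      push_cast
      ring
    rw [e] at this
    refine this.trans ?_
    rw [mul_comm]
    refine mul_le_mul_of_nonneg_right ?_ (by positivity)
    norm_num [Nat.factorial]
  · have h2 := norm_sub_le (Complex.exp (Complex.I * x))
      (1 + Complex.I * x - x ^ 2 / 2 - Complex.I * x ^ 3 / 6)
    have h3 := norm_sub_le (1 + Complex.I * x - x ^ 2 / 2) (Complex.I * (x : ℂ) ^ 3 / 6)
    have h4 := norm_sub_le (1 + Complex.I * x) ((x : ℂ) ^ 2 / 2)
    have h5 := norm_add_le 1 (Complex.I * (x : ℂ))
    have n3 : ‖Complex.I * (x : ℂ) ^ 3 / 6‖ = |x| ^ 3 / 6 := by simp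
    have n2 : ‖(x : ℂ) ^ 2 / 2‖ = |x| ^ 2 / 2 := by simp
    rw [hn, norm_one] at h5
    rw [n2] at h4
    rw [n3] at h3
    rw [h1] at h2
    have p1 : |x| ≤ |x| ^ 4 := le_self_pow₀ h (by norm_num)
    have p2 : |x| ^ 2 ≤ |x| ^ 4 := pow_le_pow_right₀ h (by norm_num)
    have p3 : |x| ^ 3 ≤ |x| ^ 4 := pow_le_pow_right₀ h (by norm_num)
    linarith

/-- Third order Taylor expansion of `log M_d(e^{-z})` along a vertical line, with the remainder
controlled by a moment. -/
lemma norm_logM_sub_cubic_le {d : ℕ} (hd : 1 ≤ d) {t : ℝ} (ht : 0 < t) (y : ℝ) :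
    ‖logM d (t + y * Complex.I) - (moment d 0 t - Complex.I * y * moment d 1 t
      - y ^ 2 / 2 * moment d 2 t + Complex.I * y ^ 3 / 6 * moment d 3 t)‖
      ≤ 4 * moment d 4 t * y ^ 4 := by
  have hre : (0 : ℝ) < ((t : ℂ) + y * Complex.I).re := by simpa using ht
  have h := (summable_logM hd hre).hasSum
  have hm : ∀ r, HasSum (fun p => ((weight d p * freq p ^ r * Real.exp (-(freq p * t)) : ℝ) : ℂ))
      (moment d r t : ℂ) := fun r => Complex.hasSum_ofReal.mpr (summable_moment hd r ht).hasSum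
  have h2 := h.sub ((((hm 0).sub ((hm 1).mul_left (Complex.I * y))).sub
    ((hm 2).mul_left ((y : ℂ) ^ 2 / 2))).add ((hm 3).mul_left (Complex.I * y ^ 3 / 6)))
  have h4 := (summable_moment hd 4 ht).hasSum.mul_left (4 * y ^ 4)
  have := h2.norm_le_of_bounded h4 fun p => ?_
  · refine this.trans (le_of_eq ?_)
    unfold moment; ring
  · set N := freq p
    have hw := weight_nonneg d p
    have e1 : Complex.exp (-(N * ((t : ℂ) + y * Complex.I)))
        = (Real.exp (-(N * t)) : ℂ) * Complex.exp (Complex.I * ((-(N * y) : ℝ) : ℂ)) := by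
      push_cast
      rw [← Complex.exp_add]; congr 1; ring
    have e2 : (weight d p : ℂ) * Complex.exp (-(N * ((t : ℂ) + y * Complex.I)))
        - (((weight d p * N ^ 0 * Real.exp (-(N * t)) : ℝ) : ℂ)
          - Complex.I * y * ((weight d p * N ^ 1 * Real.exp (-(N * t)) : ℝ) : ℂ)
          - (y : ℂ) ^ 2 / 2 * ((weight d p * N ^ 2 * Real.exp (-(N * t)) : ℝ) : ℂ)
          + Complex.I * y ^ 3 / 6 * ((weight d p * N ^ 3 * Real.exp (-(N * t)) : ℝ) : ℂ))
        = ((weight d p * Real.exp (-(N * t)) : ℝ) : ℂ) *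
          (Complex.exp (Complex.I * ((-(N * y) : ℝ) : ℂ)) -
            (1 + Complex.I * ((-(N * y) : ℝ) : ℂ) - ((-(N * y) : ℝ) : ℂ) ^ 2 / 2
              - Complex.I * ((-(N * y) : ℝ) : ℂ) ^ 3 / 6)) := by
      rw [e1]; push_cast; ring
    rw [e2, norm_mul, Complex.norm_real, Real.norm_of_nonneg (by positivity)]
    calc _ ≤ weight d p * Real.exp (-(N * t)) * (4 * (-(N * y)) ^ 4) := by
          gcongr; exact norm_exp_I_mul_sub_cubic_le _
      _ = _ := by ring

/-- Away from the positive axis `|M_d|` is exponentially smaller than on it. All terms of the double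
series favour the positive axis, and those with `m = 1` already give a gain of order `t^{-d}`, since
`|1 - e^{-t-iy}|` exceeds `1 - e^{-t}` by a fixed factor. -/
lemma exists_logM_re_le {d : ℕ} (hd : 1 ≤ d) {δ : ℝ} (hδ : 0 < δ) :
    ∃ c : ℝ, 0 < c ∧ ∀ t, 0 < t → t ≤ 1 → ∀ y : ℝ, δ * t ≤ |y| → |y| ≤ Real.pi →
      (logM d (t + y * Complex.I)).re ≤ moment d 0 t - c * (t ^ d)⁻¹ := by
  set η := Real.exp (-1) * (4 * δ ^ 2 / Real.pi ^ 2) with hη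
  have hη0 : 0 < η := by positivity
  set s := Real.sqrt (1 + η) with hs
  have hs1 : 1 < s := by rw [hs, Real.lt_sqrt zero_le_one]; linarith
  have hsinv : s⁻¹ < 1 := inv_lt_one_of_one_lt₀ hs1
  refine ⟨Real.exp (-1) * (1 - s⁻¹), mul_pos (Real.exp_pos _) (by linarith),
    fun t ht ht1 y hy hyp => ?_⟩
  have hlt : Real.exp (-t) < 1 := by rw [Real.exp_lt_one_iff]; linarith
  set r := 1 - Real.exp (-t) with hr
  have hr0 : 0 < r := by rw [hr]; linarith
  have hrt : r ≤ t := by have := Real.add_one_le_exp (-t); rw [hr]; linarith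
  set q := Complex.exp (-(t + y * Complex.I)) with hq
  have hqn : ‖q‖ = Real.exp (-t) := by rw [hq, Complex.norm_exp]; simp
  have hre : (0 : ℝ) < ((t : ℂ) + y * Complex.I).re := by simpa using ht
  -- the terms with `m = 1` already give the gain
  have hgap : kernel d t - (q / (1 - q) ^ d).re ≤ moment d 0 t - (logM d (t + y * Complex.I)).re := by
    have f1 := (hasSum_kernel hd ht).sub
      (Complex.hasSum_re (hasSum_exponent_mul_pow hd (q := q) (by rw [hqn]; exact hlt)))
    have f2 := (summable_moment hd 0 ht).hasSum.sub (Complex.hasSum_re (summable_logM hd hre).hasSum)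
    refine hasSum_le_inj (fun i : ℕ => ((i, 0) : ℕ × ℕ)) (fun i j hij => by simpa using hij)
      (fun p _ => ?_) (fun i => le_of_eq ?_) f1 f2
    · have h1 := (Complex.re_le_norm ((weight d p : ℂ) *
        Complex.exp (-(freq p * ((t : ℂ) + y * Complex.I)))))
      have e : ((t : ℂ) + y * Complex.I).re = t := by simp
      rw [norm_term, e] at h1
      simp only [pow_zero, mul_one]
      linarith
    · simp only [weight, freq, pow_zero, mul_one, hq]
      rw [← Complex.exp_nat_mul]
      push_cast
      simp only [zero_add, mul_one, div_one]
      congr 3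
      congr 1
      ring
  have hden : r * s ≤ ‖1 - q‖ := by
    have hcos := Real.cos_le_one_sub_mul_cos_sq hyp
    have hqre : q.re = Real.exp (-t) * Real.cos y := by
      rw [hq, Complex.exp_re]; simp
    have hsq : ‖1 - q‖ ^ 2 = r ^ 2 + 2 * Real.exp (-t) * (1 - Real.cos y) := by
      have h1 : ‖1 - q‖ ^ 2 = 1 - 2 * q.re + ‖q‖ ^ 2 := by
        rw [← Complex.normSq_eq_norm_sq, ← Complex.normSq_eq_norm_sq, Complex.normSq_apply,
          Complex.normSq_apply]
        simp only [Complex.sub_re, Complex.one_re, Complex.sub_im, Complex.one_im]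
        ring
      rw [h1, hqn, hqre, hr]; ring
    have hy2 : (δ * t) ^ 2 ≤ y ^ 2 := by
      rw [← sq_abs y]; exact pow_le_pow_left₀ (by positivity) hy 2
    have he : Real.exp (-1) ≤ Real.exp (-t) := Real.exp_le_exp.mpr (by linarith)
    have hc : 2 / Real.pi ^ 2 * (δ * t) ^ 2 ≤ 1 - Real.cos y := by
      have : 2 / Real.pi ^ 2 * (δ * t) ^ 2 ≤ 2 / Real.pi ^ 2 * y ^ 2 := by gcongr
      linarith
    have hfin : (r * s) ^ 2 ≤ ‖1 - q‖ ^ 2 := by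
      rw [hsq, mul_pow, hs, Real.sq_sqrt (by positivity)]
      have h1 : Real.exp (-1) * (2 / Real.pi ^ 2 * (δ * t) ^ 2)
          ≤ Real.exp (-t) * (1 - Real.cos y) := mul_le_mul he hc (by positivity) (by positivity)
      have h2 : r ^ 2 * η ≤ t ^ 2 * η := by gcongr
      have h3 : t ^ 2 * η = 2 * (Real.exp (-1) * (2 / Real.pi ^ 2 * (δ * t) ^ 2)) := by
        rw [hη]; ring
      nlinarith
    exact le_of_sq_le_sq hfin (norm_nonneg _)
  have hnorm : (q / (1 - q) ^ d).re ≤ Real.exp (-t) / r ^ d * s⁻¹ := by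
    refine (Complex.re_le_norm _).trans ?_
    rw [norm_div, norm_pow, hqn, div_eq_mul_inv, div_eq_mul_inv, mul_assoc, ← mul_inv]
    refine mul_le_mul_of_nonneg_left (inv_anti₀ (by positivity) ?_) (by positivity)
    calc r ^ d * s ≤ r ^ d * s ^ d := by
          gcongr; exact le_self_pow₀ hs1.le (by omega)
      _ = (r * s) ^ d := (mul_pow _ _ _).symm
      _ ≤ _ := pow_le_pow_left₀ (by positivity) hden d
  have hk : Real.exp (-1) * (t ^ d)⁻¹ ≤ Real.exp (-t) / r ^ d := by
    rw [div_eq_mul_inv]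
    refine mul_le_mul (Real.exp_le_exp.mpr (by linarith)) (inv_anti₀ (by positivity)
      (pow_le_pow_left₀ hr0.le hrt d)) (by positivity) (by positivity)
  have hk2 := mul_le_mul_of_nonneg_right hk (by linarith : 0 ≤ 1 - s⁻¹)
  have hkd : kernel d t = Real.exp (-t) / r ^ d := rfl
  rw [hkd] at hgap
  linarith

lemma pow_mul_exp_neg_sq_le (k : ℕ) {b : ℝ} (hb : 0 < b) (y : ℝ) :
    (y ^ 2) ^ k * Real.exp (-(b / 4) * y ^ 2)
      ≤ k.factorial * (8 / b) ^ k * Real.exp (-(b / 8) * y ^ 2) := by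
  have h := pow_mul_exp_neg_le k (t := b / 4) (by positivity) (sq_nonneg y)
  have e1 : (2 : ℝ) / (b / 4) = 8 / b := by field_simp; norm_num
  have e2 : -(b / 4) * y ^ 2 = -(y ^ 2 * (b / 4)) := by ring
  have e3 : -(b / 8) * y ^ 2 = -(y ^ 2 * (b / 4 / 2)) := by ring
  rw [e1] at h
  rw [e2, e3]
  exact h

/-- Laplace's method with explicit error: if `Λ` is a quadratic phase `-b y^2/2` up to purely
imaginary odd terms and a fourth order error, then `∫ exp Λ` is the Gaussian integral up to
relative errors of second order in the odd terms, because the first order ones integrate to `0`. -/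
lemma norm_integral_exp_sub_gaussian_le {b a κ E Y : ℝ} (hb : 0 < b) (hE : 0 ≤ E) (hY : 0 < Y)
    (hEY : E * Y ^ 2 ≤ b / 4) {Λ : ℝ → ℂ} (hΛc : Continuous Λ)
    (hΛ : ∀ y : ℝ, |y| ≤ Y →
      ‖Λ y - (Complex.I * a * y - b / 2 * y ^ 2 + Complex.I * κ * y ^ 3)‖ ≤ E * y ^ 4) :
    ‖(∫ y in (-Y)..Y, Complex.exp (Λ y)) - (Real.sqrt (2 * Real.pi / b) : ℝ)‖
      ≤ Real.sqrt (2 * Real.pi / b) * (2 * (48 * a ^ 2 / b + 18432 * κ ^ 2 / b ^ 3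
          + 128 * E / b ^ 2 + 4 / (b * Y ^ 2))) := by
  set Q := 48 * a ^ 2 / b + 18432 * κ ^ 2 / b ^ 3 + 128 * E / b ^ 2 with hQ
  have hQ0 : 0 ≤ Q := by positivity
  set g : ℝ → ℝ := fun y => Real.exp (-(b / 2) * y ^ 2) with hg
  set w : ℝ → ℝ := fun y => Real.exp (-(b / 8) * y ^ 2) with hw
  have hgint : Integrable g := integrable_exp_neg_mul_sq (by positivity)
  have hwint : Integrable w := integrable_exp_neg_mul_sq (by positivity)
  have hgval : ∫ y, g y = Real.sqrt (2 * Real.pi / b) := by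
    rw [hg, integral_gaussian]; congr 1; field_simp
  have hwval : ∫ y, w y = 2 * Real.sqrt (2 * Real.pi / b) := by
    rw [hw, integral_gaussian, show Real.pi / (b / 8) = 2 ^ 2 * (2 * Real.pi / b) by field_simp; norm_num,
      Real.sqrt_mul (by positivity), Real.sqrt_sq zero_le_two]
  have hle : -Y ≤ Y := by linarith
  set θ : ℝ → ℝ := fun y => a * y + κ * y ^ 3 with hθ
  -- pointwise comparison
  have hpt : ∀ y : ℝ, |y| ≤ Y →
      ‖Complex.exp (Λ y) - ((g y : ℂ) + Complex.I * ((g y * θ y : ℝ) : ℂ))‖ ≤ Q * w y := by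
    intro y hy
    set ρ := Λ y - (Complex.I * a * y - b / 2 * y ^ 2 + Complex.I * κ * y ^ 3) with hρ
    have hρn : ‖ρ‖ ≤ E * y ^ 4 := hΛ y hy
    have hy2 : y ^ 2 ≤ Y ^ 2 := by rw [← sq_abs]; exact pow_le_pow_left₀ (abs_nonneg y) hy 2
    have hρ2 : ‖ρ‖ ≤ b / 4 * y ^ 2 := by
      refine hρn.trans ?_
      calc E * y ^ 4 = E * y ^ 2 * y ^ 2 := by ring
        _ ≤ E * Y ^ 2 * y ^ 2 := by gcongr
        _ ≤ _ := by gcongr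
    have eΛ : Complex.exp (Λ y) = (g y : ℂ) * Complex.exp (Complex.I * (θ y : ℝ)) * Complex.exp ρ := by
      rw [hg]
      push_cast
      rw [← Complex.exp_add, ← Complex.exp_add]
      congr 1
      rw [hρ, hθ]
      push_cast
      ring
    have hsplit : Complex.exp (Λ y) - ((g y : ℂ) + Complex.I * ((g y * θ y : ℝ) : ℂ))
        = (g y : ℂ) * Complex.exp (Complex.I * (θ y : ℝ)) * (Complex.exp ρ - 1)
          + (g y : ℂ) * (Complex.exp (Complex.I * (θ y : ℝ)) - 1 - Complex.I * (θ y : ℝ)) := by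
      rw [eΛ]; push_cast; ring
    have hg0 : 0 < g y := Real.exp_pos _
    have hexpρ : ‖Complex.exp ρ - 1‖ ≤ E * y ^ 4 * Real.exp (b / 4 * y ^ 2) := by
      have := Complex.norm_exp_sub_sum_le_norm_mul_exp ρ 1
      simp only [Finset.range_one, Finset.sum_singleton, pow_zero, Nat.factorial_zero, Nat.cast_one,
        div_one, pow_one] at this
      refine this.trans (mul_le_mul hρn (Real.exp_le_exp.mpr hρ2) (Real.exp_pos _).le (by positivity))
    have hI : ‖Complex.exp (Complex.I * (θ y : ℝ))‖ = 1 := by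
      rw [mul_comm]; exact Complex.norm_exp_ofReal_mul_I _
    have n1 : ‖(g y : ℂ) * Complex.exp (Complex.I * (θ y : ℝ)) * (Complex.exp ρ - 1)‖
        ≤ g y * (E * y ^ 4 * Real.exp (b / 4 * y ^ 2)) := by
      rw [norm_mul, norm_mul, hI, mul_one, Complex.norm_real, Real.norm_of_nonneg hg0.le]
      gcongr
    have n2 : ‖(g y : ℂ) * (Complex.exp (Complex.I * (θ y : ℝ)) - 1 - Complex.I * (θ y : ℝ))‖
        ≤ g y * (3 * θ y ^ 2) := by
      rw [norm_mul, Complex.norm_real, Real.norm_of_nonneg hg0.le]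
      exact mul_le_mul_of_nonneg_left (norm_exp_I_mul_sub_linear_le _) hg0.le
    set u := Real.exp (-(b / 4) * y ^ 2) with hu
    have eg1 : g y * Real.exp (b / 4 * y ^ 2) = u := by
      rw [hg, hu, ← Real.exp_add]; congr 1; ring
    have eg2 : g y ≤ u := by
      rw [hg, hu]; refine Real.exp_le_exp.mpr ?_; nlinarith [sq_nonneg y]
    have hu0 : 0 < u := Real.exp_pos _
    have hθ2 : 3 * θ y ^ 2 ≤ 6 * a ^ 2 * y ^ 2 + 6 * κ ^ 2 * y ^ 6 := by
      rw [hθ]; nlinarith [sq_nonneg (a * y - κ * y ^ 3)]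
    have g1 := pow_mul_exp_neg_sq_le 1 hb y
    have g2 := pow_mul_exp_neg_sq_le 2 hb y
    have g3 := pow_mul_exp_neg_sq_le 3 hb y
    rw [hsplit]
    refine (norm_add_le _ _).trans ((add_le_add n1 n2).trans ?_)
    calc g y * (E * y ^ 4 * Real.exp (b / 4 * y ^ 2)) + g y * (3 * θ y ^ 2)
        ≤ E * y ^ 4 * (g y * Real.exp (b / 4 * y ^ 2))
          + u * (6 * a ^ 2 * y ^ 2 + 6 * κ ^ 2 * y ^ 6) := by
          refine add_le_add (le_of_eq (by ring)) (mul_le_mul eg2 hθ2 (by positivity) hu0.le)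
      _ = E * ((y ^ 2) ^ 2 * u) + 6 * a ^ 2 * ((y ^ 2) ^ 1 * u) + 6 * κ ^ 2 * ((y ^ 2) ^ 3 * u) := by
          rw [eg1]; ring
      _ ≤ E * ((2 : ℕ).factorial * (8 / b) ^ 2 * w y) + 6 * a ^ 2 * ((1 : ℕ).factorial * (8 / b) ^ 1 * w y)
          + 6 * κ ^ 2 * ((3 : ℕ).factorial * (8 / b) ^ 3 * w y) := by
          gcongr
      _ = Q * w y := by
          rw [hQ]; simp only [Nat.factorial]; push_cast; field_simp; ring
  have hgc : Continuous g := by fun_prop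
  have hθc : Continuous θ := by fun_prop
  have hi1 : IntervalIntegrable (fun y => Complex.exp (Λ y)) volume (-Y) Y :=
    (Complex.continuous_exp.comp hΛc).intervalIntegrable _ _
  have hi2 : IntervalIntegrable (fun y => (g y : ℂ)) volume (-Y) Y :=
    (Complex.continuous_ofReal.comp hgc).intervalIntegrable _ _
  have hi3 : IntervalIntegrable (fun y => Complex.I * ((g y * θ y : ℝ) : ℂ)) volume (-Y) Y := by
    refine Continuous.intervalIntegrable ?_ _ _
    exact continuous_const.mul (Complex.continuous_ofReal.comp (hgc.mul hθc))
  have hodd : ∫ y in (-Y)..Y, g y * θ y = 0 := by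
    have h1 := intervalIntegral.integral_comp_neg (a := -Y) (b := Y) (fun y => g y * θ y)
    have h2 : ∀ y, g (-y) * θ (-y) = -(g y * θ y) := fun y => by
      simp only [hg, hθ, neg_sq]; ring
    simp only [h2, neg_neg, intervalIntegral.integral_neg] at h1
    linarith
  have hmain : ‖(∫ y in (-Y)..Y, Complex.exp (Λ y)) - ((∫ y in (-Y)..Y, g y : ℝ) : ℂ)‖
      ≤ Q * (2 * Real.sqrt (2 * Real.pi / b)) := by
    have e1 : (∫ y in (-Y)..Y, Complex.exp (Λ y)) - ((∫ y in (-Y)..Y, g y : ℝ) : ℂ)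
        = ∫ y in (-Y)..Y, (Complex.exp (Λ y) - ((g y : ℂ) + Complex.I * ((g y * θ y : ℝ) : ℂ))) := by
      rw [intervalIntegral.integral_sub hi1 (hi2.add hi3), intervalIntegral.integral_add hi2 hi3,
        intervalIntegral.integral_const_mul, intervalIntegral.integral_ofReal,
        intervalIntegral.integral_ofReal, hodd]
      simp
    rw [e1]
    have h1 : ‖∫ y in (-Y)..Y, (Complex.exp (Λ y) - ((g y : ℂ) + Complex.I * ((g y * θ y : ℝ) : ℂ)))‖
        ≤ ∫ y in (-Y)..Y, Q * w y := by
      refine intervalIntegral.norm_integral_le_of_norm_le hle (Eventually.of_forall fun y hy => ?_)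
        ((hwint.const_mul Q).intervalIntegrable)
      exact hpt y (abs_le.mpr ⟨hy.1.le, hy.2⟩)
    refine h1.trans ?_
    rw [intervalIntegral.integral_of_le hle, ← hwval, ← integral_const_mul]
    exact setIntegral_le_integral (hwint.const_mul Q)
      (Eventually.of_forall fun y => mul_nonneg hQ0 (Real.exp_pos _).le)
  have htail : |(∫ y in (-Y)..Y, g y) - Real.sqrt (2 * Real.pi / b)|
      ≤ 4 / (b * Y ^ 2) * (2 * Real.sqrt (2 * Real.pi / b)) := by
    have e1 : (∫ y in (-Y)..Y, g y) - Real.sqrt (2 * Real.pi / b)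
        = -∫ y in (Set.Ioc (-Y) Y)ᶜ, g y := by
      rw [intervalIntegral.integral_of_le hle, ← hgval,
        ← integral_add_compl (measurableSet_Ioc (a := -Y) (b := Y)) hgint]
      ring
    rw [e1, abs_neg, abs_of_nonneg (integral_nonneg fun y => (Real.exp_pos _).le), ← hwval,
      ← integral_const_mul]
    refine le_trans (setIntegral_mono_on hgint.integrableOn
      ((hwint.const_mul (4 / (b * Y ^ 2))).integrableOn) measurableSet_Ioc.compl fun y hy => ?_)
      (setIntegral_le_integral (hwint.const_mul _)
        (Eventually.of_forall fun y => mul_nonneg (by positivity) (Real.exp_pos _).le))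
    have hyY : Y ^ 2 ≤ y ^ 2 := by
      rw [← sq_abs y]
      refine pow_le_pow_left₀ hY.le ?_ 2
      by_contra hcon
      push Not at hcon
      exact hy ⟨(abs_lt.mp hcon).1, (abs_lt.mp hcon).2.le⟩
    have h1 : g y = Real.exp (-(3 * b / 8 * y ^ 2)) * w y := by
      rw [hg, hw, ← Real.exp_add]; ring_nf
    rw [h1]
    refine mul_le_mul_of_nonneg_right ?_ (Real.exp_pos _).le
    have h2 := Real.add_one_le_exp (3 * b / 8 * y ^ 2)
    have h3 : b * Y ^ 2 / 4 ≤ Real.exp (3 * b / 8 * y ^ 2) := by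
      have : b * Y ^ 2 ≤ b * y ^ 2 := by gcongr
      nlinarith [sq_nonneg y, mul_nonneg hb.le (sq_nonneg y)]
    rw [Real.exp_neg, ← inv_div (b * Y ^ 2) 4]
    exact inv_anti₀ (by positivity) h3
  have hfin := norm_add_le ((∫ y in (-Y)..Y, Complex.exp (Λ y)) - ((∫ y in (-Y)..Y, g y : ℝ) : ℂ))
    (((∫ y in (-Y)..Y, g y) - Real.sqrt (2 * Real.pi / b) : ℝ) : ℂ)
  rw [Complex.norm_real, Real.norm_eq_abs] at hfin
  have e : (∫ y in (-Y)..Y, Complex.exp (Λ y)) - (Real.sqrt (2 * Real.pi / b) : ℝ)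
      = ((∫ y in (-Y)..Y, Complex.exp (Λ y)) - ((∫ y in (-Y)..Y, g y : ℝ) : ℂ))
        + (((∫ y in (-Y)..Y, g y) - Real.sqrt (2 * Real.pi / b) : ℝ) : ℂ) := by
    push_cast; ring
  rw [e]
  refine hfin.trans ((add_le_add hmain htail).trans (le_of_eq ?_))
  ring

lemma continuous_logM_vertical {d : ℕ} (hd : 1 ≤ d) {t : ℝ} (ht : 0 < t) :
    Continuous fun y : ℝ => logM d (t + y * Complex.I) := by
  unfold logM
  refine continuous_tsum (fun p => by fun_prop) (summable_weight_mul_exp hd ht) fun p y => ?_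
  rw [norm_term]
  simp

lemma exp_neg_mul_le_pow_four {c T : ℝ} (hc : 0 < c) (hT : 0 < T) :
    Real.exp (-(c * T)) ≤ 24 / c ^ 4 * T⁻¹ ^ 4 := by
  have h := Real.pow_div_factorial_le_exp (c * T) (by positivity) 4
  rw [Real.exp_neg]
  have e : 24 / c ^ 4 * T⁻¹ ^ 4 = ((c * T) ^ 4 / (Nat.factorial 4 : ℕ))⁻¹ := by
    simp only [Nat.factorial]; push_cast; field_simp
  rw [e]
  exact inv_anti₀ (by positivity) h

/-- The part of the integral away from the saddle point is negligible where the integrand is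
small. -/
lemma norm_integral_sub_integral_le {f : ℝ → ℂ} (hf : Continuous f) {Y ε : ℝ} (hY0 : 0 < Y)
    (hYpi : Y ≤ Real.pi) (hε : 0 ≤ ε) (h : ∀ y : ℝ, Y ≤ |y| → |y| ≤ Real.pi → ‖f y‖ ≤ ε) :
    ‖(∫ y in (-Real.pi)..Real.pi, f y) - ∫ y in (-Y)..Y, f y‖ ≤ 2 * Real.pi * ε := by
  have hpi := Real.pi_pos
  have hii : ∀ u v, IntervalIntegrable f volume u v := fun u v => hf.intervalIntegrable _ _
  have ho1 : ‖∫ y in (-Real.pi)..(-Y), f y‖ ≤ ε * Real.pi := by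
    refine (intervalIntegral.norm_integral_le_of_norm_le_const (C := ε) fun y hy => ?_).trans ?_
    · rw [Set.uIoc_of_le (by linarith)] at hy
      have hyneg : y < 0 := by linarith [hy.2]
      exact h y (by rw [abs_of_neg hyneg]; linarith [hy.2]) (by rw [abs_of_neg hyneg]; linarith [hy.1])
    · rw [abs_of_nonneg (by linarith)]
      exact mul_le_mul_of_nonneg_left (by linarith) hε
  have ho2 : ‖∫ y in Y..Real.pi, f y‖ ≤ ε * Real.pi := by
    refine (intervalIntegral.norm_integral_le_of_norm_le_const (C := ε) fun y hy => ?_).trans ?_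
    · rw [Set.uIoc_of_le hYpi] at hy
      have hypos : 0 < y := by linarith [hy.1]
      exact h y (by rw [abs_of_pos hypos]; linarith [hy.1]) (by rw [abs_of_pos hypos]; exact hy.2)
    · rw [abs_of_nonneg (by linarith)]
      exact mul_le_mul_of_nonneg_left (by linarith) hε
  rw [← intervalIntegral.integral_add_adjacent_intervals (hii (-Real.pi) (-Y)) (hii _ _),
    ← intervalIntegral.integral_add_adjacent_intervals (hii (-Y) Y) (hii _ _),
    show ∀ a b c : ℂ, a + (b + c) - b = a + c by intros; ring]
  linarith [norm_add_le (∫ y in (-Real.pi)..(-Y), f y) (∫ y in Y..Real.pi, f y)]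

/-- Exponentially small quantities are small relative to the Gaussian integral. -/
lemma two_pi_mul_exp_le {d : ℕ} (hd : 1 ≤ d) {c M b t : ℝ} (hc : 0 < c) (hM : 0 ≤ M) (hb : 0 < b)
    (ht : 0 < t) (ht1 : t ≤ 1) (hbM : t ^ 2 * b ≤ M * (t ^ d)⁻¹) :
    2 * Real.pi * Real.exp (-(c * (t ^ d)⁻¹))
      ≤ Real.sqrt (2 * Real.pi / b) * (24 / c ^ 4 * (1 + 2 * Real.pi * M) * t) := by
  have hpi := Real.pi_pos
  have htd0 : 0 < t ^ d := by positivity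
  have htd : t ^ d ≤ t := by simpa using pow_le_pow_of_le_one ht.le ht1 hd
  have h3 : 2 * Real.pi = Real.sqrt (2 * Real.pi / b) * Real.sqrt (2 * Real.pi * b) := by
    rw [← Real.sqrt_mul (by positivity), show 2 * Real.pi / b * (2 * Real.pi * b)
      = (2 * Real.pi) ^ 2 by field_simp, Real.sqrt_sq (by positivity)]
  conv_lhs => rw [h3, mul_assoc]
  refine mul_le_mul_of_nonneg_left ?_ (Real.sqrt_nonneg _)
  have h4 : Real.sqrt (2 * Real.pi * b) ≤ 1 + 2 * Real.pi * b := by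
    have : 0 ≤ 2 * Real.pi * b := by positivity
    rw [Real.sqrt_le_left (by positivity)]
    nlinarith only [this]
  have h5 : b ≤ M * (t ^ d)⁻¹ / t ^ 2 := by
    rw [le_div_iff₀ (by positivity), mul_comm]; exact hbM
  have h6 := exp_neg_mul_le_pow_four hc (inv_pos.mpr htd0)
  rw [inv_inv] at h6
  have h7 : (t ^ d) ^ 4 ≤ t := by
    calc (t ^ d) ^ 4 ≤ t ^ 4 := pow_le_pow_left₀ htd0.le htd 4
      _ ≤ t := by simpa using pow_le_pow_of_le_one ht.le ht1 (by norm_num : 1 ≤ 4)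
  have h8 : (t ^ d) ^ 4 * ((t ^ d)⁻¹ / t ^ 2) ≤ t := by
    have : (t ^ d) ^ 4 * ((t ^ d)⁻¹ / t ^ 2) = (t ^ d) ^ 3 / t ^ 2 := by field_simp
    rw [this, div_le_iff₀ (by positivity)]
    calc (t ^ d) ^ 3 ≤ t ^ 3 := pow_le_pow_left₀ htd0.le htd 3
      _ = _ := by ring
  calc Real.sqrt (2 * Real.pi * b) * Real.exp (-(c * (t ^ d)⁻¹))
      ≤ (1 + 2 * Real.pi * (M * (t ^ d)⁻¹ / t ^ 2)) * (24 / c ^ 4 * (t ^ d) ^ 4) := by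
        refine mul_le_mul (h4.trans ?_) h6 (Real.exp_pos _).le (by positivity)
        gcongr
    _ = 24 / c ^ 4 * ((t ^ d) ^ 4 + 2 * Real.pi * M * ((t ^ d) ^ 4 * ((t ^ d)⁻¹ / t ^ 2))) := by
        ring
    _ ≤ 24 / c ^ 4 * (t + 2 * Real.pi * M * t) := by gcongr
    _ = _ := by ring

/-- The passage from the integral in Cauchy's formula to the coefficient. -/
lemma abs_div_sqrt_sub_one_le {m w b ε : ℝ} {I : ℂ} (hb : 0 < b) (hw : 0 < w)
    (hm : (m : ℂ) = (((2 * Real.pi)⁻¹ * w : ℝ) : ℂ) * I)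
    (hI : ‖I - (Real.sqrt (2 * Real.pi / b) : ℝ)‖ ≤ Real.sqrt (2 * Real.pi / b) * ε) :
    |m / (Real.sqrt (1 / (2 * Real.pi * b)) * w) - 1| ≤ ε := by
  have hpi := Real.pi_pos
  set g := Real.sqrt (2 * Real.pi / b) with hg
  have hg0 : 0 < g := Real.sqrt_pos.mpr (by positivity)
  have h3 : Real.sqrt (1 / (2 * Real.pi * b)) = g * (2 * Real.pi)⁻¹ := by
    have : 1 / (2 * Real.pi * b) = 2 * Real.pi / b * ((2 * Real.pi)⁻¹) ^ 2 := by field_simp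
    rw [this, Real.sqrt_mul (by positivity), Real.sqrt_sq (by positivity)]
  have hc2 : ((m / (Real.sqrt (1 / (2 * Real.pi * b)) * w) - 1 : ℝ) : ℂ)
      = (g⁻¹ : ℝ) * (I - (g : ℝ)) := by
    have hgc : (g : ℂ) ≠ 0 := by exact_mod_cast hg0.ne'
    have hwc : (w : ℂ) ≠ 0 := by exact_mod_cast hw.ne'
    have hpc : (Real.pi : ℂ) ≠ 0 := by exact_mod_cast hpi.ne'
    rw [h3, Complex.ofReal_sub, Complex.ofReal_div, hm]
    push_cast
    field_simp
  have := Complex.norm_real (m / (Real.sqrt (1 / (2 * Real.pi * b)) * w) - 1)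
  rw [Real.norm_eq_abs, hc2, norm_mul, Complex.norm_real, Real.norm_of_nonneg (by positivity)] at this
  rw [← this]
  calc g⁻¹ * ‖I - (g : ℝ)‖ ≤ g⁻¹ * (g * ε) := by gcongr
    _ = _ := by field_simp

set_option maxHeartbeats 1000000 in
/-- The saddle point formula in terms of the exact moments, at the saddle point of the main part.
The two differ, but by the precision of `exists_moment_one_asymp` the linear term that this leaves
in the exponent costs only a relative error `O(t)`. -/
lemma exists_macMahonNumber_asymp_moment {d : ℕ} (hd : 1 ≤ d) :
    ∃ K t₀ : ℝ, 0 ≤ K ∧ 0 < t₀ ∧ t₀ ≤ 1 ∧ ∀ (n : ℕ) (t : ℝ), 0 < t → t ≤ t₀ →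
      ∑ j ∈ Finset.Icc 1 d, macMahonC d j / t ^ (j + 1) = n →
      macMahonC d d / 2 * (t ^ d)⁻¹ ≤ t ^ 2 * moment d 2 t ∧
      |macMahonNumber d n / (Real.sqrt (1 / (2 * Real.pi * moment d 2 t)) *
        Real.exp (moment d 0 t + n * t)) - 1| ≤ K * t := by
  obtain ⟨C1, hC1, h1⟩ := exists_moment_one_asymp hd
  obtain ⟨C2, hC2, h2⟩ := exists_moment_two_asymp hd
  obtain ⟨M2, hM2, hm2⟩ := exists_moment_le hd 2
  obtain ⟨M3, hM3, hm3⟩ := exists_moment_le hd 3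
  obtain ⟨M4, hM4, hm4⟩ := exists_moment_le hd 4
  have hcd := macMahonC_self_pos hd
  set β := macMahonC d d / 2 with hβ
  have hβ0 : 0 < β := by positivity
  -- for `|y| ≤ δ t` the fourth order error stays below half of the quadratic term
  set δ := Real.sqrt (min 1 (β / (16 * (M4 + 1)))) with hδdef
  have hδ2 : δ ^ 2 = min 1 (β / (16 * (M4 + 1))) :=
    Real.sq_sqrt (le_min zero_le_one (by positivity))
  have hδ0 : 0 < δ := Real.sqrt_pos.mpr (lt_min one_pos (by positivity))
  have hδ1 : δ ≤ 1 := by rw [hδdef, Real.sqrt_le_one]; exact min_le_left _ _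
  have hδβ : 16 * δ ^ 2 * M4 ≤ β := by
    have h3 : δ ^ 2 ≤ β / (16 * (M4 + 1)) := hδ2 ▸ min_le_right _ _
    rw [le_div_iff₀ (by positivity)] at h3
    nlinarith [sq_nonneg δ]
  obtain ⟨c, hc, hout⟩ := exists_logM_re_le hd hδ0
  set K1 := 2 * (48 * (C1 / β) + 512 * (M3 ^ 2 / β ^ 3) + 512 * (M4 / β ^ 2) + 4 / (δ ^ 2 * β))
    with hK1
  set K2 := 24 / c ^ 4 * (1 + 2 * Real.pi * M2) with hK2
  refine ⟨K1 + K2, min 1 (β / (C2 + 1)), by positivity, lt_min one_pos (by positivity),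
    min_le_left _ _, fun n t ht htt hn => ?_⟩
  have ht1 : t ≤ 1 := htt.trans (min_le_left _ _)
  have htβ : C2 * t ≤ β := by
    have h3 : t ≤ β / (C2 + 1) := htt.trans (min_le_right _ _)
    rw [le_div_iff₀ (by positivity)] at h3
    nlinarith
  have htd0 : 0 < t ^ d := by positivity
  have htd : t ^ d ≤ t := by simpa using pow_le_pow_of_le_one ht.le ht1 hd
  set T := (t ^ d)⁻¹ with hT
  have hT0 : 0 < T := by positivity
  have hTt : T * t ^ d = 1 := inv_mul_cancel₀ htd0.ne'
  have hTinv : T⁻¹ = t ^ d := inv_inv _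
  set b := moment d 2 t with hb
  -- the lower bound for the second moment
  have hb2 : β * T ≤ t ^ 2 * b := by
    have h3 := h2 t ht ht1
    set S := ∑ j ∈ Finset.Icc 1 d, (j + 1) * macMahonC d j / t ^ j with hS
    have h4 : macMahonC d d * T ≤ S := by
      have h5 : (d + 1) * macMahonC d d / t ^ d ≤ S :=
        Finset.single_le_sum (f := fun j : ℕ => (j + 1) * macMahonC d j / t ^ j) (fun j hj => by
          have := macMahonC_nonneg d (Finset.mem_Icc.mp hj).1
          positivity) (Finset.mem_Icc.mpr ⟨hd, le_rfl⟩)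
      refine le_trans ?_ h5
      rw [div_eq_mul_inv]
      refine mul_le_mul_of_nonneg_right ?_ hT0.le
      have : (0 : ℝ) ≤ d := by positivity
      nlinarith
    have h6 : |t ^ 2 * b - S| ≤ C2 * t * T := by
      calc |t ^ 2 * b - S| = |t ^ 2 * b - S| * t ^ d * T := by rw [mul_assoc, mul_comm _ T, hTt, mul_one]
        _ ≤ C2 * t * T := by gcongr
    have h7 : C2 * t * T ≤ β * T := by gcongr
    have h8 := (abs_le.mp h6).1
    have h9 : macMahonC d d * T = 2 * (β * T) := by rw [hβ]; ring
    linarith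
  refine ⟨hb2, ?_⟩
  have hbT : 0 < t ^ 2 * b := (by positivity : 0 < β * T).trans_le hb2
  have hb0 : 0 < b := pos_of_mul_pos_right hbT (by positivity)
  set Y := δ * t with hY
  have hY0 : 0 < Y := by positivity
  have hYpi : Y ≤ Real.pi := by
    have := Real.pi_gt_three
    nlinarith
  set A := (n : ℝ) - moment d 1 t with hA
  set κ := moment d 3 t / 6 with hκ
  set E := 4 * moment d 4 t with hE
  have hm3' := hm3 t ht ht1
  have hm4' := hm4 t ht ht1
  have hE0 : 0 ≤ E := mul_nonneg zero_le_four (moment_nonneg _ _ _)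
  have hEY : E * Y ^ 2 ≤ b / 4 := by
    have h3 : 16 * δ ^ 2 * (t ^ 4 * moment d 4 t) ≤ t ^ 2 * b :=
      calc 16 * δ ^ 2 * (t ^ 4 * moment d 4 t) ≤ 16 * δ ^ 2 * (M4 * T) := by gcongr
        _ = 16 * δ ^ 2 * M4 * T := by ring
        _ ≤ β * T := by gcongr
        _ ≤ _ := hb2
    have h4 : t ^ 2 * (E * Y ^ 2) ≤ t ^ 2 * (b / 4) := by
      rw [hE, hY]
      calc _ = (16 * δ ^ 2 * (t ^ 4 * moment d 4 t)) / 4 := by ring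
        _ ≤ (t ^ 2 * b) / 4 := by gcongr
        _ = _ := by ring
    exact le_of_mul_le_mul_left h4 (by positivity)
  set Λ : ℝ → ℂ := fun y => logM d (t + y * Complex.I) + n * (t + y * Complex.I)
    - ((moment d 0 t + n * t : ℝ) : ℂ) with hΛ
  have hΛc : Continuous Λ := ((continuous_logM_vertical hd ht).add (by fun_prop)).sub continuous_const
  have hloc := norm_integral_exp_sub_gaussian_le (b := b) (a := A) (κ := κ) (E := E) (Y := Y) hb0 hE0
    hY0 hEY hΛc (fun y _ => by
      have := norm_logM_sub_cubic_le hd ht y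
      refine le_trans (le_of_eq ?_) this
      congr 1
      rw [hΛ, hA, hκ, hb]
      push_cast
      ring)
  -- each error term is `O(t)`
  have q1 : A ^ 2 / b ≤ C1 / β * t := by
    have h3 := h1 t ht ht1
    have h4 : t * moment d 1 t - ∑ j ∈ Finset.Icc 1 d, macMahonC d j / t ^ j = -(t * A) := by
      rw [hA, ← hn, mul_sub, Finset.mul_sum]
      have : ∀ j ∈ Finset.Icc 1 d, t * (macMahonC d j / t ^ (j + 1)) = macMahonC d j / t ^ j :=
        fun j _ => by rw [pow_succ]; field_simp
      rw [Finset.sum_congr rfl this]; ring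
    rw [h4] at h3
    have h5 : (t * A) ^ 2 ≤ C1 * t * T := by
      calc (t * A) ^ 2 = (-(t * A)) ^ 2 * t ^ d * T := by rw [mul_assoc, mul_comm _ T, hTt]; ring
        _ ≤ C1 * t * T := by gcongr
    rw [div_le_iff₀ hb0]
    have h6 : t ^ 2 * A ^ 2 ≤ t ^ 2 * (C1 / β * t * b) := by
      calc t ^ 2 * A ^ 2 = (t * A) ^ 2 := by ring
        _ ≤ C1 * t * T := h5
        _ = C1 / β * t * (β * T) := by field_simp
        _ ≤ C1 / β * t * (t ^ 2 * b) := by gcongr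
        _ = _ := by ring
    exact le_of_mul_le_mul_left h6 (by positivity)
  have q2 : κ ^ 2 / b ^ 3 ≤ M3 ^ 2 / (36 * β ^ 3) * t := by
    have h3 : κ ^ 2 / b ^ 3 = (t ^ 3 * moment d 3 t) ^ 2 / (36 * (t ^ 2 * b) ^ 3) := by
      rw [hκ]; field_simp; ring
    rw [h3]
    have := moment_nonneg d 3 t
    calc _ ≤ (M3 * T) ^ 2 / (36 * (β * T) ^ 3) := by gcongr
      _ = M3 ^ 2 / (36 * β ^ 3) * T⁻¹ := by field_simp
      _ ≤ _ := by rw [hTinv]; gcongr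
  have q3 : E / b ^ 2 ≤ 4 * M4 / β ^ 2 * t := by
    have h3 : E / b ^ 2 = 4 * (t ^ 4 * moment d 4 t) / (t ^ 2 * b) ^ 2 := by
      rw [hE]; field_simp
    rw [h3]
    calc _ ≤ 4 * (M4 * T) / (β * T) ^ 2 := by gcongr
      _ = 4 * M4 / β ^ 2 * T⁻¹ := by field_simp
      _ ≤ _ := by rw [hTinv]; gcongr
  have q4 : 4 / (b * Y ^ 2) ≤ 4 / (δ ^ 2 * β) * t := by
    have h3 : b * Y ^ 2 = δ ^ 2 * (t ^ 2 * b) := by rw [hY]; ring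
    rw [h3]
    calc _ ≤ 4 / (δ ^ 2 * (β * T)) := by gcongr
      _ = 4 / (δ ^ 2 * β) * T⁻¹ := by field_simp
      _ ≤ _ := by rw [hTinv]; gcongr
  set g := Real.sqrt (2 * Real.pi / b) with hg
  have hg0 : 0 < g := Real.sqrt_pos.mpr (by positivity)
  have hloc2 : ‖(∫ y in (-Y)..Y, Complex.exp (Λ y)) - (g : ℝ)‖ ≤ g * (K1 * t) := by
    refine hloc.trans (mul_le_mul_of_nonneg_left ?_ hg0.le)
    calc _ = 2 * (48 * (A ^ 2 / b) + 18432 * (κ ^ 2 / b ^ 3) + 128 * (E / b ^ 2)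
          + 4 / (b * Y ^ 2)) := by ring
      _ ≤ 2 * (48 * (C1 / β * t) + 18432 * (M3 ^ 2 / (36 * β ^ 3) * t)
          + 128 * (4 * M4 / β ^ 2 * t) + 4 / (δ ^ 2 * β) * t) := by gcongr
      _ = K1 * t := by rw [hK1]; field_simp; ring
  -- the outer range
  have hΛre : ∀ y : ℝ, Y ≤ |y| → |y| ≤ Real.pi → ‖Complex.exp (Λ y)‖ ≤ Real.exp (-(c * T)) := by
    intro y hy1 hy2
    rw [Complex.norm_exp]
    refine Real.exp_le_exp.mpr ?_
    have := hout t ht ht1 y hy1 hy2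
    have e : (Λ y).re = (logM d (t + y * Complex.I)).re - moment d 0 t := by
      rw [hΛ]; simp
    rw [e]; linarith
  have hdiff := norm_integral_sub_integral_le (Complex.continuous_exp.comp hΛc) hY0 hYpi
    (Real.exp_pos _).le hΛre
  have hout2 := two_pi_mul_exp_le hd hc hM2 hb0 ht ht1 (hm2 t ht ht1)
  rw [← hT, ← hg, ← hK2] at hout2
  refine abs_div_sqrt_sub_one_le (I := ∫ y in (-Real.pi)..Real.pi, Complex.exp (Λ y)) hb0
    (Real.exp_pos _) ?_ ?_
  · rw [macMahonNumber_eq_integral hd n ht]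
    push_cast
    rw [mul_assoc]
    congr 1
    rw [← intervalIntegral.integral_const_mul]
    refine intervalIntegral.integral_congr (E := ℂ) fun y _ => ?_
    simp only [hΛ]
    rw [← Complex.exp_add]
    congr 1
    push_cast
    ring
  · have e3 : g * ((K1 + K2) * t) = g * (K2 * t) + g * (K1 * t) := by ring
    rw [← hg, e3]
    refine (norm_sub_le_norm_sub_add_norm_sub _ (∫ y in (-Y)..Y, Complex.exp (Λ y)) _).trans
      (add_le_add (hdiff.trans hout2) hloc2)

/-! ### The saddle point formula in terms of the main part -/

/-- The second derivative `∑ (k+1) C_k / t^(k+2)` of `macMahonG d n` at `t > 0`; it does not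
depend on `n`. -/
noncomputable def curvature (d : ℕ) (t : ℝ) : ℝ :=
  ∑ k ∈ Finset.Icc 1 d, (k + 1) * macMahonC d k / t ^ (k + 2)

lemma hasDerivAt_macMahonG (d n : ℕ) {t : ℝ} (ht : t ≠ 0) :
    HasDerivAt (macMahonG d n) (n - ∑ k ∈ Finset.Icc 1 d, macMahonC d k / t ^ (k + 1)) t := by
  have h : ∀ k ∈ Finset.Icc 1 d, HasDerivAt (fun t : ℝ => macMahonC d k / (k * t ^ k))
      (-(macMahonC d k / t ^ (k + 1))) t := fun k hk => by
    have hk1 := (Finset.mem_Icc.mp hk).1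
    have hk0 : (k : ℝ) ≠ 0 := by positivity
    obtain ⟨i, rfl⟩ := Nat.exists_eq_add_of_le' hk1
    refine (((hasDerivAt_const t (macMahonC d (i + 1))).div
      ((hasDerivAt_pow (i + 1) t).const_mul ((i + 1 : ℕ) : ℝ)) (by positivity))).congr_deriv ?_
    rw [Nat.add_sub_cancel]
    field_simp
    ring
  have h2 := (HasDerivAt.fun_sum h).add ((hasDerivAt_id t).const_mul (n : ℝ))
  refine h2.congr_deriv ?_
  rw [Finset.sum_neg_distrib]
  ring

lemma iteratedDeriv_two_macMahonG (d n : ℕ) {t : ℝ} (ht : 0 < t) :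
    iteratedDeriv 2 (macMahonG d n) t = curvature d t := by
  rw [iteratedDeriv_succ, iteratedDeriv_one]
  have h : deriv (macMahonG d n) =ᶠ[𝓝 t]
      fun t => n - ∑ k ∈ Finset.Icc 1 d, macMahonC d k / t ^ (k + 1) := by
    filter_upwards [eventually_ne_nhds ht.ne'] with u hu
    exact (hasDerivAt_macMahonG d n hu).deriv
  rw [h.deriv_eq]
  have h1 : ∀ k ∈ Finset.Icc 1 d, HasDerivAt (fun t : ℝ => macMahonC d k / t ^ (k + 1))
      (-((k + 1) * macMahonC d k / t ^ (k + 2))) t := fun k _ => by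
    refine (((hasDerivAt_const t (macMahonC d k)).div (hasDerivAt_pow (k + 1) t)
      (by positivity))).congr_deriv ?_
    rw [Nat.add_sub_cancel]
    field_simp
    push_cast
    ring
  have h2 := (HasDerivAt.fun_sum h1).const_sub (n : ℝ)
  rw [h2.deriv, curvature, Finset.sum_neg_distrib, neg_neg]

lemma curvature_pos {d : ℕ} (hd : 1 ≤ d) {t : ℝ} (ht : 0 < t) : 0 < curvature d t := by
  refine Finset.sum_pos' (fun k hk => ?_) ⟨d, Finset.mem_Icc.mpr ⟨hd, le_rfl⟩, ?_⟩
  · have := macMahonC_nonneg d (Finset.mem_Icc.mp hk).1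
    positivity
  · have := macMahonC_self_pos hd
    positivity

lemma abs_mul_sub_one_le {x y a b t : ℝ} (hx : |x - 1| ≤ a * t) (hy : |y - 1| ≤ b * t)
    (ht : 0 ≤ t) (ht1 : t ≤ 1) (ha : 0 ≤ a) (hb : 0 ≤ b) : |x * y - 1| ≤ (a + b + a * b) * t := by
  have h1 : x * y - 1 = (x - 1) + (y - 1) + (x - 1) * (y - 1) := by ring
  calc |x * y - 1| ≤ |x - 1| + |y - 1| + |x - 1| * |y - 1| := by
        rw [h1, ← abs_mul]; exact abs_add_three _ _ _
    _ ≤ a * t + b * t + (a * t) * (b * t) := by gcongr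
    _ ≤ a * t + b * t + (a * t) * (b * 1) := by gcongr
    _ = _ := by ring

lemma abs_sqrt_sub_one_le {x : ℝ} (hx : 0 ≤ x) : |Real.sqrt x - 1| ≤ |x - 1| := by
  have h : x - 1 = (Real.sqrt x - 1) * (Real.sqrt x + 1) := by
    nlinarith only [Real.sq_sqrt hx]
  rw [h, abs_mul]
  refine le_mul_of_one_le_right (abs_nonneg _) ?_
  rw [abs_of_nonneg (by positivity)]
  linarith [Real.sqrt_nonneg x]

/-- The saddle point formula with relative error `O(t)`, where `t` is the saddle point. -/
lemma exists_macMahonNumber_asymp {d : ℕ} (hd : 1 ≤ d) :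
    ∃ K t₀ : ℝ, 0 ≤ K ∧ 0 < t₀ ∧ t₀ ≤ 1 ∧ ∀ (n : ℕ) (t : ℝ), 0 < t → t ≤ t₀ →
      ∑ j ∈ Finset.Icc 1 d, macMahonC d j / t ^ (j + 1) = n →
      |macMahonNumber d n / (Real.sqrt (1 / (2 * Real.pi * curvature d t)) *
        Real.exp (logMain d t + n * t)) - 1| ≤ K * t := by
  obtain ⟨K, t₀, hK, ht₀, ht₀1, h⟩ := exists_macMahonNumber_asymp_moment hd
  obtain ⟨B, hB, hB'⟩ := exists_abs_moment_sub_logMain_le hd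
  obtain ⟨C, hC, h2⟩ := exists_moment_two_asymp hd
  have hcd := macMahonC_self_pos hd
  set β := macMahonC d d / 2 with hβ
  have hβ0 : 0 < β := by positivity
  refine ⟨(K + C / β + K * (C / β)) + 2 * B + (K + C / β + K * (C / β)) * (2 * B),
    min t₀ (1 / (B + 1)), by positivity, lt_min ht₀ (by positivity), (min_le_left _ _).trans ht₀1,
    fun n t ht htt hn => ?_⟩
  have htt₀ : t ≤ t₀ := htt.trans (min_le_left _ _)
  have ht1 : t ≤ 1 := htt₀.trans ht₀1
  have hBt : B * t ≤ 1 := by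
    have h3 : t ≤ 1 / (B + 1) := htt.trans (min_le_right _ _)
    rw [le_div_iff₀ (by positivity)] at h3
    nlinarith
  obtain ⟨hb2, hR⟩ := h n t ht htt₀ hn
  have hV := curvature_pos hd ht
  set b := moment d 2 t with hb
  set V := curvature d t with hVdef
  have htd : 0 < t ^ d := by positivity
  have hbT : 0 < t ^ 2 * b := (by positivity : 0 < β * (t ^ d)⁻¹).trans_le hb2
  have hb0 : 0 < b := pos_of_mul_pos_right hbT (by positivity)
  have hVb : |V / b - 1| ≤ C / β * t := by
    have e1 : ∑ j ∈ Finset.Icc 1 d, (j + 1) * macMahonC d j / t ^ j = t ^ 2 * V := by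
      rw [hVdef, curvature, Finset.mul_sum]
      refine Finset.sum_congr rfl fun j _ => ?_
      rw [pow_add]; field_simp
    have h3 := h2 t ht ht1
    rw [e1] at h3
    have e2 : V / b - 1 = -(t ^ 2 * b - t ^ 2 * V) / (t ^ 2 * b) := by field_simp; ring
    rw [e2, abs_div, abs_neg, abs_of_pos hbT, div_le_iff₀ hbT]
    calc |t ^ 2 * b - t ^ 2 * V| = |t ^ 2 * b - t ^ 2 * V| * t ^ d * (t ^ d)⁻¹ := by field_simp
      _ ≤ C * t * (t ^ d)⁻¹ := by gcongr
      _ = C / β * t * (β * (t ^ d)⁻¹) := by field_simp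
      _ ≤ _ := by gcongr
  have hsq := (abs_sqrt_sub_one_le (by positivity : 0 ≤ V / b)).trans hVb
  have hex : |Real.exp (moment d 0 t - logMain d t) - 1| ≤ 2 * B * t := by
    have h3 := hB' t ht
    have h4 := Real.abs_exp_sub_one_le (h3.trans hBt)
    linarith
  have key := abs_mul_sub_one_le (abs_mul_sub_one_le hR hsq ht.le ht1 hK (by positivity)) hex ht.le
    ht1 (by positivity) (by positivity)
  refine le_trans (le_of_eq ?_) key
  congr 2
  have e3 : Real.sqrt (1 / (2 * Real.pi * b)) =
      Real.sqrt (1 / (2 * Real.pi * V)) * Real.sqrt (V / b) := by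
    rw [← Real.sqrt_mul (by positivity)]; congr 1; field_simp
  have e4 : Real.exp (moment d 0 t + n * t) =
      Real.exp (logMain d t + n * t) * Real.exp (moment d 0 t - logMain d t) := by
    rw [← Real.exp_add]; congr 1; ring
  have h5 : 0 < Real.sqrt (V / b) := Real.sqrt_pos.mpr (by positivity)
  have h6 : 0 < Real.sqrt (1 / (2 * Real.pi * V)) := Real.sqrt_pos.mpr (by positivity)
  rw [e3, e4]
  field_simp

/-! ### The saddle point -/

lemma exists_saddle {d : ℕ} (hd : 1 ≤ d) {n : ℕ} (hn : 1 ≤ n) :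
    ∃ t : ℝ, 0 < t ∧ ∑ k ∈ Finset.Icc 1 d, macMahonC d k / t ^ (k + 1) = n := by
  set f : ℝ → ℝ := fun t => ∑ k ∈ Finset.Icc 1 d, macMahonC d k / t ^ (k + 1) with hf
  have hcd := macMahonC_self_pos hd
  have hn0 : (1 : ℝ) ≤ n := by exact_mod_cast hn
  set S := ∑ k ∈ Finset.Icc 1 d, macMahonC d k with hS
  have hcS : macMahonC d d ≤ S := Finset.single_le_sum (f := fun k => macMahonC d k)
    (fun k hk => macMahonC_nonneg d (Finset.mem_Icc.mp hk).1) (Finset.mem_Icc.mpr ⟨hd, le_rfl⟩)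
  -- the sum is at least `n` at `a` and at most `n` at `b`
  set a := min 1 (macMahonC d d / n) with ha
  have ha0 : 0 < a := lt_min one_pos (by positivity)
  have ha1 : a ≤ 1 := min_le_left _ _
  set b := max 1 S with hb
  have hb1 : 1 ≤ b := le_max_left _ _
  have hfa : (n : ℝ) ≤ f a := by
    have h1 : macMahonC d d / a ^ (d + 1) ≤ f a := Finset.single_le_sum
      (f := fun k : ℕ => macMahonC d k / a ^ (k + 1)) (fun k hk => by
        have := macMahonC_nonneg d (Finset.mem_Icc.mp hk).1
        positivity) (Finset.mem_Icc.mpr ⟨hd, le_rfl⟩)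
    refine le_trans ?_ h1
    rw [le_div_iff₀ (by positivity)]
    have h2 : a ^ (d + 1) ≤ a := by
      simpa using pow_le_pow_of_le_one ha0.le ha1 (Nat.le_add_left 1 d)
    calc (n : ℝ) * a ^ (d + 1) ≤ n * (macMahonC d d / n) := by
          gcongr; exact h2.trans (min_le_right _ _)
      _ = _ := by field_simp
  have hfb : f b ≤ n := by
    refine le_trans ?_ hn0
    have h1 : f b ≤ ∑ k ∈ Finset.Icc 1 d, macMahonC d k / b := by
      refine Finset.sum_le_sum fun k hk => ?_
      have := macMahonC_nonneg d (Finset.mem_Icc.mp hk).1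
      have h3 : b ≤ b ^ (k + 1) := le_self_pow₀ hb1 (by omega)
      gcongr
    refine h1.trans ?_
    rw [← Finset.sum_div, div_le_one (by positivity)]
    exact le_max_right _ _
  have hc : ContinuousOn f (Set.Icc a b) := by
    refine continuousOn_finsetSum _ fun k _ => ContinuousOn.div (by fun_prop) (by fun_prop) ?_
    intro x hx
    exact pow_ne_zero _ (ha0.trans_le hx.1).ne'
  obtain ⟨t, ht, h⟩ := intermediate_value_Icc' (ha1.trans hb1) hc ⟨hfb, hfa⟩
  exact ⟨t, ha0.trans_le ht.1, h⟩

lemma saddle_sum_strictAnti {d : ℕ} (hd : 1 ≤ d) {s t : ℝ} (hs : 0 < s) (hst : s < t) :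
    ∑ k ∈ Finset.Icc 1 d, macMahonC d k / t ^ (k + 1)
      < ∑ k ∈ Finset.Icc 1 d, macMahonC d k / s ^ (k + 1) := by
  refine Finset.sum_lt_sum (fun k hk => ?_) ⟨d, Finset.mem_Icc.mpr ⟨hd, le_rfl⟩, ?_⟩
  · have := macMahonC_nonneg d (Finset.mem_Icc.mp hk).1
    gcongr
  · have := macMahonC_self_pos hd
    gcongr

lemma saddle_unique {d : ℕ} (hd : 1 ≤ d) {s t x : ℝ} (hs : 0 < s) (ht : 0 < t)
    (h1 : ∑ k ∈ Finset.Icc 1 d, macMahonC d k / s ^ (k + 1) = x)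
    (h2 : ∑ k ∈ Finset.Icc 1 d, macMahonC d k / t ^ (k + 1) = x) : s = t := by
  rcases lt_trichotomy s t with h | h | h
  · linarith [saddle_sum_strictAnti hd hs h]
  · exact h
  · linarith [saddle_sum_strictAnti hd ht h]

lemma tendsto_saddle {d : ℕ} (hd : 1 ≤ d) {τ : ℕ → ℝ} (hτ : ∀ n, 1 ≤ n → 0 < τ n ∧
    ∑ k ∈ Finset.Icc 1 d, macMahonC d k / τ n ^ (k + 1) = n) :
    Tendsto τ atTop (𝓝[>] 0) := by
  refine tendsto_nhdsWithin_iff.mpr ⟨?_, ?_⟩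
  · refine Metric.tendsto_atTop.mpr fun ε hε => ?_
    obtain ⟨N, hN⟩ := exists_nat_gt (∑ k ∈ Finset.Icc 1 d, macMahonC d k / ε ^ (k + 1))
    refine ⟨N + 1, fun n hn => ?_⟩
    obtain ⟨h0, h1⟩ := hτ n (by omega)
    rw [Real.dist_0_eq_abs, abs_of_pos h0]
    by_contra! hcon
    have h2 : (N : ℝ) ≤ n := by exact_mod_cast (by omega : N ≤ n)
    rcases hcon.eq_or_lt with h | h
    · rw [h, h1] at hN; linarith
    · linarith [saddle_sum_strictAnti hd hε h]
  · filter_upwards [eventually_ge_atTop 1] with n hn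
    exact (hτ n hn).1

/-! ### The expansion of the logarithm -/

/-- The polynomial `P(t) = ∑ C_k t^(d-k)`; the saddle point equation is `n t^(d+1) = P(t)`. -/
noncomputable def saddlePoly (d : ℕ) (t : ℝ) : ℝ :=
  ∑ k ∈ Finset.Icc 1 d, macMahonC d k * t ^ (d - k)

/-- The polynomial `Q(t)` for which `macMahonG d n t = Q(t) / t^d` at the saddle point. -/
noncomputable def heightPoly (d : ℕ) (t : ℝ) : ℝ :=
  ∑ k ∈ Finset.Icc 1 d, macMahonC d k / k * t ^ (d - k) + saddlePoly d t

/-- The root `S = P^(1/(d+1))` of `saddlePoly`; at the saddle point `S(t) / t = n^(1/(d+1))`. -/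
noncomputable def saddleRoot (d : ℕ) (t : ℝ) : ℝ := Real.exp (Real.log (saddlePoly d t) / (d + 1))

lemma sum_Icc_mul_zero_pow {d : ℕ} (hd : 1 ≤ d) (c : ℕ → ℝ) :
    ∑ k ∈ Finset.Icc 1 d, c k * (0 : ℝ) ^ (d - k) = c d := by
  rw [Finset.sum_eq_single_of_mem d (Finset.mem_Icc.mpr ⟨hd, le_rfl⟩)]
  · simp
  · intro k hk hkd
    have := (Finset.mem_Icc.mp hk).2
    rw [zero_pow (by omega), mul_zero]

lemma saddlePoly_zero {d : ℕ} (hd : 1 ≤ d) : saddlePoly d 0 = macMahonC d d :=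
  sum_Icc_mul_zero_pow hd _

lemma heightPoly_zero {d : ℕ} (hd : 1 ≤ d) :
    heightPoly d 0 = macMahonC d d / d + macMahonC d d := by
  rw [heightPoly, saddlePoly_zero hd, sum_Icc_mul_zero_pow hd]

lemma continuous_saddlePoly (d : ℕ) : Continuous (saddlePoly d) := by
  unfold saddlePoly; fun_prop

lemma saddlePoly_pos {d : ℕ} (hd : 1 ≤ d) {t : ℝ} (ht : 0 ≤ t) : 0 < saddlePoly d t := by
  refine Finset.sum_pos' (fun k hk => ?_) ⟨d, Finset.mem_Icc.mpr ⟨hd, le_rfl⟩, ?_⟩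
  · have := macMahonC_nonneg d (Finset.mem_Icc.mp hk).1
    positivity
  · have := macMahonC_self_pos hd
    simpa using this

lemma saddleRoot_pos (d : ℕ) (t : ℝ) : 0 < saddleRoot d t := Real.exp_pos _

lemma saddleRoot_pow {d : ℕ} (hd : 1 ≤ d) {t : ℝ} (ht : 0 ≤ t) :
    saddleRoot d t ^ (d + 1) = saddlePoly d t := by
  rw [saddleRoot, ← Real.exp_nat_mul]
  have : (((d + 1 : ℕ) : ℝ)) * (Real.log (saddlePoly d t) / (d + 1))
      = Real.log (saddlePoly d t) := by
    push_cast; field_simp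
  rw [this, Real.exp_log (saddlePoly_pos hd ht)]

lemma saddleRoot_zero {d : ℕ} (hd : 1 ≤ d) :
    saddleRoot d 0 = macMahonC d d ^ (1 / ((d : ℝ) + 1)) := by
  rw [saddleRoot, saddlePoly_zero hd, Real.rpow_def_of_pos (macMahonC_self_pos hd), mul_one_div]

lemma analyticAt_heightPoly (d : ℕ) : AnalyticAt ℝ (heightPoly d) 0 := by
  unfold heightPoly saddlePoly; fun_prop

lemma analyticAt_saddleRoot {d : ℕ} (hd : 1 ≤ d) : AnalyticAt ℝ (saddleRoot d) 0 := by
  have h : AnalyticAt ℝ (saddlePoly d) 0 := by unfold saddlePoly; fun_prop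
  have h1 := h.log (saddlePoly_pos hd le_rfl)
  exact (h1.div analyticAt_const (by positivity)).rexp'

/-- A Taylor expansion in which the powers of `t` are accompanied by powers of a fixed function
that does not vanish at `0`. -/
lemma exists_taylor_mul_pow {f S : ℝ → ℝ} (hf : AnalyticAt ℝ f 0) (hS : AnalyticAt ℝ S 0)
    (hS0 : S 0 ≠ 0) (m : ℕ → ℕ) (N : ℕ) :
    ∃ (b : ℕ → ℝ) (g : ℝ → ℝ), AnalyticAt ℝ g 0 ∧
      ∀ t, f t = ∑ i ∈ Finset.range N, b i * (t ^ i * S t ^ m i) + t ^ N * g t := by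
  induction N with
  | zero => exact ⟨fun _ => 0, f, hf, fun t => by simp⟩
  | succ N ih =>
    obtain ⟨b, g, hg, h⟩ := ih
    set c := g 0 / S 0 ^ m N with hc
    set u : ℝ → ℝ := fun t => g t - c * S t ^ m N with hu
    have hua : AnalyticAt ℝ u 0 := hg.sub (analyticAt_const.mul (hS.pow _))
    have hu0 : u 0 = 0 := by
      simp only [hu, hc]
      rw [div_mul_cancel₀ _ (pow_ne_zero _ hS0), sub_self]
    refine ⟨fun i => if i = N then c else b i, dslope u 0, analyticAt_dslope hua, fun t => ?_⟩
    have h1 := sub_smul_dslope u 0 t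
    rw [sub_zero, smul_eq_mul, hu0, sub_zero] at h1
    have h2 : ∑ i ∈ Finset.range N, (if i = N then c else b i) * (t ^ i * S t ^ m i)
        = ∑ i ∈ Finset.range N, b i * (t ^ i * S t ^ m i) :=
      Finset.sum_congr rfl fun i hi => by rw [if_neg (Finset.mem_range.mp hi).ne]
    rw [h t, Finset.sum_range_succ, h2, pow_succ, mul_assoc, h1]
    simp only [hu, if_true]
    ring

lemma macMahonG_saddle {d n : ℕ} {t : ℝ} (ht : 0 < t)
    (hn : ∑ k ∈ Finset.Icc 1 d, macMahonC d k / t ^ (k + 1) = n) :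
    n * t ^ (d + 1) = saddlePoly d t ∧ macMahonG d n t = heightPoly d t / t ^ d := by
  have hP : n * t ^ (d + 1) = saddlePoly d t := by
    rw [← hn, Finset.sum_mul, saddlePoly]
    refine Finset.sum_congr rfl fun k hk => ?_
    have e : d + 1 = (d - k) + (k + 1) := by have := (Finset.mem_Icc.mp hk).2; omega
    rw [e, pow_add t (d - k)]
    field_simp
  refine ⟨hP, ?_⟩
  rw [heightPoly, ← hP, macMahonG, add_div, Finset.sum_div]
  congr 1
  · refine Finset.sum_congr rfl fun k hk => ?_
    have e : t ^ d = t ^ (d - k) * t ^ k := by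
      rw [← pow_add]; congr 1; have := (Finset.mem_Icc.mp hk).2; omega
    rw [e]
    field_simp
  · rw [pow_succ]; field_simp

/-- The powers of the root `S` divided by powers of `t` become powers of `n` at the saddle
point. -/
lemma saddleRoot_div_pow {d n : ℕ} (hd : 1 ≤ d) {t : ℝ} (ht : 0 < t)
    (hP : n * t ^ (d + 1) = saddlePoly d t) {i : ℕ} (hi : i ≤ d) :
    t ^ i * saddleRoot d t ^ (d - i) / t ^ d = (n : ℝ) ^ (((d : ℝ) - i) / (d + 1)) := by
  set S := saddleRoot d t with hS
  have hS0 : 0 < S := saddleRoot_pos d t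
  have h1 : (S / t) ^ (d + 1) = n := by
    rw [div_pow, saddleRoot_pow hd ht.le, ← hP]; field_simp
  have h2 : ((n : ℝ)) ^ (((d : ℝ) - i) / (d + 1)) = (S / t) ^ (d - i) := by
    rw [← h1, ← Real.rpow_natCast, ← Real.rpow_mul (by positivity), ← Real.rpow_natCast]
    congr 1
    push_cast [Nat.cast_sub hi]
    field_simp
  rw [h2, div_pow]
  have e : t ^ d = t ^ i * t ^ (d - i) := by rw [← pow_add]; congr 1; omega
  rw [e]
  field_simp

lemma curvature_eq {d : ℕ} {t : ℝ} (ht : 0 < t) :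
    curvature d t = (∑ k ∈ Finset.Icc 1 d, (k + 1) * macMahonC d k * t ^ (d - k)) / t ^ (d + 2) := by
  rw [curvature, Finset.sum_div]
  refine Finset.sum_congr rfl fun k hk => ?_
  have e : t ^ (d + 2) = t ^ (d - k) * t ^ (k + 2) := by
    rw [← pow_add]; congr 1; have := (Finset.mem_Icc.mp hk).2; omega
  rw [e]
  field_simp

/-- `b` is the list of coefficients in the expansion of `heightPoly` in powers of `t` and of
`saddleRoot`. Divided by `t^d` and evaluated at the saddle point, this is the expansion of
`macMahonG` in powers of `n^(1/(d+1))`. -/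
def IsHeightExpansion (d : ℕ) (b : ℕ → ℝ) : Prop :=
  ∃ g : ℝ → ℝ, AnalyticAt ℝ g 0 ∧ ∀ t, heightPoly d t =
    ∑ i ∈ Finset.range (d + 1), b i * (t ^ i * saddleRoot d t ^ (d - i)) + t ^ (d + 1) * g t

lemma exists_isHeightExpansion {d : ℕ} (hd : 1 ≤ d) : ∃ b, IsHeightExpansion d b :=
  exists_taylor_mul_pow (analyticAt_heightPoly d) (analyticAt_saddleRoot hd)
    (saddleRoot_pos d 0).ne' (fun i => d - i) (d + 1)

lemma IsHeightExpansion.coeff_zero {d : ℕ} (hd : 1 ≤ d) {b : ℕ → ℝ} (hb : IsHeightExpansion d b) :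
    b 0 = ((d : ℝ) + 1) / d * (d * zetaR (d + 1)) ^ (1 / ((d : ℝ) + 1)) := by
  obtain ⟨g, -, hg⟩ := hb
  have hd0 : (d : ℝ) ≠ 0 := by positivity
  have h := hg 0
  rw [Finset.sum_eq_single_of_mem 0 (by simp) (fun i _ hi => by rw [zero_pow hi]; ring),
    heightPoly_zero hd, zero_pow d.succ_ne_zero, ← saddlePoly_zero hd, ← saddleRoot_pow hd le_rfl] at h
  rw [← macMahonC_self hd, ← saddleRoot_zero hd]
  have hS := (saddleRoot_pos d 0).ne'
  simp only [pow_zero, one_mul, Nat.sub_zero, zero_mul, add_zero] at h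
  have h2 : b 0 * saddleRoot d 0 ^ d =
      ((d : ℝ) + 1) / d * saddleRoot d 0 * saddleRoot d 0 ^ d := by
    rw [← h, pow_succ]; field_simp; ring
  exact mul_right_cancel₀ (pow_ne_zero _ hS) h2

/-- The saddle point formula along a sequence of saddle points, which eventually lie in the range
where the formula is valid. -/
lemma exists_eventually_abs_ratio_sub_one_le {d : ℕ} (hd : 1 ≤ d) {τ : ℕ → ℝ}
    (hτ : ∀ n, 1 ≤ n → 0 < τ n ∧ ∑ k ∈ Finset.Icc 1 d, macMahonC d k / τ n ^ (k + 1) = n) :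
    ∃ K, ∀ᶠ n in atTop, τ n ≤ 1 ∧
      |macMahonNumber d n / (Real.sqrt (1 / (2 * Real.pi * curvature d (τ n))) *
        Real.exp (logMain d (τ n) + n * τ n)) - 1| ≤ K * τ n := by
  obtain ⟨K, t₀, -, ht₀, ht₀1, h⟩ := exists_macMahonNumber_asymp hd
  refine ⟨K, ?_⟩
  have h1 := (tendsto_nhdsWithin_iff.mp (tendsto_saddle hd hτ)).1
  filter_upwards [eventually_ge_atTop 1, h1.eventually (eventually_le_nhds ht₀)] with n hn hn2
  exact ⟨hn2.trans ht₀1, h n _ (hτ n hn).1 hn2 (hτ n hn).2⟩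

/-- The exact logarithm of the saddle point approximation, with `log t` eliminated by the saddle
point equation `log n + (d + 1) log t = log P(t)`. -/
lemma log_saddle_approx {d n : ℕ} (hd : 1 ≤ d) {t : ℝ} (ht : 0 < t) (hn1 : 1 ≤ n)
    (hn : ∑ k ∈ Finset.Icc 1 d, macMahonC d k / t ^ (k + 1) = n) {b : ℕ → ℝ} {g : ℝ → ℝ}
    (hg : ∀ t, heightPoly d t =
      ∑ i ∈ Finset.range (d + 1), b i * (t ^ i * saddleRoot d t ^ (d - i)) + t ^ (d + 1) * g t) :
    Real.log (Real.sqrt (1 / (2 * Real.pi * curvature d t)) * Real.exp (logMain d t + n * t)) =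
      ∑ r ∈ Finset.Icc 1 d, b (r - 1) * (n : ℝ) ^ (((d : ℝ) - r + 1) / ((d : ℝ) + 1))
        + ((macMahonDirichlet d 0).re - ((d : ℝ) + 2) / 2) / (d + 1) * Real.log n
        + (b d + (deriv (macMahonDirichlet d) 0).re - Real.log (2 * Real.pi) / 2
          - Real.log (∑ k ∈ Finset.Icc 1 d, (k + 1) * macMahonC d k * t ^ (d - k)) / 2
          - ((macMahonDirichlet d 0).re - ((d : ℝ) + 2) / 2) / (d + 1)
            * Real.log (saddlePoly d t)) + t * g t := by
  obtain ⟨hP, hG⟩ := macMahonG_saddle ht hn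
  have hV := curvature_pos hd ht
  have hn0 : (0 : ℝ) < n := by exact_mod_cast hn1
  have hpi := Real.pi_pos
  have hlog : Real.log n + (d + 1) * Real.log t = Real.log (saddlePoly d t) := by
    rw [← hP, Real.log_mul hn0.ne' (by positivity), Real.log_pow]; push_cast; ring
  have hVlog : Real.log (curvature d t)
      = Real.log (∑ k ∈ Finset.Icc 1 d, (k + 1) * macMahonC d k * t ^ (d - k))
        - (d + 2) * Real.log t := by
    have h1 := curvature_eq (d := d) ht
    have h2 : ∑ k ∈ Finset.Icc 1 d, (k + 1) * macMahonC d k * t ^ (d - k) ≠ 0 := by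
      intro h0; rw [h0, zero_div] at h1; exact hV.ne' h1
    rw [h1, Real.log_div h2 (by positivity), Real.log_pow]; push_cast; ring
  have hmain : logMain d t + n * t = macMahonG d n t - (macMahonDirichlet d 0).re * Real.log t
      + (deriv (macMahonDirichlet d) 0).re := by
    rw [logMain, macMahonG]; ring
  have hsum : macMahonG d n t =
      ∑ r ∈ Finset.Icc 1 d, b (r - 1) * (n : ℝ) ^ (((d : ℝ) - r + 1) / ((d : ℝ) + 1))
        + b d + t * g t := by
    have h1 : ∑ r ∈ Finset.Icc 1 d, b (r - 1) * (n : ℝ) ^ (((d : ℝ) - r + 1) / ((d : ℝ) + 1))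
        = ∑ i ∈ Finset.range d, b i * (t ^ i * saddleRoot d t ^ (d - i)) / t ^ d := by
      refine Finset.sum_nbij' (fun r => r - 1) (fun i => i + 1) ?_ ?_ ?_ ?_ ?_
      · intro r hr; have := Finset.mem_Icc.mp hr; rw [Finset.mem_range]; omega
      · intro i hi; have := Finset.mem_range.mp hi; rw [Finset.mem_Icc]; omega
      · intro r hr; have := Finset.mem_Icc.mp hr; omega
      · intro i _; omega
      · intro r hr
        have hr1 := Finset.mem_Icc.mp hr
        obtain ⟨i, rfl⟩ := Nat.exists_eq_add_of_le' hr1.1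
        rw [Nat.add_sub_cancel, mul_div_assoc, saddleRoot_div_pow hd ht hP (by omega)]
        push_cast
        ring_nf
    rw [hG, hg, add_div, Finset.sum_div, Finset.sum_range_succ, h1, Nat.sub_self]
    field_simp
    ring
  rw [Real.log_mul (Real.sqrt_pos.mpr (by positivity)).ne' (Real.exp_pos _).ne', Real.log_exp,
    Real.log_sqrt (by positivity), one_div, Real.log_inv, Real.log_mul (by positivity) hV.ne', hmain,
    hsum, hVlog, ← hlog]
  field_simp
  ring

lemma tendsto_log_macMahonNumber {d : ℕ} (hd : 1 ≤ d) {b : ℕ → ℝ} (hb : IsHeightExpansion d b) :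
    Tendsto (fun n : ℕ => Real.log (macMahonNumber d n) -
        (∑ r ∈ Finset.Icc 1 d, b (r - 1) * (n : ℝ) ^ (((d : ℝ) - r + 1) / ((d : ℝ) + 1))
          + ((macMahonDirichlet d 0).re - ((d : ℝ) + 2) / 2) / (d + 1) * Real.log n
          + (b d + (deriv (macMahonDirichlet d) 0).re - Real.log (2 * Real.pi) / 2
            - Real.log (((d : ℝ) + 1) * macMahonC d d) / 2
            - ((macMahonDirichlet d 0).re - ((d : ℝ) + 2) / 2) / (d + 1)
              * Real.log (macMahonC d d)))) atTop (𝓝 0) := by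
  obtain ⟨g, hga, hg⟩ := hb
  choose! τ hτ using fun n (hn : 1 ≤ n) => exists_saddle hd hn
  have hτ0 := (tendsto_nhdsWithin_iff.mp (tendsto_saddle hd hτ)).1
  obtain ⟨K, hK⟩ := exists_eventually_abs_ratio_sub_one_le hd hτ
  set W : ℕ → ℝ := fun n => Real.sqrt (1 / (2 * Real.pi * curvature d (τ n))) *
    Real.exp (logMain d (τ n) + n * τ n) with hW
  have hratio : Tendsto (fun n => macMahonNumber d n / W n) atTop (𝓝 1) := by
    have h1 : Tendsto (fun n => macMahonNumber d n / W n - 1) atTop (𝓝 0) :=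
      squeeze_zero_norm' (hK.mono fun n hn => hn.2)
        (by simpa using hτ0.const_mul K)
    simpa using h1.add_const 1
  have hlr : Tendsto (fun n => Real.log (macMahonNumber d n / W n)) atTop (𝓝 0) := by
    simpa using hratio.log one_ne_zero
  set c := ((macMahonDirichlet d 0).re - ((d : ℝ) + 2) / 2) / (d + 1) with hc
  have hcd := macMahonC_self_pos hd
  have hP : Tendsto (fun n => Real.log (saddlePoly d (τ n))) atTop (𝓝 (Real.log (macMahonC d d))) := by
    have h1 := ((continuous_saddlePoly d).tendsto 0).comp hτ0
    rw [saddlePoly_zero hd] at h1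
    exact h1.log hcd.ne'
  have hR : Tendsto (fun n => Real.log (∑ k ∈ Finset.Icc 1 d,
      (k + 1) * macMahonC d k * τ n ^ (d - k))) atTop
      (𝓝 (Real.log (((d : ℝ) + 1) * macMahonC d d))) := by
    have h0 : Continuous fun t : ℝ => ∑ k ∈ Finset.Icc 1 d, (k + 1) * macMahonC d k * t ^ (d - k) := by
      fun_prop
    have h1 := (h0.tendsto 0).comp hτ0
    rw [sum_Icc_mul_zero_pow hd fun k => (k + 1) * macMahonC d k] at h1
    exact h1.log (by positivity)
  have hgt : Tendsto (fun n => τ n * g (τ n)) atTop (𝓝 0) := by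
    simpa using hτ0.mul (hga.continuousAt.tendsto.comp hτ0)
  have hall := ((hlr.add hgt).sub ((hR.sub_const (Real.log (((d : ℝ) + 1) * macMahonC d d))).div_const 2)).sub
    ((hP.sub_const (Real.log (macMahonC d d))).const_mul c)
  simp only [sub_self, zero_div, mul_zero, add_zero] at hall
  refine hall.congr' ?_
  filter_upwards [eventually_ge_atTop 1, hratio.eventually (eventually_gt_nhds one_pos)] with n hn hr
  obtain ⟨ht, hsad⟩ := hτ n hn
  have hpi := Real.pi_pos
  have hV := curvature_pos hd ht
  have hW0 : 0 < W n := mul_pos (Real.sqrt_pos.mpr (by positivity)) (Real.exp_pos _)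
  have h1 := log_saddle_approx hd ht hn hsad hg
  have h2 : Real.log (macMahonNumber d n) = Real.log (macMahonNumber d n / W n) + Real.log (W n) := by
    rw [← Real.log_mul hr.ne' hW0.ne', div_mul_cancel₀ _ hW0.ne']
  rw [h2]
  simp only [hW]
  rw [h1]
  ring

/-- The error `O(t)` is `O(t^α)` for every `α < 1`, as the saddle point tends to `0`. -/
lemma saddle_formula_isBigO {d : ℕ} (hd : 1 ≤ d) {τ : ℕ → ℝ}
    (hτ : ∀ n, 1 ≤ n → 0 < τ n ∧ ∑ k ∈ Finset.Icc 1 d, macMahonC d k / τ n ^ (k + 1) = n)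
    {α : ℝ} (hα : α < 1) :
    (fun n : ℕ => macMahonNumber d n /
        (Real.sqrt (1 / (2 * Real.pi * iteratedDeriv 2 (macMahonG d n) (τ n)))
          * τ n ^ (-(macMahonDirichlet d 0).re)
          * Real.exp (macMahonG d n (τ n) + (deriv (macMahonDirichlet d) 0).re)) - 1)
      =O[atTop] fun n : ℕ => τ n ^ α := by
  obtain ⟨K, hK⟩ := exists_eventually_abs_ratio_sub_one_le hd hτ
  refine IsBigO.of_bound |K| ?_
  filter_upwards [hK, eventually_ge_atTop 1] with n ⟨h1, h2⟩ hn
  have ht := (hτ n hn).1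
  have e : Real.sqrt (1 / (2 * Real.pi * iteratedDeriv 2 (macMahonG d n) (τ n)))
          * τ n ^ (-(macMahonDirichlet d 0).re)
          * Real.exp (macMahonG d n (τ n) + (deriv (macMahonDirichlet d) 0).re)
      = Real.sqrt (1 / (2 * Real.pi * curvature d (τ n))) *
        Real.exp (logMain d (τ n) + n * τ n) := by
    rw [iteratedDeriv_two_macMahonG d n ht, Real.rpow_def_of_pos ht, mul_assoc, ← Real.exp_add,
      logMain, macMahonG]
    congr 2
    ring
  have h3 : τ n ≤ τ n ^ α := by
    simpa using Real.rpow_le_rpow_of_exponent_ge ht h1 hα.le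
  rw [e, Real.norm_eq_abs, Real.norm_of_nonneg (by positivity)]
  calc _ ≤ K * τ n := h2
    _ ≤ |K| * τ n ^ α := by gcongr; exact le_abs_self K

/-! ### Uniqueness of the coefficients -/

/-- Uniqueness of coefficients for expansions as in `exists_taylor_mul_pow`. -/
lemma eq_zero_of_sum_isBigO {f : ℕ → ℝ → ℝ} (hf : ∀ i, ContinuousAt (f i) 0)
    (hf0 : ∀ i, f i 0 ≠ 0) (c : ℕ → ℝ) (N : ℕ)
    (h : (fun t => ∑ i ∈ Finset.range N, c i * (t ^ i * f i t)) =O[𝓝[>] 0] fun t : ℝ => t ^ N) :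
    ∀ i < N, c i = 0 := by
  induction N with
  | zero => intro i hi; omega
  | succ N ih =>
    have hfb : ∀ i, f i =O[𝓝[>] 0] fun _ => (1 : ℝ) := fun i =>
      ((hf i).tendsto.mono_left nhdsWithin_le_nhds).isBigO_one ℝ
    have hlast : (fun t => c N * (t ^ N * f N t)) =O[𝓝[>] 0] fun t : ℝ => t ^ N := by
      simpa using (((isBigO_refl (fun t : ℝ => t ^ N) (𝓝[>] 0)).mul (hfb N)).const_mul_left (c N))
    have hpow : (fun t : ℝ => t ^ (N + 1)) =O[𝓝[>] 0] fun t : ℝ => t ^ N := by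
      have h1 : (fun t : ℝ => t) =O[𝓝[>] 0] fun _ => (1 : ℝ) :=
        (tendsto_id.mono_left nhdsWithin_le_nhds : Tendsto (fun t : ℝ => t) (𝓝[>] 0) (𝓝 0)).isBigO_one ℝ
      simpa [pow_succ] using (isBigO_refl (fun t : ℝ => t ^ N) (𝓝[>] 0)).mul h1
    have hlow := ih (((h.trans hpow).sub hlast).congr_left fun t => by
      rw [Finset.sum_range_succ, add_sub_cancel_right])
    have hN : c N = 0 := by
      have h1 : (fun t => c N * (t ^ N * f N t)) =O[𝓝[>] 0] fun t : ℝ => t ^ (N + 1) := by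
        refine h.congr_left fun t => ?_
        rw [Finset.sum_range_succ, Finset.sum_eq_zero, zero_add]
        intro i hi
        rw [hlow i (Finset.mem_range.mp hi), zero_mul]
      obtain ⟨C, hC⟩ := h1.bound
      have h2 : Tendsto (fun t => c N * f N t) (𝓝[>] 0) (𝓝 0) := by
        refine squeeze_zero_norm' (a := fun t => C * t) ?_ ?_
        · filter_upwards [hC, self_mem_nhdsWithin] with t ht (ht0 : 0 < t)
          have h3 : 0 < t ^ N := by positivity
          rw [show c N * (t ^ N * f N t) = t ^ N * (c N * f N t) by ring, norm_mul,
            Real.norm_of_nonneg h3.le, Real.norm_of_nonneg (by positivity : 0 ≤ t ^ (N + 1)),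
            pow_succ] at ht
          refine le_of_mul_le_mul_left (ht.trans_eq ?_) h3
          ring
        · have : Tendsto (fun t : ℝ => C * t) (𝓝 0) (𝓝 (C * 0)) := tendsto_id.const_mul C
          rw [mul_zero] at this
          exact this.mono_left nhdsWithin_le_nhds
      have h3 : Tendsto (fun t => c N * f N t) (𝓝[>] 0) (𝓝 (c N * f N 0)) :=
        ((hf N).tendsto.mono_left nhdsWithin_le_nhds).const_mul _
      exact (mul_eq_zero.mp (tendsto_nhds_unique h3 h2)).resolve_right (hf0 N)
    intro i hi
    rcases Nat.lt_succ_iff_lt_or_eq.mp hi with h1 | rfl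
    · exact hlow i h1
    · exact hN

/-- The coefficients of the expansion may be computed with any approximate root `q` of
`saddlePoly` in place of the exact one. -/
lemma IsHeightExpansion.coeff_eq {d : ℕ} (hd : 1 ≤ d) {b : ℕ → ℝ} (hb : IsHeightExpansion d b)
    {q : ℝ → ℝ} (hq : Continuous q) (hq0 : 0 < q 0)
    (hqP : (fun t => q t ^ (d + 1) - saddlePoly d t) =O[𝓝[>] 0] fun t : ℝ => t ^ d)
    {b' : ℕ → ℝ}
    (hb' : (fun t => heightPoly d t - ∑ i ∈ Finset.range d, b' i * (t ^ i * q t ^ (d - i)))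
      =O[𝓝[>] 0] fun t : ℝ => t ^ d) :
    ∀ i < d, b i = b' i := by
  obtain ⟨g, hga, hg⟩ := hb
  set S := saddleRoot d with hS
  have hSc : Tendsto S (𝓝[>] 0) (𝓝 (S 0)) :=
    (analyticAt_saddleRoot hd).continuousAt.tendsto.mono_left nhdsWithin_le_nhds
  have hqc : Tendsto q (𝓝[>] 0) (𝓝 (q 0)) := (hq.tendsto 0).mono_left nhdsWithin_le_nhds
  have hone : ∀ {f : ℝ → ℝ} {x : ℝ}, Tendsto f (𝓝[>] 0) (𝓝 x) →
      f =O[𝓝[>] 0] fun _ => (1 : ℝ) := fun h => h.isBigO_one ℝ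
  -- the two roots differ by `O(t^d)`
  have hSq : (fun t => S t - q t) =O[𝓝[>] 0] fun t : ℝ => t ^ d := by
    set u : ℝ → ℝ := fun t => ∑ i ∈ Finset.range (d + 1), S t ^ i * q t ^ (d - i) with hu
    have hut : Tendsto u (𝓝[>] 0) (𝓝 (∑ i ∈ Finset.range (d + 1), S 0 ^ i * q 0 ^ (d - i))) :=
      tendsto_finsetSum _ fun i _ => (hSc.pow i).mul (hqc.pow _)
    have hu0 : (∑ i ∈ Finset.range (d + 1), S 0 ^ i * q 0 ^ (d - i)) ≠ 0 := by
      refine (Finset.sum_pos (fun i _ => ?_) (by simp)).ne'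
      have := saddleRoot_pos d 0
      positivity
    have h1 : ∀ᶠ t in 𝓝[>] 0, -(q t ^ (d + 1) - saddlePoly d t) * (u t)⁻¹ = S t - q t := by
      filter_upwards [hut.eventually_ne hu0, self_mem_nhdsWithin] with t hut0 (ht : 0 < t)
      have h2 := (Commute.all (S t) (q t)).geom_sum₂_mul (d + 1)
      rw [saddleRoot_pow hd ht.le] at h2
      rw [neg_sub, ← h2, mul_comm, ← mul_assoc]
      simp only [Nat.add_sub_cancel] at *
      rw [inv_mul_cancel₀ hut0, one_mul]
    have h2 := hqP.neg_left.mul (hone (hut.inv₀ hu0))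
    simp only [mul_one] at h2
    exact h2.congr' h1 EventuallyEq.rfl
  have hpow : ∀ m : ℕ, (fun t => S t ^ m - q t ^ m) =O[𝓝[>] 0] fun t : ℝ => t ^ d := fun m => by
    have h1 := (hone (tendsto_finsetSum (Finset.range m) fun i _ =>
      (hSc.pow i).mul (hqc.pow (m - 1 - i)))).mul hSq
    simp only [one_mul] at h1
    exact h1.congr_left fun t => (Commute.all (S t) (q t)).geom_sum₂_mul m
  have htpow : ∀ i : ℕ, (fun t : ℝ => t ^ i) =O[𝓝[>] 0] fun _ => (1 : ℝ) := fun i =>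
    hone (((continuous_pow i).tendsto 0).mono_left nhdsWithin_le_nhds)
  have hkey : (fun t => ∑ i ∈ Finset.range d, (b i - b' i) * (t ^ i * q t ^ (d - i)))
      =O[𝓝[>] 0] fun t : ℝ => t ^ d := by
    have h1 : (fun t => ∑ i ∈ Finset.range d, b i * (t ^ i * (S t ^ (d - i) - q t ^ (d - i))))
        =O[𝓝[>] 0] fun t : ℝ => t ^ d := by
      refine IsBigO.fun_sum fun i _ => ?_
      have := ((htpow i).mul (hpow (d - i))).const_mul_left (b i)
      simpa only [one_mul] using this
    have h2 : (fun t => b d * t ^ d + t ^ d * (t * g t)) =O[𝓝[>] 0] fun t : ℝ => t ^ d := by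
      refine ((isBigO_refl _ _).const_mul_left _).add ?_
      have h3 := hga.continuousAt.tendsto.mono_left (nhdsWithin_le_nhds (s := Set.Ioi 0))
      have := (isBigO_refl (fun t : ℝ => t ^ d) (𝓝[>] 0)).mul ((htpow 1).mul (hone h3))
      simpa using this
    refine ((hb'.sub h1).sub h2).congr_left fun t => ?_
    rw [hg t, Finset.sum_range_succ, Nat.sub_self, pow_zero]
    have h3 : ∑ i ∈ Finset.range d, b i * (t ^ i * (S t ^ (d - i) - q t ^ (d - i)))
        = ∑ i ∈ Finset.range d, b i * (t ^ i * S t ^ (d - i))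
          - ∑ i ∈ Finset.range d, b i * (t ^ i * q t ^ (d - i)) := by
      rw [← Finset.sum_sub_distrib]
      exact Finset.sum_congr rfl fun i _ => by ring
    have h4 : ∑ i ∈ Finset.range d, (b i - b' i) * (t ^ i * q t ^ (d - i))
        = ∑ i ∈ Finset.range d, b i * (t ^ i * q t ^ (d - i))
          - ∑ i ∈ Finset.range d, b' i * (t ^ i * q t ^ (d - i)) := by
      rw [← Finset.sum_sub_distrib]
      exact Finset.sum_congr rfl fun i _ => by ring
    rw [h3, h4]
    ring
  intro i hi
  exact sub_eq_zero.mp (eq_zero_of_sum_isBigO (f := fun i t => q t ^ (d - i))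
    (fun i => (hq.pow _).continuousAt) (fun i => (pow_pos hq0 _).ne') (fun i => b i - b' i) d hkey i hi)

lemma IsHeightExpansion.coeff_eq_of_remainder {d : ℕ} (hd : 1 ≤ d) {b : ℕ → ℝ}
    (hb : IsHeightExpansion d b) {q r₁ r₂ : ℝ → ℝ} (hq : Continuous q) (hq0 : 0 < q 0)
    (hr₁ : Continuous r₁) (hr₂ : Continuous r₂) {b' : ℕ → ℝ}
    (h₁ : ∀ t, q t ^ (d + 1) = saddlePoly d t + t ^ d * r₁ t)
    (h₂ : ∀ t, heightPoly d t
      = ∑ i ∈ Finset.range d, b' i * (t ^ i * q t ^ (d - i)) + t ^ d * r₂ t) :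
    ∀ i < d, b i = b' i := by
  have key : ∀ {r : ℝ → ℝ}, Continuous r →
      (fun t : ℝ => t ^ d * r t) =O[𝓝[>] 0] fun t : ℝ => t ^ d := fun hr => by
    simpa using (isBigO_refl (fun t : ℝ => t ^ d) (𝓝[>] 0)).mul
      (((hr.tendsto 0).mono_left nhdsWithin_le_nhds).isBigO_one ℝ)
  refine hb.coeff_eq hd hq hq0 ((key hr₁).congr_left fun t => ?_) ((key hr₂).congr_left fun t => ?_)
  · rw [h₁ t, add_sub_cancel_left]
  · rw [h₂ t, add_sub_cancel_left]

lemma pow_rpow_div {θ : ℝ} (hθ : 0 < θ) {m k : ℕ} {x : ℝ} (h : m * x = k) :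
    (θ ^ m) ^ x = θ ^ k := by
  rw [← Real.rpow_natCast, ← Real.rpow_mul hθ.le, h, Real.rpow_natCast]

/-! ### The coefficients for `d = 3, 4, 5`

The approximate root of `saddlePoly` is `θ (1 + t u)`, where `θ ^ (d + 1) = C_d` and where
`a₁, a₂, …` are the coefficients of the polynomial `u` of degree `d - 2`; the other `C_k` are
polynomials in `θ` and the `a_i`. The list `b'` comes from Lagrange inversion: its `i`-th entry is
`(d + 1) / ((d - i) (i + 1))` times the coefficient of `t ^ i` in `(θ (1 + t u)) ^ (i + 1)`. In the
remainders, `u = a₁ + t v` and, for `d = 5`, `v = a₂ + t w`. -/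

lemma IsHeightExpansion.coeff_three {b : ℕ → ℝ} (hb : IsHeightExpansion 3 b) {C1 C2 C3 : ℝ}
    (h1 : C1 = macMahonC 3 1) (h2 : C2 = macMahonC 3 2) (h3 : C3 = macMahonC 3 3) :
    b 0 = 4 / 3 * C3 ^ (1 / 4 : ℝ) ∧ b 1 = C2 / (2 * C3 ^ (2 / 4 : ℝ)) ∧
      b 2 = (8 * C1 * C3 - C2 ^ 2) / (8 * C3 ^ (5 / 4 : ℝ)) := by
  have hC : 0 < C3 := h3 ▸ macMahonC_self_pos (by norm_num)
  obtain ⟨θ, hθ, rfl⟩ : ∃ θ : ℝ, 0 < θ ∧ C3 = θ ^ 4 :=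
    ⟨C3 ^ (1 / 4 : ℝ), by positivity, by rw [← Real.rpow_natCast, ← Real.rpow_mul hC.le]; norm_num⟩
  obtain ⟨a₁, rfl⟩ : ∃ a, C2 = θ ^ 4 * (4 * a) := ⟨C2 / (4 * θ ^ 4), by field_simp⟩
  obtain ⟨a₂, rfl⟩ : ∃ a, C1 = θ ^ 4 * (4 * a + 6 * a₁ ^ 2) :=
    ⟨(C1 / θ ^ 4 - 6 * a₁ ^ 2) / 4, by field_simp; ring⟩
  have key := hb.coeff_eq_of_remainder (by norm_num)
    (q := fun t => θ * (1 + t * (a₁ + t * a₂)))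
    (r₁ := fun t => let u := a₁ + t * a₂
      θ ^ 4 * (6 * (2 * a₁ * a₂ + t * a₂ ^ 2) + 4 * u ^ 3 + t * u ^ 4))
    (r₂ := fun t => let u := a₁ + t * a₂
      θ ^ 4 * -(4 / 3 * (3 * (2 * a₁ * a₂ + t * a₂ ^ 2) + u ^ 3) + 2 * a₁ * (2 * a₂ + u ^ 2)
        + 4 * (a₂ + a₁ ^ 2) * u))
    (b' := fun i => [4 / 3 * θ, 2 * a₁ * θ ^ 2, 4 * (a₂ + a₁ ^ 2) * θ ^ 3].getD i 0)
    (by fun_prop) (by simpa using hθ) (by fun_prop) (by fun_prop)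
    (fun t => by
      simp only [saddlePoly, Finset.sum_Icc_succ_top, Nat.reduceAdd, Nat.reduceLeDiff,
        Finset.Icc_self, Finset.sum_singleton, ← h1, ← h2, ← h3, Nat.reduceSub]
      ring)
    (fun t => by
      simp only [heightPoly, saddlePoly, Finset.sum_Icc_succ_top, Nat.reduceAdd, Nat.reduceLeDiff,
        Finset.Icc_self, Finset.sum_singleton, ← h1, ← h2, ← h3, Nat.reduceSub,
        Finset.sum_range_succ, Finset.sum_range_zero, List.getD_cons_zero, List.getD_cons_succ]
      push_cast
      ring)
  refine ⟨(key 0 (by norm_num)).trans ?_, (key 1 (by norm_num)).trans ?_,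
    (key 2 (by norm_num)).trans ?_⟩
  · rw [pow_rpow_div hθ (k := 1) (by norm_num)]; simp
  · rw [pow_rpow_div hθ (k := 2) (by norm_num)]
    simp only [List.getD_cons_zero, List.getD_cons_succ]
    field_simp; ring
  · rw [pow_rpow_div hθ (k := 5) (by norm_num)]
    simp only [List.getD_cons_zero, List.getD_cons_succ]
    field_simp; ring

lemma IsHeightExpansion.coeff_four {b : ℕ → ℝ} (hb : IsHeightExpansion 4 b) {C1 C2 C3 C4 : ℝ}
    (h1 : C1 = macMahonC 4 1) (h2 : C2 = macMahonC 4 2) (h3 : C3 = macMahonC 4 3)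
    (h4 : C4 = macMahonC 4 4) :
    b 0 = 5 / 4 * C4 ^ (1 / 5 : ℝ) ∧ b 1 = C3 / (3 * C4 ^ (3 / 5 : ℝ)) ∧
      b 2 = (5 * C2 * C4 - C3 ^ 2) / (10 * C4 ^ (7 / 5 : ℝ)) ∧
      b 3 = (C3 ^ 3 - 5 * C2 * C4 * C3 + 25 * C1 * C4 ^ 2) / (25 * C4 ^ (11 / 5 : ℝ)) := by
  have hC : 0 < C4 := h4 ▸ macMahonC_self_pos (by norm_num)
  obtain ⟨θ, hθ, rfl⟩ : ∃ θ : ℝ, 0 < θ ∧ C4 = θ ^ 5 :=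
    ⟨C4 ^ (1 / 5 : ℝ), by positivity, by rw [← Real.rpow_natCast, ← Real.rpow_mul hC.le]; norm_num⟩
  obtain ⟨a₁, rfl⟩ : ∃ a, C3 = θ ^ 5 * (5 * a) := ⟨C3 / (5 * θ ^ 5), by field_simp⟩
  obtain ⟨a₂, rfl⟩ : ∃ a, C2 = θ ^ 5 * (5 * a + 10 * a₁ ^ 2) :=
    ⟨(C2 / θ ^ 5 - 10 * a₁ ^ 2) / 5, by field_simp; ring⟩
  obtain ⟨a₃, rfl⟩ : ∃ a, C1 = θ ^ 5 * (5 * a + 20 * a₁ * a₂ + 10 * a₁ ^ 3) :=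
    ⟨(C1 / θ ^ 5 - 20 * a₁ * a₂ - 10 * a₁ ^ 3) / 5, by field_simp; ring⟩
  have key := hb.coeff_eq_of_remainder (by norm_num)
    (q := fun t => θ * (1 + t * (a₁ + t * (a₂ + t * a₃))))
    (r₁ := fun t => let v := a₂ + t * a₃
      let u := a₁ + t * v
      θ ^ 5 * (10 * (2 * a₁ * a₃ + v ^ 2)
        + 10 * (3 * a₁ ^ 2 * v + 3 * a₁ * t * v ^ 2 + t ^ 2 * v ^ 3) + 5 * u ^ 4 + t * u ^ 5))
    (r₂ := fun t => let v := a₂ + t * a₃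
      let u := a₁ + t * v
      θ ^ 5 * -(5 / 4 * (6 * (2 * a₁ * a₃ + v ^ 2)
          + 4 * (3 * a₁ ^ 2 * v + 3 * a₁ * t * v ^ 2 + t ^ 2 * v ^ 3) + u ^ 4)
        + 5 / 3 * a₁ * (3 * a₃ + 3 * (2 * a₁ * a₂ + t * (2 * a₁ * a₃ + v ^ 2)) + u ^ 3)
        + 5 / 2 * (a₂ + a₁ ^ 2) * (2 * v + u ^ 2)
        + 5 * (a₃ + 3 * a₁ * a₂ + a₁ ^ 3) * u))
    (b' := fun i => [5 / 4 * θ, 5 / 3 * a₁ * θ ^ 2, 5 / 2 * (a₂ + a₁ ^ 2) * θ ^ 3,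
      5 * (a₃ + 3 * a₁ * a₂ + a₁ ^ 3) * θ ^ 4].getD i 0)
    (by fun_prop) (by simpa using hθ) (by fun_prop) (by fun_prop)
    (fun t => by
      simp only [saddlePoly, Finset.sum_Icc_succ_top, Nat.reduceAdd, Nat.reduceLeDiff,
        Finset.Icc_self, Finset.sum_singleton, ← h1, ← h2, ← h3, ← h4, Nat.reduceSub]
      ring)
    (fun t => by
      simp only [heightPoly, saddlePoly, Finset.sum_Icc_succ_top, Nat.reduceAdd, Nat.reduceLeDiff,
        Finset.Icc_self, Finset.sum_singleton, ← h1, ← h2, ← h3, ← h4, Nat.reduceSub,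
        Finset.sum_range_succ, Finset.sum_range_zero, List.getD_cons_zero, List.getD_cons_succ]
      push_cast
      ring)
  refine ⟨(key 0 (by norm_num)).trans ?_, (key 1 (by norm_num)).trans ?_,
    (key 2 (by norm_num)).trans ?_, (key 3 (by norm_num)).trans ?_⟩
  · rw [pow_rpow_div hθ (k := 1) (by norm_num)]; simp
  · rw [pow_rpow_div hθ (k := 3) (by norm_num)]
    simp only [List.getD_cons_zero, List.getD_cons_succ]
    field_simp
  · rw [pow_rpow_div hθ (k := 7) (by norm_num)]
    simp only [List.getD_cons_zero, List.getD_cons_succ]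
    field_simp; ring
  · rw [pow_rpow_div hθ (k := 11) (by norm_num)]
    simp only [List.getD_cons_zero, List.getD_cons_succ]
    field_simp; ring

lemma IsHeightExpansion.coeff_five {b : ℕ → ℝ} (hb : IsHeightExpansion 5 b) {C1 C2 C3 C4 C5 : ℝ}
    (h1 : C1 = macMahonC 5 1) (h2 : C2 = macMahonC 5 2) (h3 : C3 = macMahonC 5 3)
    (h4 : C4 = macMahonC 5 4) (h5 : C5 = macMahonC 5 5) :
    b 0 = 6 / 5 * C5 ^ (1 / 6 : ℝ) ∧ b 1 = C4 / (4 * C5 ^ (2 / 3 : ℝ)) ∧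
      b 2 = (4 * C3 * C5 - C4 ^ 2) / (12 * C5 ^ (3 / 2 : ℝ)) ∧
      b 3 = (2 * C4 ^ 3 - 9 * C3 * C5 * C4 + 27 * C2 * C5 ^ 2) / (54 * C5 ^ (7 / 3 : ℝ)) ∧
      b 4 = (-91 * C4 ^ 4 + 504 * C3 * C5 * C4 ^ 2 - 864 * C2 * C5 ^ 2 * C4
              + 432 * C5 ^ 2 * (12 * C1 * C5 - C3 ^ 2)) / (5184 * C5 ^ (19 / 6 : ℝ)) := by
  have hC : 0 < C5 := h5 ▸ macMahonC_self_pos (by norm_num)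
  obtain ⟨θ, hθ, rfl⟩ : ∃ θ : ℝ, 0 < θ ∧ C5 = θ ^ 6 :=
    ⟨C5 ^ (1 / 6 : ℝ), by positivity, by rw [← Real.rpow_natCast, ← Real.rpow_mul hC.le]; norm_num⟩
  obtain ⟨a₁, rfl⟩ : ∃ a, C4 = θ ^ 6 * (6 * a) := ⟨C4 / (6 * θ ^ 6), by field_simp⟩
  obtain ⟨a₂, rfl⟩ : ∃ a, C3 = θ ^ 6 * (6 * a + 15 * a₁ ^ 2) :=
    ⟨(C3 / θ ^ 6 - 15 * a₁ ^ 2) / 6, by field_simp; ring⟩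
  obtain ⟨a₃, rfl⟩ : ∃ a, C2 = θ ^ 6 * (6 * a + 30 * a₁ * a₂ + 20 * a₁ ^ 3) :=
    ⟨(C2 / θ ^ 6 - 30 * a₁ * a₂ - 20 * a₁ ^ 3) / 6, by field_simp; ring⟩
  obtain ⟨a₄, rfl⟩ : ∃ a, C1 = θ ^ 6 * (6 * a + 30 * a₁ * a₃ + 15 * a₂ ^ 2 + 60 * a₁ ^ 2 * a₂
      + 15 * a₁ ^ 4) :=
    ⟨(C1 / θ ^ 6 - 30 * a₁ * a₃ - 15 * a₂ ^ 2 - 60 * a₁ ^ 2 * a₂ - 15 * a₁ ^ 4) / 6,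
      by field_simp; ring⟩
  have key := hb.coeff_eq_of_remainder (by norm_num)
    (q := fun t => θ * (1 + t * (a₁ + t * (a₂ + t * (a₃ + t * a₄)))))
    (r₁ := fun t => let w := a₃ + t * a₄
      let v := a₂ + t * w
      let u := a₁ + t * v
      θ ^ 6 * (15 * (2 * a₁ * a₄ + 2 * a₂ * w + t * w ^ 2)
        + 20 * (3 * a₁ ^ 2 * w + 3 * a₁ * v ^ 2 + t * v ^ 3)
        + 15 * (4 * a₁ ^ 3 * v + 6 * a₁ ^ 2 * t * v ^ 2 + 4 * a₁ * t ^ 2 * v ^ 3 + t ^ 3 * v ^ 4)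
        + 6 * u ^ 5 + t * u ^ 6))
    (r₂ := fun t => let w := a₃ + t * a₄
      let v := a₂ + t * w
      let u := a₁ + t * v
      θ ^ 6 * -(6 / 5 * (10 * (2 * a₁ * a₄ + 2 * a₂ * w + t * w ^ 2)
          + 10 * (3 * a₁ ^ 2 * w + 3 * a₁ * v ^ 2 + t * v ^ 3)
          + 5 * (4 * a₁ ^ 3 * v + 6 * a₁ ^ 2 * t * v ^ 2 + 4 * a₁ * t ^ 2 * v ^ 3 + t ^ 3 * v ^ 4)
          + u ^ 5)
        + 3 / 2 * a₁ * (4 * a₄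
          + 6 * (2 * a₁ * a₃ + a₂ ^ 2 + t * (2 * a₁ * a₄ + 2 * a₂ * w + t * w ^ 2))
          + 4 * (3 * a₁ ^ 2 * a₂ + t * (3 * a₁ ^ 2 * w + 3 * a₁ * v ^ 2 + t * v ^ 3)) + u ^ 4)
        + 2 * (a₂ + a₁ ^ 2) * (3 * w + 3 * (2 * a₁ * a₂
          + t * (2 * a₁ * a₃ + a₂ ^ 2 + t * (2 * a₁ * a₄ + 2 * a₂ * w + t * w ^ 2))) + u ^ 3)
        + 3 * (a₃ + 3 * a₁ * a₂ + a₁ ^ 3) * (2 * v + u ^ 2)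
        + 6 * (a₄ + 4 * a₁ * a₃ + 2 * a₂ ^ 2 + 6 * a₁ ^ 2 * a₂ + a₁ ^ 4) * u))
    (b' := fun i => [6 / 5 * θ, 3 / 2 * a₁ * θ ^ 2, 2 * (a₂ + a₁ ^ 2) * θ ^ 3,
      3 * (a₃ + 3 * a₁ * a₂ + a₁ ^ 3) * θ ^ 4,
      6 * (a₄ + 4 * a₁ * a₃ + 2 * a₂ ^ 2 + 6 * a₁ ^ 2 * a₂ + a₁ ^ 4) * θ ^ 5].getD i 0)
    (by fun_prop) (by simpa using hθ) (by fun_prop) (by fun_prop)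
    (fun t => by
      simp only [saddlePoly, Finset.sum_Icc_succ_top, Nat.reduceAdd, Nat.reduceLeDiff,
        Finset.Icc_self, Finset.sum_singleton, ← h1, ← h2, ← h3, ← h4, ← h5, Nat.reduceSub]
      ring)
    (fun t => by
      simp only [heightPoly, saddlePoly, Finset.sum_Icc_succ_top, Nat.reduceAdd, Nat.reduceLeDiff,
        Finset.Icc_self, Finset.sum_singleton, ← h1, ← h2, ← h3, ← h4, ← h5, Nat.reduceSub,
        Finset.sum_range_succ, Finset.sum_range_zero, List.getD_cons_zero, List.getD_cons_succ]
      push_cast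
      ring)
  refine ⟨(key 0 (by norm_num)).trans ?_, (key 1 (by norm_num)).trans ?_,
    (key 2 (by norm_num)).trans ?_, (key 3 (by norm_num)).trans ?_, (key 4 (by norm_num)).trans ?_⟩
  · rw [pow_rpow_div hθ (k := 1) (by norm_num)]; simp
  · rw [pow_rpow_div hθ (k := 4) (by norm_num)]
    simp only [List.getD_cons_zero, List.getD_cons_succ]
    field_simp; ring
  · rw [pow_rpow_div hθ (k := 9) (by norm_num)]
    simp only [List.getD_cons_zero, List.getD_cons_succ]
    field_simp; ring
  · rw [pow_rpow_div hθ (k := 14) (by norm_num)]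
    simp only [List.getD_cons_zero, List.getD_cons_succ]
    field_simp; ring
  · rw [pow_rpow_div hθ (k := 19) (by norm_num)]
    simp only [List.getD_cons_zero, List.getD_cons_succ]
    field_simp; ring

/-! ### Explicit values of `C_k` and of `D_d(0)` -/

lemma macMahonPoly_three : macMahonPoly 3 =
    Polynomial.C (1 / 2) * Polynomial.X + Polynomial.C (1 / 2) * Polynomial.X ^ 2 := by
  refine Polynomial.funext fun x => ?_
  simp [macMahonPoly, ascPochhammer_succ_right]
  ring

lemma macMahonPoly_four : macMahonPoly 4 = Polynomial.C (1 / 3) * Polynomial.X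
    + Polynomial.C (1 / 2) * Polynomial.X ^ 2 + Polynomial.C (1 / 6) * Polynomial.X ^ 3 := by
  refine Polynomial.funext fun x => ?_
  simp [macMahonPoly, ascPochhammer_succ_right, Nat.factorial]
  ring

lemma macMahonPoly_five : macMahonPoly 5 = Polynomial.C (1 / 4) * Polynomial.X
    + Polynomial.C (11 / 24) * Polynomial.X ^ 2 + Polynomial.C (1 / 4) * Polynomial.X ^ 3
    + Polynomial.C (1 / 24) * Polynomial.X ^ 4 := by
  refine Polynomial.funext fun x => ?_
  simp [macMahonPoly, ascPochhammer_succ_right, Nat.factorial]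
  ring

lemma macMahonC_eq (d k : ℕ) :
    macMahonC d (k + 1) = (macMahonPoly d).coeff k * (k + 1).factorial * zetaR (k + 2) := by
  rw [macMahonC, macMahonResidue, Nat.add_sub_cancel, Real.Gamma_nat_eq_factorial]

lemma macMahonC_three : macMahonC 3 1 = 0 ∧ macMahonC 3 2 = zetaR 3 ∧
    macMahonC 3 3 = 3 * zetaR 4 := by
  refine ⟨?_, ?_, ?_⟩ <;> rw [macMahonC_eq, macMahonPoly_three] <;>
    simp [Polynomial.coeff_X, Polynomial.coeff_X_pow, Nat.factorial, -mul_eq_mul_left_iff,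
      -mul_eq_mul_right_iff, -one_div]
  ring

lemma macMahonC_four : macMahonC 4 1 = 0 ∧ macMahonC 4 2 = 2 * zetaR 3 / 3 ∧
    macMahonC 4 3 = 3 * zetaR 4 ∧ macMahonC 4 4 = 4 * zetaR 5 := by
  refine ⟨?_, ?_, ?_, ?_⟩ <;> rw [macMahonC_eq, macMahonPoly_four] <;>
    simp [Polynomial.coeff_X, Polynomial.coeff_X_pow, Nat.factorial, -mul_eq_mul_left_iff,
      -mul_eq_mul_right_iff, -one_div] <;> ring

lemma macMahonC_five : macMahonC 5 1 = 0 ∧ macMahonC 5 2 = 1 / 2 * zetaR 3 ∧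
    macMahonC 5 3 = 11 / 4 * zetaR 4 ∧ macMahonC 5 4 = 6 * zetaR 5 ∧
    macMahonC 5 5 = 5 * zetaR 6 := by
  refine ⟨?_, ?_, ?_, ?_, ?_⟩ <;> rw [macMahonC_eq, macMahonPoly_five] <;>
    simp [Polynomial.coeff_X, Polynomial.coeff_X_pow, Nat.factorial, -mul_eq_mul_left_iff,
      -mul_eq_mul_right_iff, -one_div] <;> ring

lemma riemannZeta_neg_one : riemannZeta (-1) = -1 / 12 := by
  have h := riemannZeta_neg_nat_eq_bernoulli' 1
  norm_num [bernoulli'_two] at h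
  rw [h]; norm_num

lemma riemannZeta_neg_two : riemannZeta (-2) = 0 := by
  have h := riemannZeta_neg_nat_eq_bernoulli' 2
  norm_num [bernoulli'_three] at h
  exact h

lemma riemannZeta_neg_three : riemannZeta (-3) = 1 / 120 := by
  have h := riemannZeta_neg_nat_eq_bernoulli' 3
  norm_num [bernoulli'_four] at h
  rw [h]

lemma riemannZeta_neg_four : riemannZeta (-4) = 0 := by
  have h := riemannZeta_neg_two_mul_nat_add_one 1
  norm_num at h
  exact h

lemma macMahonDirichlet_three_zero : (macMahonDirichlet 3 0).re = -1 / 24 := by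
  have h : macMahonDirichlet 3 0 = ((-1 / 24 : ℝ) : ℂ) := by
    simp [macMahonDirichlet, macMahonPoly_three, Finset.sum_range_succ, Polynomial.coeff_X,
      Polynomial.coeff_X_pow, riemannZeta_neg_one, riemannZeta_neg_two]
    norm_num
  rw [h, Complex.ofReal_re]

lemma macMahonDirichlet_four_zero : (macMahonDirichlet 4 0).re = -19 / 720 := by
  have h : macMahonDirichlet 4 0 = ((-19 / 720 : ℝ) : ℂ) := by
    simp [macMahonDirichlet, macMahonPoly_four, Finset.sum_range_succ, Polynomial.coeff_X,
      Polynomial.coeff_X_pow, riemannZeta_neg_one, riemannZeta_neg_two, riemannZeta_neg_three]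
    norm_num
  rw [h, Complex.ofReal_re]

lemma macMahonDirichlet_five_zero : (macMahonDirichlet 5 0).re = -3 / 160 := by
  have h : macMahonDirichlet 5 0 = ((-3 / 160 : ℝ) : ℂ) := by
    simp [macMahonDirichlet, macMahonPoly_five, Finset.sum_range_succ, Polynomial.coeff_X,
      Polynomial.coeff_X_pow, riemannZeta_neg_one, riemannZeta_neg_two, riemannZeta_neg_three,
      riemannZeta_neg_four]
    norm_num
  rw [h, Complex.ofReal_re]

end MacMahon

theorem mainTheorem2 :
    ∃ (β : ℕ → ℕ → ℝ) (γ δ : ℕ → ℝ),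
      -- the asymptotic expansion in every dimension, with its leading constant
      (∀ d : ℕ, 1 ≤ d →
        β d 1 = ((d : ℝ) + 1) / d * ((d : ℝ) * zetaR (d + 1)) ^ (1 / ((d : ℝ) + 1)) ∧
        Tendsto (fun n : ℕ => Real.log (macMahonNumber d n) -
            (∑ r ∈ Finset.Icc 1 d, β d r * (n : ℝ) ^ (((d : ℝ) - r + 1) / ((d : ℝ) + 1))
              + γ d * Real.log n + δ d))
          atTop (𝓝 0)) ∧
      -- the saddle point formula in every dimension
      (∀ d : ℕ, 1 ≤ d → ∃ tstar : ℕ → ℝ,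
        (∀ n : ℕ, 1 ≤ n →
          0 < tstar n ∧
          ∑ k ∈ Finset.Icc 1 d, macMahonC d k / tstar n ^ (k + 1) - n = 0 ∧
          ∀ t : ℝ, 0 < t → ∑ k ∈ Finset.Icc 1 d, macMahonC d k / t ^ (k + 1) - n = 0 →
            t = tstar n) ∧
        ∀ α : ℝ, 0 < α → α < 1 →
          (fun n : ℕ => macMahonNumber d n /
              (Real.sqrt (1 / (2 * Real.pi * iteratedDeriv 2 (macMahonG d n) (tstar n)))
                * tstar n ^ (-(macMahonDirichlet d 0).re)
                * Real.exp (macMahonG d n (tstar n) + (deriv (macMahonDirichlet d) 0).re)) - 1)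
            =O[atTop] fun n : ℕ => tstar n ^ α) ∧
      -- dimension 3
      (macMahonC 3 1 = 0 ∧ macMahonC 3 2 = zetaR 3 ∧ macMahonC 3 3 = 3 * zetaR 4 ∧
        (∀ C1 C2 C3 : ℝ, C1 = macMahonC 3 1 → C2 = macMahonC 3 2 → C3 = macMahonC 3 3 →
          β 3 1 = 4 / 3 * C3 ^ (1 / 4 : ℝ) ∧
          β 3 2 = C2 / (2 * C3 ^ (2 / 4 : ℝ)) ∧
          β 3 3 = (8 * C1 * C3 - C2 ^ 2) / (8 * C3 ^ (5 / 4 : ℝ))) ∧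
        γ 3 = -61 / 96) ∧
      -- dimension 4
      (macMahonC 4 1 = 0 ∧ macMahonC 4 2 = 2 * zetaR 3 / 3 ∧ macMahonC 4 3 = 3 * zetaR 4 ∧
        macMahonC 4 4 = 4 * zetaR 5 ∧
        (∀ C1 C2 C3 C4 : ℝ, C1 = macMahonC 4 1 → C2 = macMahonC 4 2 → C3 = macMahonC 4 3 →
          C4 = macMahonC 4 4 →
          β 4 1 = 5 / 4 * C4 ^ (1 / 5 : ℝ) ∧
          β 4 2 = C3 / (3 * C4 ^ (3 / 5 : ℝ)) ∧
          β 4 3 = (5 * C2 * C4 - C3 ^ 2) / (10 * C4 ^ (7 / 5 : ℝ)) ∧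
          β 4 4 = (C3 ^ 3 - 5 * C2 * C4 * C3 + 25 * C1 * C4 ^ 2) / (25 * C4 ^ (11 / 5 : ℝ))) ∧
        γ 4 = -2179 / 3600) ∧
      -- dimension 5
      (macMahonC 5 1 = 0 ∧ macMahonC 5 2 = 1 / 2 * zetaR 3 ∧ macMahonC 5 3 = 11 / 4 * zetaR 4 ∧
        macMahonC 5 4 = 6 * zetaR 5 ∧ macMahonC 5 5 = 5 * zetaR 6 ∧
        (∀ C1 C2 C3 C4 C5 : ℝ, C1 = macMahonC 5 1 → C2 = macMahonC 5 2 → C3 = macMahonC 5 3 →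
          C4 = macMahonC 5 4 → C5 = macMahonC 5 5 →
          β 5 1 = 6 / 5 * C5 ^ (1 / 6 : ℝ) ∧
          β 5 2 = C4 / (4 * C5 ^ (2 / 3 : ℝ)) ∧
          β 5 3 = (4 * C3 * C5 - C4 ^ 2) / (12 * C5 ^ (3 / 2 : ℝ)) ∧
          β 5 4 = (2 * C4 ^ 3 - 9 * C3 * C5 * C4 + 27 * C2 * C5 ^ 2)
            / (54 * C5 ^ (7 / 3 : ℝ)) ∧
          β 5 5 = (-91 * C4 ^ 4 + 504 * C3 * C5 * C4 ^ 2 - 864 * C2 * C5 ^ 2 * C4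
              + 432 * C5 ^ 2 * (12 * C1 * C5 - C3 ^ 2)) / (5184 * C5 ^ (19 / 6 : ℝ))) ∧
        γ 5 = -563 / 960) := by
  choose b hb using fun d : ℕ => show ∃ b : ℕ → ℝ, 1 ≤ d → MacMahon.IsHeightExpansion d b by
    by_cases hd : 1 ≤ d
    · obtain ⟨b, h⟩ := MacMahon.exists_isHeightExpansion hd
      exact ⟨b, fun _ => h⟩
    · exact ⟨0, fun h => absurd h hd⟩
  refine ⟨fun d r => b d (r - 1),
    fun d => ((macMahonDirichlet d 0).re - ((d : ℝ) + 2) / 2) / (d + 1),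
    fun d => b d d + (deriv (macMahonDirichlet d) 0).re - Real.log (2 * Real.pi) / 2
      - Real.log (((d : ℝ) + 1) * macMahonC d d) / 2
      - ((macMahonDirichlet d 0).re - ((d : ℝ) + 2) / 2) / (d + 1) * Real.log (macMahonC d d),
    fun d hd => ⟨(hb d hd).coeff_zero hd, MacMahon.tendsto_log_macMahonNumber hd (hb d hd)⟩,
    fun d hd => ?_, ?_, ?_, ?_⟩
  · choose! τ hτ using fun n (hn : 1 ≤ n) => MacMahon.exists_saddle hd hn
    exact ⟨τ, fun n hn => ⟨(hτ n hn).1, sub_eq_zero.mpr (hτ n hn).2, fun t ht h =>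
      MacMahon.saddle_unique hd ht (hτ n hn).1 (sub_eq_zero.mp h) (hτ n hn).2⟩,
      fun α _ hα => MacMahon.saddle_formula_isBigO hd hτ hα⟩
  · obtain ⟨h1, h2, h3⟩ := MacMahon.macMahonC_three
    refine ⟨h1, h2, h3, fun C1 C2 C3 e1 e2 e3 => (hb 3 (by norm_num)).coeff_three e1 e2 e3, ?_⟩
    simp only [MacMahon.macMahonDirichlet_three_zero]
    norm_num
  · obtain ⟨h1, h2, h3, h4⟩ := MacMahon.macMahonC_four
    refine ⟨h1, h2, h3, h4,
      fun C1 C2 C3 C4 e1 e2 e3 e4 => (hb 4 (by norm_num)).coeff_four e1 e2 e3 e4, ?_⟩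
    simp only [MacMahon.macMahonDirichlet_four_zero]
    norm_num
  · obtain ⟨h1, h2, h3, h4, h5⟩ := MacMahon.macMahonC_five
    refine ⟨h1, h2, h3, h4, h5,
      fun C1 C2 C3 C4 C5 e1 e2 e3 e4 e5 => (hb 5 (by norm_num)).coeff_five e1 e2 e3 e4 e5, ?_⟩
    simp only [MacMahon.macMahonDirichlet_five_zero]
    norm_num
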